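/- Let $G$ be a finite simple undirected graph with $n\ge 2$ vertices. A \emph{cycle} of $G$ is a sequence $\langle v_1,\dots,v_k\rangle$ of $k\ge 3$ distinct vertices with $v_iv_{i+1}\in E(G)$ for $1\le i<k$ and $v_kv_1\in E(G)$; sequences that differ by rotation or reversal describe the same cycle. It is \emph{chordless} if every edge of $G$ between two of its vertices is one of these $k$ edges. $G$ is \emph{cyclically orientable} (CO) if its edges can be oriented so that every chordless cycle becomes a directed cycle. A graph is \emph{two-connected} if it has at least two vertices, is connected, and remains connected after the removal of any one vertex; the two-connected components of $G$ are its maximal two-connected subgraphs (a single edge can be one, an isolated vertex is not). Algorithm ChordlessCyclesCOGraph, on input $G$: 1. If $|E(G)|>2|V(G)|-3$, or $|E(G_i)|>2|V(G_i)|-3$ for some two-connected component $G_i$ of $G$, return NO. Otherwise set $C\leftarrow\varnothing$. 2. For each two-connected component $G_i$ of $G$ that is not a single edge (in any order), do the following on a working copy of $G_i$. Initially every vertex $v$ is white, $\mathrm{degree}(v)$ is its degree in $G_i$, $\mathrm{key}(v)=\langle v\rangle$, and $F$ is a queue containing the vertices with $\mathrm{degree}(v)=2$ (in any order). While $F\ne\varnothing$,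 remove the first element $u$ of $F$; if $u$ is white: (a) Set $P\leftarrow\langle\rangle$, $y\leftarrow u$, and $x\leftarrow a$ for some white neighbor $a$ of $u$. (b) While $\mathrm{degree}(x)=2$ and $x$ has a white neighbor $a'$ other than the vertex from which $x$ was reached: remove $x$ from $F$, color $x$ gray, set $P\leftarrow\langle\mathrm{key}(x),P\rangle$, $x\leftarrow a'$. (c) While $\mathrm{degree}(y)=2$ and $y$ has a white neighbor $b$ other than the vertex from which $y$ was reached (other than $a$ at the first pass, when $y=u$): remove $y$ from $F$, color $y$ gray, set $P\leftarrow\langle P,\mathrm{key}(y)\rangle$, $y\leftarrow b$. (d) If $x\neq y$ and $x,y$ are adjacent: add $\langle\mathrm{key}(x),P,\mathrm{key}(y)\rangle$ to $C$, decrease $\mathrm{degree}(x)$ and $\mathrm{degree}(y)$ by $1$, and append to $F$ each of $x,y$ whose degree is now $2$. If $x\ne y$ are not adjacent: create a new white vertex $w$ of degree $2$, adjacent to $x$ and $y$, with $\mathrm{key}(w)=P$. If $x=y$: add $\langle\mathrm{key}(x),P\rangle$ to $C$ and color $x$ gray. (In (b) and (c), the path $\mathrm{key}(w)$ of a created vertex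 $w$ is inserted in the direction in which $w$ is traversed.) When $F=\varnothing$: if some vertex of $G_i$ is still white, return NO; otherwise go on to the next component. 3. When all components have been processed, return YES and $C$. \textbf{Theorem.} If $G$ is cyclically orientable, then the algorithm finds all chordless cycles of $G$: however the open choices (order of the components, initial order of the queues, choice of neighbors) are made, it terminates and returns YES together with a set $C$ of sequences such that every element of $C$ is a chordless cycle of $G$ and every chordless cycle of $G$ is described, up to rotation and reversal, by an element of $C$. -/

import Mathlib

noncomputable section

namespace COGraph

open scoped Classical

/-! ### Chordless cycles and cyclic orientations -/

section Cycles

variable {V : Type*}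

/-- A cycle of `G`, as a sequence `⟨v₁, …, v_k⟩` of `k ≥ 3` distinct vertices in which consecutive
vertices, and also `v_k` and `v₁`, are adjacent (the first vertex is not repeated at the end). -/
def IsCycle (G : SimpleGraph V) (l : List V) : Prop :=
  3 ≤ l.length ∧ l.Nodup ∧ l.IsChain G.Adj ∧
    ∀ a ∈ l.getLast?, ∀ b ∈ l.head?, G.Adj a b

/-- `b` follows `a` in the cyclic sequence `l`. -/
def Follows (l : List V) (a b : V) : Prop :=
  ∃ (i : ℕ) (hi : i < l.length),
    l[i] = a ∧ l[(i + 1) % l.length]'(Nat.mod_lt _ (Nat.zero_lt_of_lt hi)) = b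

/-- A chordless cycle: every edge of `G` between two vertices of the cycle is part of the cycle. -/
def IsChordlessCycle (G : SimpleGraph V) (l : List V) : Prop :=
  IsCycle G l ∧ ∀ a ∈ l, ∀ b ∈ l, G.Adj a b → Follows l a b ∨ Follows l b a

/-- Two sequences describe the same cycle: they agree up to rotation and reversal. -/
def SameCycle (l l' : List V) : Prop :=
  l.IsRotated l' ∨ l.IsRotated l'.reverse

/-- `D` is an orientation of `G`: each edge gets exactly one of its two directions, and there are
no other arcs. -/
def IsOrientation (G : SimpleGraph V) (D : V → V → Prop) : Prop :=
  ∀ a b, (G.Adj a b ↔ D a b ∨ D b a) ∧ ¬ (D a b ∧ D b a)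

/-- The cyclic sequence `l` is cyclically oriented by `D`, in one of the two senses. -/
def CyclicallyOriented (D : V → V → Prop) (l : List V) : Prop :=
  (∀ a b, Follows l a b → D a b) ∨ (∀ a b, Follows l a b → D b a)

/-- `G` has an orientation in which every chordless cycle is cyclically oriented. -/
def CyclicallyOrientable (G : SimpleGraph V) : Prop :=
  ∃ D : V → V → Prop, IsOrientation G D ∧ ∀ l, IsChordlessCycle G l → CyclicallyOriented D l

/-! ### Two-connected components -/

/-- The subgraph induced on `S` is two-connected: it has at least two vertices, it is connected,
and removing one vertex does not disconnect it. (A single edge is two-connected.) -/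
def TwoConnectedOn (G : SimpleGraph V) (S : Set V) : Prop :=
  S.Nontrivial ∧ (G.induce S).Connected ∧ ∀ v ∈ S, (G.induce (S \ {v})).Connected

/-- `S` is the vertex set of a two-connected component of `G`. The component itself is the
subgraph induced on `S`. -/
def IsTwoConnectedComponent (G : SimpleGraph V) (S : Set V) : Prop :=
  Maximal (TwoConnectedOn G) S

/-- Number of edges of the subgraph induced on `S`. -/
def numEdges (G : SimpleGraph V) (S : Set V) : ℕ :=
  (G.induce S).edgeSet.ncard

/-- The subgraph induced on `S` has more than `2n - 3` edges, `n` its number of vertices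
(the comparison is made in `ℤ`). -/
def TooManyEdges (G : SimpleGraph V) (S : Set V) : Prop :=
  2 * (S.ncard : ℤ) - 3 < (numEdges G S : ℤ)

end Cycles

/-! ### The data of the algorithm -/

section Data

/-- The vertices of a working copy of a component: `inl v` is the vertex `v` of the graph, and
`inr k` is the `k`-th vertex created by the algorithm. -/
abbrev Node (V : Type*) := V ⊕ ℕ

/-- The colors of the vertices. -/
inductive Color
  | white
  | gray

/-- The variables used while a component is processed. -/
structure Work (V : Type*) where
  /-- adjacency of the working copy -/
  adj : Node V → Node V → Prop
  /-- the counters `degree` -/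
  degree : Node V → ℕ
  /-- the colors -/
  color : Node V → Color
  /-- the path of vertices of the graph that a vertex of the working copy stands for -/
  key : Node V → List V
  /-- for a created vertex `w`, the neighbor of `w` next to which the path `key w` begins -/
  start : Node V → Node V
  /-- the queue `F` -/
  queue : List (Node V)
  /-- number of vertices created so far -/
  created : ℕ

variable {V : Type*}

/-- The initial values for the component with vertex set `S`, with queue `F`: all vertices are
white, and each stands for itself. -/
def Work.init (G : SimpleGraph V) (S : Set V) (F : List (Node V)) : Work V where
  adj p q := ∃ a ∈ S, ∃ b ∈ S, p = Sum.inl a ∧ q = Sum.inl b ∧ G.Adj a b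
  degree := Sum.elim (fun a => (G.neighborSet a ∩ S).ncard) (fun _ => 0)
  color _ := Color.white
  key := Sum.elim (fun a => [a]) (fun _ => [])
  start p := p
  queue := F
  created := 0

/-- The possible initial queues: the vertices of degree two of the component, in any order. -/
def IsInitialQueue (G : SimpleGraph V) (S : Set V) (F : List (Node V)) : Prop :=
  F.Nodup ∧ ∀ p, p ∈ F ↔ ∃ a ∈ S, p = Sum.inl a ∧ (G.neighborSet a ∩ S).ncard = 2

/-- `key v`, read in the direction in which one leaves `v` towards its neighbor `b`. -/
def Work.keyTowards (s : Work V) (v b : Node V) : List V :=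
  if b = s.start v then (s.key v).reverse else s.key v

/-- From `v`, reached from `prev`, a walk along vertices of degree two can go on to `a`. -/
def Work.CanMove (s : Work V) (prev v a : Node V) : Prop :=
  s.degree v = 2 ∧ s.adj v a ∧ s.color a = Color.white ∧ a ≠ prev

/-- `color(v) ← gray`. -/
def Work.paint (s : Work V) (v : Node V) : Work V :=
  { s with color := Function.update s.color v Color.gray }

/-- `F ← F - {v}; color(v) ← gray`. -/
def Work.remove (s : Work V) (v : Node V) : Work V :=
  { s.paint v with queue := s.queue.filter (fun p => p ≠ v) }

/-- `degree(v) ← degree(v) - 1`. -/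
def Work.decrease (s : Work V) (v : Node V) : Work V :=
  { s with degree := Function.update s.degree v (s.degree v - 1) }

/-- `if degree(v) = 2 then F ← F ∪ {v}`. -/
def Work.enqueueIfTwo (s : Work V) (v : Node V) : Work V :=
  { s with queue := if s.degree v = 2 then s.queue ++ [v] else s.queue }

/-- The update of degrees and queue after a cycle has been found that closes with the edge
between `x` and `y`. -/
def Work.cut (s : Work V) (x y : Node V) : Work V :=
  (((s.decrease x).decrease y).enqueueIfTwo x).enqueueIfTwo y

/-- Creation of a new white vertex of degree two that is adjacent to `x` and `y` and stands for
the path `P`, which runs from the side of `x` to the side of `y`. -/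
def Work.create (s : Work V) (x y : Node V) (P : List V) : Work V :=
  let w : Node V := Sum.inr s.created
  { adj := fun p q =>
      s.adj p q ∨ (p = w ∧ (q = x ∨ q = y)) ∨ (q = w ∧ (p = x ∨ p = y))
    degree := Function.update s.degree w 2
    color := Function.update s.color w Color.white
    key := Function.update s.key w P
    start := Function.update s.start w x
    queue := s.queue
    created := s.created + 1 }

/-- The results the algorithm can return. -/
inductive Result (V : Type*)
  | no
  | yes (C : Set (List V))

/-- The configurations of the algorithm. In each of them `L` is the list of the components that
are still to be processed after the present one, and `C` is the set of sequences found so far;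
`S` is the vertex set of the present component and `s` is the state of its working copy. -/
inductive Config (V : Type*)
  /-- the algorithm starts -/
  | start
  /-- head of the loop over the components -/
  | components (L : List (Set V)) (C : Set (List V))
  /-- head of the loop `while F is not empty` -/
  | outer (L : List (Set V)) (C : Set (List V)) (S : Set V) (s : Work V)
  /-- head of the first inner loop: `x` moves, it was reached from `prev`; the walk from `u`
  started with the neighbor `first` of `u` -/
  | walkX (L : List (Set V)) (C : Set (List V)) (S : Set V) (s : Work V)
      (u first : Node V) (P : List V) (prev x : Node V)
  /-- head of the second inner loop: `y` moves, it was reached from `prev` -/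
  | walkY (L : List (Set V)) (C : Set (List V)) (S : Set V) (s : Work V)
      (P : List V) (x prev y : Node V)
  /-- the two inner loops are finished -/
  | branch (L : List (Set V)) (C : Set (List V)) (S : Set V) (s : Work V)
      (P : List V) (x y : Node V)
  /-- the algorithm has returned `r` -/
  | returned (r : Result V)

end Data

/-! ### The algorithm -/

section Algorithm

variable {V : Type*}

/-- One step of the algorithm `ChordlessCyclesCOGraph` on the input `G`. The relation is not
functional, because the algorithm leaves some choices open: the order of the components, the order
of the initial queue, and the neighbor with which a walk starts or continues. -/
inductive Step (G : SimpleGraph V) : Config V → Config V → Prop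
  /-- the graph or one of its two-connected components has too many edges -/
  | reject
      (h : TooManyEdges G Set.univ ∨ ∃ S, IsTwoConnectedComponent G S ∧ TooManyEdges G S) :
      Step G .start (.returned .no)
  /-- otherwise `C ← ∅`, and the components that are not a single edge are listed -/
  | accept (L : List (Set V))
      (h : ¬ (TooManyEdges G Set.univ ∨ ∃ S, IsTwoConnectedComponent G S ∧ TooManyEdges G S))
      (hL : L.Nodup) (hmem : ∀ S, S ∈ L ↔ IsTwoConnectedComponent G S ∧ numEdges G S ≠ 1) :
      Step G .start (.components L ∅)
  /-- take the next component, initialize its working copy and the queue -/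
  | nextComponent (L : List (Set V)) (C : Set (List V)) (S : Set V) (F : List (Node V))
      (hF : IsInitialQueue G S F) :
      Step G (.components (S :: L) C) (.outer L C S (Work.init G S F))
  /-- all components have been processed -/
  | answerYes (C : Set (List V)) :
      Step G (.components [] C) (.returned (.yes C))
  /-- the first element of the queue is not white -/
  | skip (L : List (Set V)) (C : Set (List V)) (S : Set V) (s : Work V)
      (u : Node V) (F : List (Node V)) (hq : s.queue = u :: F) (hu : s.color u ≠ Color.white) :
      Step G (.outer L C S s) (.outer L C S { s with queue := F })
  /-- the first element `u` of the queue is white: `P ← ∅`, `y ← u`, `x ← a` -/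
  | take (L : List (Set V)) (C : Set (List V)) (S : Set V) (s : Work V)
      (u : Node V) (F : List (Node V)) (hq : s.queue = u :: F) (hu : s.color u = Color.white)
      (a : Node V) (ha : s.adj u a) (hw : s.color a = Color.white) :
      Step G (.outer L C S s) (.walkX L C S { s with queue := F } u a [] u a)
  /-- `F ← F - {x}; color(x) ← gray; P ← ⟨key(x), P⟩; x ← a` -/
  | moveX (L : List (Set V)) (C : Set (List V)) (S : Set V) (s : Work V)
      (u first : Node V) (P : List V) (prev x a : Node V) (h : s.CanMove prev x a) :
      Step G (.walkX L C S s u first P prev x)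
        (.walkX L C S (s.remove x) u first ((s.keyTowards x a).reverse ++ P) x a)
  /-- the first inner loop ends; the second one leaves `y = u`, not through `first` -/
  | endX (L : List (Set V)) (C : Set (List V)) (S : Set V) (s : Work V)
      (u first : Node V) (P : List V) (prev x : Node V) (h : ∀ a, ¬ s.CanMove prev x a) :
      Step G (.walkX L C S s u first P prev x) (.walkY L C S s P x first u)
  /-- `F ← F - {y}; color(y) ← gray; P ← ⟨P, key(y)⟩; y ← b` -/
  | moveY (L : List (Set V)) (C : Set (List V)) (S : Set V) (s : Work V)
      (P : List V) (x prev y b : Node V) (h : s.CanMove prev y b) :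
      Step G (.walkY L C S s P x prev y)
        (.walkY L C S (s.remove y) (P ++ s.keyTowards y b) x y b)
  /-- the second inner loop ends -/
  | endY (L : List (Set V)) (C : Set (List V)) (S : Set V) (s : Work V)
      (P : List V) (x prev y : Node V) (h : ∀ b, ¬ s.CanMove prev y b) :
      Step G (.walkY L C S s P x prev y) (.branch L C S s P x y)
  /-- `x ≠ y` and `x`, `y` are adjacent: a cycle has been found, and the path `P` is peeled off -/
  | peel (L : List (Set V)) (C : Set (List V)) (S : Set V) (s : Work V)
      (P : List V) (x y : Node V) (hne : x ≠ y) (hadj : s.adj x y) :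
      Step G (.branch L C S s P x y)
        (.outer L (insert (s.key x ++ P ++ s.key y) C) S (s.cut x y))
  /-- `x ≠ y` and `x`, `y` are not adjacent: the path `P` is replaced by a new vertex -/
  | contract (L : List (Set V)) (C : Set (List V)) (S : Set V) (s : Work V)
      (P : List V) (x y : Node V) (hne : x ≠ y) (hadj : ¬ s.adj x y) :
      Step G (.branch L C S s P x y) (.outer L C S (s.create x y P))
  /-- `x = y`: a cycle has been found, and it is peeled off with its last vertex `x` -/
  | close (L : List (Set V)) (C : Set (List V)) (S : Set V) (s : Work V)
      (P : List V) (x y : Node V) (heq : x = y) :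
      Step G (.branch L C S s P x y) (.outer L (insert (s.key x ++ P) C) S (s.paint x))
  /-- the queue is empty and a vertex of the component is still white -/
  | componentNo (L : List (Set V)) (C : Set (List V)) (S : Set V) (s : Work V)
      (hq : s.queue = []) (h : ∃ a ∈ S, s.color (Sum.inl a) = Color.white) :
      Step G (.outer L C S s) (.returned .no)
  /-- the queue is empty and no vertex of the component is white -/
  | componentYes (L : List (Set V)) (C : Set (List V)) (S : Set V) (s : Work V)
      (hq : s.queue = []) (h : ∀ a ∈ S, s.color (Sum.inl a) ≠ Color.white) :
      Step G (.outer L C S s) (.components L C)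

/-- However the open choices are made, the algorithm, run from the configuration `c`, comes to an
end without getting stuck and returns a result with the property `Q`. -/
inductive EveryRunReturns (G : SimpleGraph V) (Q : Result V → Prop) : Config V → Prop
  | returned (r : Result V) (h : Q r) : EveryRunReturns G Q (.returned r)
  | step (c : Config V) (hex : ∃ c', Step G c c')
      (hall : ∀ c', Step G c c' → EveryRunReturns G Q c') : EveryRunReturns G Q c

end Algorithm

end COGraph

end

namespace COGraph

open scoped Classical

variable {V : Type*} {G : SimpleGraph V}

/-! ### Cyclic sequences -/

/-! The orientation is used only locally. If two neighbors of `c` are joined by a walk that meets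
the closed neighborhood of `c` only in these two, a shortest such walk closes up through `c` to a
chordless cycle, so one of the two edges at `c` points inwards and the other outwards. Three edges
cannot be pairwise opposite, hence no three neighbors of `c` are pairwise linked in this way
(`not_three_linked`). It follows that a connected set off a chordless cycle is attached only to
pairwise adjacent vertices of the cycle (`adj_of_attached`), and never to all corners of a triangle
(`not_attached_triangle`).

An extremal choice then gives `exists_ear`: in the two-connected case, with at least three vertices,
some chordless cycle has no neighbors outside itself except at the ends of one of its edges. Its
inner vertices have degree two. Removing one of them costs two edges, which yields the bound `2n -
3` by induction (`numEdges_add_three_le`), so the input is never rejected; and the queue cannot be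
empty while anything remains (`OuterInv.exists_mem_queue`).

The rest is an invariant, `OuterInv`. The active nodes represent the subgraph induced on a set `T`
that is empty or two-connected with at least three vertices. A round walks from a vertex of degree
two in both directions. Either the walk comes back to its start (`Loop`), and then `T` is a single
cycle, or it stops at two vertices of larger degree (`Ear`), which are distinct because a common end
would be a cut vertex. If the ends are adjacent, the path and its ends form a chordless cycle, and
every other chordless cycle in `T` avoids the path, since entering it means following it to both
ends (`IsChordlessCycle.covers`, `sameCycle_of_subset`). So deleting the path loses no other cycle,
and two-connectedness survives because the ends remain joined by an edge. If the ends are not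
adjacent, only the representation of `T` changes. Every round deactivates at least one original
vertex, the one it starts from, so the process ends. -/

theorem Follows.mem {l : List V} {a b : V} (h : Follows l a b) : a ∈ l ∧ b ∈ l := by
  obtain ⟨i, hi, rfl, rfl⟩ := h
  exact ⟨List.getElem_mem _, List.getElem_mem _⟩

theorem follows_of_getElem {l : List V} {i : ℕ} (h : i + 1 < l.length) :
    Follows l l[i] l[i + 1] :=
  ⟨i, by omega, rfl, by simp [Nat.mod_eq_of_lt h]⟩

theorem follows_last_head {l : List V} {a b : V} (ha : l.getLast? = some a)
    (hb : l.head? = some b) : Follows l a b := by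
  have hne : l ≠ [] := by rintro rfl; simp at ha
  have hlen := List.length_pos_iff.2 hne
  refine ⟨l.length - 1, by omega, ?_, ?_⟩
  · rw [List.getLast?_eq_getElem?] at ha
    exact (List.getElem?_eq_some_iff.1 ha).2
  · have : (l.length - 1 + 1) % l.length = 0 := by
      rw [Nat.sub_add_cancel hlen, Nat.mod_self]
    rw [List.head?_eq_getElem?] at hb
    simpa [this] using (List.getElem?_eq_some_iff.1 hb).2

/-- Replaces the index modulo the length by two cases: a step inside the list and the step across
its end. -/
theorem follows_cases {l : List V} {a b : V} (h : Follows l a b) :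
    (∃ i, ∃ h : i + 1 < l.length, l[i] = a ∧ l[i + 1] = b) ∨
      (l.getLast? = some a ∧ l.head? = some b) := by
  obtain ⟨i, hi, h1, h2⟩ := h
  by_cases h : i + 1 < l.length
  · left
    refine ⟨i, h, h1, ?_⟩
    simpa [Nat.mod_eq_of_lt h] using h2
  · right
    have : i + 1 = l.length := by omega
    constructor
    · rw [List.getLast?_eq_getElem?, List.getElem?_eq_some_iff]
      exact ⟨by omega, by simpa [← this] using h1⟩
    · rw [List.head?_eq_getElem?, List.getElem?_eq_some_iff]
      exact ⟨by omega, by simpa [this] using h2⟩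

/-- In terms of `Follows` the closing edge is treated like all others, which makes rotation and
reversal easy. -/
theorem isCycle_iff {l : List V} :
    IsCycle G l ↔ 3 ≤ l.length ∧ l.Nodup ∧ ∀ a b, Follows l a b → G.Adj a b := by
  constructor
  · rintro ⟨h1, h2, h3, h4⟩
    refine ⟨h1, h2, fun a b h => ?_⟩
    rcases follows_cases h with ⟨i, hi, rfl, rfl⟩ | ⟨ha, hb⟩
    · exact h3.getElem i hi
    · exact h4 a ha b hb
  · rintro ⟨h1, h2, h3⟩
    exact ⟨h1, h2, List.isChain_iff_getElem.2 fun i hi => h3 _ _ (follows_of_getElem hi),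
      fun a ha b hb => h3 _ _ (follows_last_head ha hb)⟩

theorem IsCycle.exists_mem {l : List V} (h : IsCycle G l) : ∃ v, v ∈ l :=
  List.exists_mem_of_length_pos (by have := h.1; omega)

theorem follows_rotate {l : List V} {n : ℕ} {a b : V} :
    Follows (l.rotate n) a b ↔ Follows l a b := by
  have key : ∀ (l : List V) (n : ℕ), Follows (l.rotate n) a b → Follows l a b := by
    rintro l n ⟨i, hi, h1, h2⟩
    have hi' : i < l.length := by simpa using hi
    rw [List.getElem_rotate] at h1 h2
    refine ⟨(i + n) % l.length, Nat.mod_lt _ (by omega), h1, ?_⟩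
    rw [← h2]
    congr 1
    simp only [List.length_rotate, Nat.mod_add_mod]
    congr 1
    omega
  refine ⟨key l n, fun h => ?_⟩
  -- The rotation is undone by the complementary one; `n` is reduced modulo the length so that the
  -- subtraction does not truncate.
  have : l = (l.rotate n).rotate (l.length - n % l.length) := by
    rcases eq_or_ne l [] with rfl | hl
    · simp
    have := Nat.mod_lt n (List.length_pos_iff.2 hl)
    rw [← List.rotate_mod l n, List.rotate_rotate, Nat.add_sub_cancel' this.le,
      List.rotate_length]
  rw [this] at h
  exact key _ _ h

theorem follows_isRotated {l l' : List V} (h : l ~r l') {a b : V} :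
    Follows l' a b ↔ Follows l a b := by
  obtain ⟨n, rfl⟩ := h
  exact follows_rotate

theorem follows_reverse {l : List V} {a b : V} : Follows l.reverse a b ↔ Follows l b a := by
  have key : ∀ (l : List V) (a b : V), Follows l a b → Follows l.reverse b a := by
    intro l a b h
    rcases follows_cases h with ⟨i, hi, rfl, rfl⟩ | ⟨ha, hb⟩
    · have h1 : l[i + 1] = l.reverse[l.length - 2 - i]'(by simp; omega) := by
        rw [List.getElem_reverse]; congr 1; omega
      have h2 : l[i] = l.reverse[l.length - 2 - i + 1]'(by simp; omega) := by
        rw [List.getElem_reverse]; congr 1; omega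
      rw [h1, h2]
      exact follows_of_getElem (by simp; omega)
    · exact follows_last_head (by simpa using hb) (by simpa using ha)
  exact ⟨fun h => by simpa using key _ _ _ h, key _ _ _⟩

theorem isCycle_isRotated {l l' : List V} (h : l ~r l') (hl : IsCycle G l) : IsCycle G l' := by
  rw [isCycle_iff] at hl ⊢
  refine ⟨h.perm.length_eq ▸ hl.1, h.nodup_iff.1 hl.2.1, fun a b hab => ?_⟩
  exact hl.2.2 a b ((follows_isRotated h).1 hab)

theorem isCycle_reverse {l : List V} (hl : IsCycle G l) : IsCycle G l.reverse := by
  rw [isCycle_iff] at hl ⊢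
  exact ⟨by simpa using hl.1, by simpa using hl.2.1,
    fun a b hab => (hl.2.2 b a (follows_reverse.1 hab)).symm⟩

theorem isChordlessCycle_isRotated {l l' : List V} (h : l ~r l') (hl : IsChordlessCycle G l) :
    IsChordlessCycle G l' := by
  refine ⟨isCycle_isRotated h hl.1, fun a ha b hb hab => ?_⟩
  rw [follows_isRotated h, follows_isRotated h]
  exact hl.2 a (h.mem_iff.2 ha) b (h.mem_iff.2 hb) hab

theorem isChordlessCycle_reverse {l : List V} (hl : IsChordlessCycle G l) :
    IsChordlessCycle G l.reverse := by
  refine ⟨isCycle_reverse hl.1, fun a ha b hb hab => ?_⟩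
  rw [follows_reverse, follows_reverse]
  exact (hl.2 a (by simpa using ha) b (by simpa using hb) hab).symm

theorem exists_isRotated_cons {l : List V} {x : V} (hx : x ∈ l) : ∃ m, l ~r (x :: m) := by
  obtain ⟨s, t, rfl⟩ := List.append_of_mem hx
  exact ⟨t ++ s, by simpa using List.isRotated_append (l := s) (l' := x :: t)⟩

theorem follows_right_unique {l : List V} (hl : l.Nodup) {a b c : V} (h : Follows l a b)
    (h' : Follows l a c) : b = c := by
  obtain ⟨i, hi, h1, h2⟩ := h
  obtain ⟨j, hj, h3, h4⟩ := h'
  have : i = j := (hl.getElem_inj_iff).1 (h1.trans h3.symm)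
  subst this
  exact h2.symm.trans h4

theorem follows_left_unique {l : List V} (hl : l.Nodup) {a b c : V} (h : Follows l b a)
    (h' : Follows l c a) : b = c :=
  follows_right_unique (List.nodup_reverse.2 hl) (follows_reverse.2 h) (follows_reverse.2 h')

theorem exists_follows {l : List V} {a : V} (ha : a ∈ l) : ∃ b, Follows l a b := by
  obtain ⟨i, hi, rfl⟩ := List.getElem_of_mem ha
  exact ⟨_, i, hi, rfl, rfl⟩

theorem exists_follows' {l : List V} {a : V} (ha : a ∈ l) : ∃ b, Follows l b a := by
  obtain ⟨b, hb⟩ := exists_follows (List.mem_reverse.2 ha)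
  exact ⟨b, follows_reverse.1 hb⟩

/-- In a cyclic sequence of length at least three, predecessor and successor differ. -/
theorem follows_ne {l : List V} (hl : l.Nodup) (h3 : 3 ≤ l.length) {a b c : V}
    (h : Follows l a b) (h' : Follows l b c) : a ≠ c := by
  obtain ⟨i, hi, h1, h2⟩ := h
  obtain ⟨j, hj, h5, h6⟩ := h'
  have hj' : (i + 1) % l.length = j := (hl.getElem_inj_iff).1 (h2.trans h5.symm)
  rintro rfl
  have : i = (j + 1) % l.length := (hl.getElem_inj_iff).1 (h1.trans h6.symm)
  rw [← hj', Nat.mod_add_mod] at this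
  rcases lt_or_ge (i + 1 + 1) l.length with h | h
  · rw [Nat.mod_eq_of_lt h] at this; omega
  · rw [Nat.mod_eq_sub_mod h, Nat.mod_eq_of_lt (by omega)] at this; omega

/-! ### Connection inside a set of vertices -/

/-- `a` and `b` are joined by a walk all of whose edges lie inside `S`. -/
def Conn (G : SimpleGraph V) (S : Set V) : V → V → Prop :=
  Relation.ReflTransGen fun a b => G.Adj a b ∧ a ∈ S ∧ b ∈ S

theorem Conn.refl (S : Set V) (a : V) : Conn G S a a := Relation.ReflTransGen.refl

theorem Conn.trans {S : Set V} {a b c : V} (h : Conn G S a b) (h' : Conn G S b c) :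
    Conn G S a c := Relation.ReflTransGen.trans h h'

theorem Conn.symm {S : Set V} {a b : V} (h : Conn G S a b) : Conn G S b a := by
  induction h with
  | refl => exact Relation.ReflTransGen.refl
  | tail _ h ih => exact Relation.ReflTransGen.head ⟨h.1.symm, h.2.2, h.2.1⟩ ih

theorem Conn.mono {S S' : Set V} (hS : S ⊆ S') {a b : V} (h : Conn G S a b) : Conn G S' a b := by
  induction h with
  | refl => exact Conn.refl _ _
  | tail _ h ih => exact Relation.ReflTransGen.tail ih ⟨h.1, hS h.2.1, hS h.2.2⟩

theorem Conn.single {S : Set V} {a b : V} (h : G.Adj a b) (ha : a ∈ S) (hb : b ∈ S) :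
    Conn G S a b := Relation.ReflTransGen.single ⟨h, ha, hb⟩

theorem Conn.mem_right {S : Set V} {a b : V} (h : Conn G S a b) (ha : a ∈ S) : b ∈ S := by
  induction h with
  | refl => exact ha
  | tail _ h _ => exact h.2.2

theorem Conn.restrict {S K : Set V} {a b : V} (h : Conn G S a b) (ha : a ∈ K)
    (hK : ∀ c ∈ K, ∀ d ∈ S, G.Adj c d → d ∈ K) : Conn G (S ∩ K) a b ∧ b ∈ K := by
  induction h with
  | refl => exact ⟨Conn.refl _ _, ha⟩
  | tail _ h ih =>
    have := hK _ ih.2 _ h.2.2 h.1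
    exact ⟨ih.1.trans (Conn.single h.1 ⟨h.2.1, ih.2⟩ ⟨h.2.2, this⟩), this⟩

theorem conn_of_isChain {S : Set V} {a : V} {l : List V} (h : (a :: l).IsChain G.Adj)
    (hS : ∀ v ∈ a :: l, v ∈ S) : ∀ b ∈ a :: l, Conn G S a b := by
  induction l generalizing a with
  | nil => intro b hb; obtain rfl : b = a := by simpa using hb
           exact Conn.refl _ _
  | cons c l ih =>
    rw [List.isChain_cons_cons] at h
    intro b hb
    rcases List.mem_cons.1 hb with rfl | hb
    · exact Conn.refl _ _
    · exact (Conn.single h.1 (hS _ (by simp)) (hS _ (by simp))).trans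
        (ih h.2 (fun v hv => hS v (List.mem_cons_of_mem _ hv)) b hb)

theorem exists_isChain_of_conn {S : Set V} {a b : V} (h : Conn G S a b) (ha : a ∈ S) :
    ∃ l : List V, l.IsChain G.Adj ∧ l.head? = some a ∧ l.getLast? = some b ∧ ∀ v ∈ l, v ∈ S := by
  induction h with
  | refl => exact ⟨[a], by simp, by simp, by simp, by simpa using ha⟩
  | @tail b c _ h ih =>
    obtain ⟨l, h1, h2, h3, h4⟩ := ih
    refine ⟨l ++ [c], ?_, by simp [h2], by simp, ?_⟩
    · rw [List.isChain_append]
      refine ⟨h1, by simp, ?_⟩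
      rintro x hx y hy
      rw [h3] at hx
      simp at hx hy
      subst hx hy
      exact h.1
    · simp only [List.mem_append, List.mem_singleton]
      rintro v (hv | rfl)
      · exact h4 v hv
      · exact h.2.2

/-- A shortest path has no repetitions and no chords. -/
theorem exists_induced_path {S : Set V} {a b : V} (h : Conn G S a b) (ha : a ∈ S) :
    ∃ l : List V, l.IsChain G.Adj ∧ l.head? = some a ∧ l.getLast? = some b ∧ (∀ v ∈ l, v ∈ S) ∧
      l.Nodup ∧ ∀ (i j : ℕ) (hi : i < l.length) (hj : j < l.length), i < j → G.Adj l[i] l[j] →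
        j = i + 1 := by
  obtain ⟨l, ⟨h1, h2, h3, h4⟩, hmin⟩ := WellFounded.has_min
    (InvImage.wf List.length Nat.lt_wfRel.wf)
    {l : List V | l.IsChain G.Adj ∧ l.head? = some a ∧ l.getLast? = some b ∧ ∀ v ∈ l, v ∈ S}
    (exists_isChain_of_conn h ha)
  -- Cutting out the entries strictly between `i` and `k` would give a shorter walk. The value `k =
  -- l.length` drops the whole tail, which is allowed when `l[i]` is already `b`.
  have short : ∀ i k (hi : i < l.length), i + 1 < k → k ≤ l.length →
      (∀ h : k < l.length, G.Adj l[i] l[k]) → (k = l.length → l[i] = b) → False := by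
    intro i k hi hik hk hadj hlast
    refine hmin (l.take (i + 1) ++ l.drop k) ⟨?_, ?_, ?_, ?_⟩ ?_
    · rw [List.isChain_append]
      refine ⟨h1.take _, h1.drop _, ?_⟩
      intro x hx y hy
      rw [List.getLast?_take] at hx
      rw [List.head?_drop] at hy
      simp [List.getElem?_eq_getElem hi] at hx
      obtain ⟨hk', rfl⟩ := List.getElem?_eq_some_iff.1 hy
      rw [← hx]
      exact hadj hk'
    · cases l with
      | nil => simp at hi
      | cons c l => simpa using h2
    · rcases hk.lt_or_eq with hk' | hk'
      · rw [List.getLast?_append, List.getLast?_drop]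
        simp [h3, hk']
      · subst hk'
        simp [List.getLast?_take, List.getElem?_eq_getElem hi, hlast]
    · intro v hv
      rcases List.mem_append.1 hv with hv | hv
      · exact h4 v (List.mem_of_mem_take hv)
      · exact h4 v (List.mem_of_mem_drop hv)
    · simp [InvImage]
      show _ < _
      omega
  refine ⟨l, h1, h2, h3, h4, ?_, ?_⟩
  · rw [List.nodup_iff_getElem?_ne_getElem?]
    intro i j hij hj heq
    rw [List.getElem?_eq_getElem (by omega), List.getElem?_eq_getElem hj, Option.some_inj] at heq
    -- The entry at `j` repeats the one at `i`, so the successor of `j` can follow `i` directly.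
    refine short i (j + 1) (by omega) (by omega) (by omega) (fun h => ?_) (fun h => ?_)
    · rw [heq]; exact h1.getElem j h
    · rw [heq]
      rw [List.getLast?_eq_getElem?] at h3
      have : l.length - 1 = j := by omega
      rw [this] at h3
      exact (List.getElem?_eq_some_iff.1 h3).2
  · intro i j hi hj hij hadj
    by_contra hne
    exact short i j hi (by omega) hj.le (fun _ => hadj) (fun h => by omega)

/-- Two neighbors of `c` that are joined outside the neighborhood of `c` lie with `c` on a
chordless cycle. -/
theorem exists_isChordlessCycle {c p q : V} {M : Set V} (hp : G.Adj c p) (hq : G.Adj c q)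
    (hpq : p ≠ q) (hpM : p ∈ M) (hM : ∀ m ∈ M, m ≠ c ∧ (G.Adj c m → m = p ∨ m = q))
    (h : Conn G M p q) :
    ∃ l : List V, IsChordlessCycle G (c :: l) ∧ l.head? = some p ∧ l.getLast? = some q ∧
      ∀ v ∈ l, v ∈ M := by
  obtain ⟨l, h1, h2, h3, h4, h5, h6⟩ := exists_induced_path h hpM
  have hlen : 2 ≤ l.length := by
    match l, h2, h3 with
    | [x], h2, h3 => simp at h2 h3; exact absurd (h2.symm.trans h3) hpq
    | x :: y :: l, _, _ => simp
  have hcp : Follows (c :: l) c p := by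
    have h0 : l[0]'(by omega) = p := by
      rw [List.head?_eq_getElem?] at h2
      exact (List.getElem?_eq_some_iff.1 h2).2
    have := follows_of_getElem (l := c :: l) (i := 0) (by simp; omega)
    simpa [h0] using this
  have hqc : Follows (c :: l) q c := by
    refine follows_last_head ?_ (by simp)
    rw [List.getLast?_cons, h3]; simp
  refine ⟨l, ⟨⟨by simp; omega, ?_, ?_, ?_⟩, ?_⟩, h2, h3, h4⟩
  · exact List.nodup_cons.2 ⟨fun hc => (hM c (h4 c hc)).1 rfl, h5⟩
  · rw [List.isChain_cons, h2]
    exact ⟨by simpa using hp, h1⟩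
  · rw [List.getLast?_cons, h3]
    simpa using hq.symm
  · have aux : ∀ a ∈ l, G.Adj c a → Follows (c :: l) c a ∨ Follows (c :: l) a c := by
      intro a ha hca
      rcases (hM a (h4 a ha)).2 hca with rfl | rfl
      · exact Or.inl hcp
      · exact Or.inr hqc
    have aux2 : ∀ i j (hi : i < l.length) (hj : j < l.length), i < j → G.Adj l[i] l[j] →
        Follows (c :: l) l[i] l[j] := by
      intro i j hi hj hij hadj
      obtain rfl := h6 i j hi hj hij hadj
      have := follows_of_getElem (l := c :: l) (i := i + 1) (by simpa using hj)
      simpa using this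
    intro a ha b hb hab
    rcases List.mem_cons.1 ha with rfl | ha'
    · rcases List.mem_cons.1 hb with rfl | hb
      · exact absurd hab (G.irrefl)
      · exact aux b hb hab
    · rcases List.mem_cons.1 hb with rfl | hb
      · exact (aux _ ha' hab.symm).symm
      · obtain ⟨i, hi, rfl⟩ := List.getElem_of_mem ha'
        obtain ⟨j, hj, rfl⟩ := List.getElem_of_mem hb
        rcases lt_trichotomy i j with hij | hij | hij
        · exact Or.inl (aux2 i j hi hj hij hab)
        · subst hij; exact absurd hab (G.irrefl)
        · exact Or.inr (aux2 j i hj hi hij hab.symm)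

/-- A chordless cycle, seen from one of its vertices. -/
theorem IsChordlessCycle.around {z : List V} (hz : IsChordlessCycle G z) {x : V} (hx : x ∈ z) :
    ∃ p q, p ∈ z ∧ q ∈ z ∧ p ≠ q ∧ G.Adj x p ∧ G.Adj x q ∧
      (∀ y ∈ z, G.Adj x y → y = p ∨ y = q) ∧
      (∀ y ∈ z, y ≠ x → Conn G ({v | v ∈ z} \ {x}) p y) ∧
      (∀ y ∈ z, y ≠ x → y ≠ q → Conn G ({v | v ∈ z} \ {x, q}) p y) ∧
      (∀ y ∈ z, y ≠ x → y ≠ p → Conn G ({v | v ∈ z} \ {x, p}) y q) := by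
  obtain ⟨m, hm⟩ := exists_isRotated_cons hx
  have hmem : ∀ v, v ∈ z ↔ v ∈ x :: m := fun v => hm.mem_iff
  have hz' := isChordlessCycle_isRotated hm hz
  obtain ⟨⟨h1, h2, h3, h4⟩, h5⟩ := hz'
  have hlen : 2 ≤ m.length := by simpa using h1
  -- Rotated to begin at `x`, the cycle reads `x, p, s, q`. The three connections run along `p, s,
  -- q`, along `p, s`, and along `q` and `s` backwards.
  obtain ⟨p, t, rfl⟩ : ∃ p t, m = p :: t := by
    cases m with
    | nil => simp at hlen
    | cons p t => exact ⟨p, t, rfl⟩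
  have htne : t ≠ [] := by rintro rfl; simp at hlen
  obtain ⟨s, q, rfl⟩ := (List.eq_nil_or_concat' t).resolve_left htne
  simp only [hmem]
  have hcyc := isCycle_iff.1 ⟨h1, h2, h3, h4⟩
  have hxp : Follows (x :: p :: (s ++ [q])) x p := by
    simpa using follows_of_getElem (l := x :: p :: (s ++ [q])) (i := 0) (by simp)
  have hqx : Follows (x :: p :: (s ++ [q])) q x :=
    follows_last_head (List.getLast?_concat (l := x :: p :: s)) (by simp)
  rw [List.isChain_cons_cons] at h3
  have hnd : x ∉ p :: (s ++ [q]) := (List.nodup_cons.1 h2).1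
  have hnd2 : p ∉ s ++ [q] := (List.nodup_cons.1 (List.nodup_cons.1 h2).2).1
  have hqs : q ∉ p :: s := by
    have := (List.nodup_cons.1 h2).2
    rw [← List.cons_append, List.nodup_append] at this
    intro h
    exact this.2.2 q h q (by simp) rfl
  refine ⟨p, q, by simp, by simp, ?_, hcyc.2.2 _ _ hxp, (hcyc.2.2 _ _ hqx).symm, ?_, ?_, ?_, ?_⟩
  · rintro rfl; simp at hnd2
  · intro y hy hxy
    rcases h5 x (by simp) y hy hxy with h | h
    · exact Or.inl (follows_right_unique h2 h hxp)
    · exact Or.inr (follows_left_unique h2 h hqx)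
  · intro y hy hyx
    refine conn_of_isChain (S := {v | v ∈ x :: p :: (s ++ [q])} \ {x}) h3.2
      (fun v hv => ⟨List.mem_cons_of_mem _ hv, ?_⟩) y ?_
    · rintro rfl; exact hnd hv
    · exact (List.mem_cons.1 hy).resolve_left hyx
  · intro y hy hyx hyq
    have hc : (p :: s).IsChain G.Adj := by
      have := h3.2
      rw [← List.cons_append] at this
      exact this.left_of_append
    refine conn_of_isChain (S := {v | v ∈ x :: p :: (s ++ [q])} \ {x, q}) hc
      (fun v hv => ⟨?_, ?_⟩) y ?_
    · simp at hv ⊢; tauto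
    · rintro (rfl | rfl)
      · apply hnd; simp only [List.mem_cons, List.mem_append] at hv ⊢; tauto
      · exact hqs hv
    · simp only [List.mem_cons, List.mem_append, List.not_mem_nil, or_false] at hy ⊢; tauto
  · intro y hy hyx hyp
    have hc : (s ++ [q]).reverse.IsChain G.Adj := by
      rw [List.isChain_reverse]
      exact h3.2.tail.imp fun _ _ h => h.symm
    rw [List.reverse_append] at hc
    refine (conn_of_isChain (S := {v | v ∈ x :: p :: (s ++ [q])} \ {x, p}) hc
      (fun v hv => ⟨?_, ?_⟩) y ?_).symm
    · simp at hv ⊢; tauto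
    · rintro (rfl | rfl)
      · apply hnd; simp at hv ⊢; tauto
      · apply hnd2; simp at hv ⊢; tauto
    · simp at hy ⊢; tauto

/-- A cycle inside the vertex set of a chordless cycle is that chordless cycle. -/
theorem sameCycle_of_subset {w l : List V} (hc : IsCycle G w) (hl : IsChordlessCycle G l)
    (h : ∀ v ∈ w, v ∈ l) : SameCycle w l := by
  obtain ⟨h1, h2, h3⟩ := isCycle_iff.1 hc
  -- Sequences with the same first two entries agree: the next edge of `w` is an edge of `m` by
  -- chordlessness and cannot lead back, so both advance to the same vertex.
  have key : ∀ m : List V, IsChordlessCycle G m → (∀ v ∈ w, v ∈ m) →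
      (∃ (h0 : 0 < m.length) (h0 : 1 < m.length), m[0] = w[0] ∧ m[1] = w[1]) → w = m := by
    rintro m hm hcm ⟨hm0, hm1, e0, e1⟩
    obtain ⟨m1, m2, m3⟩ := isCycle_iff.1 hm.1
    have step : ∀ i, ∀ h : i + 1 < w.length, ∃ h' : i + 1 < m.length,
        m[i] = w[i] ∧ m[i + 1] = w[i + 1] := by
      intro i
      induction i with
      | zero => intro h; exact ⟨hm1, e0, e1⟩
      | succ i ih =>
        intro h
        obtain ⟨h', ea, eb⟩ := ih (by omega)
        have hadj : G.Adj w[i + 1] w[i + 1 + 1] := h3 _ _ (follows_of_getElem h)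
        have hne : w[i + 1 + 1] ≠ w[i] := by
          intro he
          have := h2.getElem_inj_iff.1 he
          omega
        rcases hm.2 _ (hcm _ (List.getElem_mem _)) _ (hcm _ (List.getElem_mem _)) hadj with hf | hf
        · obtain ⟨j, hj, f1, f2⟩ := hf
          have : j = i + 1 := m2.getElem_inj_iff.1 (f1.trans eb.symm)
          subst this
          rcases lt_or_ge (i + 1 + 1) m.length with hlt | hge
          · refine ⟨hlt, eb, ?_⟩
            simpa [Nat.mod_eq_of_lt hlt] using f2
          · exfalso
            have : (i + 1 + 1) % m.length = 0 := by
              rw [show i + 1 + 1 = m.length by omega, Nat.mod_self]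
            simp only [this] at f2
            have := h2.getElem_inj_iff.1 (e0.symm.trans f2)
            omega
        · exfalso
          apply hne
          apply follows_left_unique m2 hf
          rw [← ea, ← eb]
          exact follows_of_getElem h'
    have hle : w.length ≤ m.length := by
      obtain ⟨h', -, -⟩ := step (w.length - 2) (by omega)
      omega
    have heq : ∀ i (hi : i < w.length), m[i] = w[i] := by
      intro i hi
      rcases i with _ | i
      · exact e0
      · exact (step i hi).2.2
    -- The closing edge of `w` must be an edge of `m` as well, and this forces equal lengths.
    have hlast : G.Adj w[w.length - 1] w[0] := by
      refine h3 _ _ (follows_last_head ?_ ?_)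
      · rw [List.getLast?_eq_getElem?, List.getElem?_eq_getElem]
      · rw [List.head?_eq_getElem?, List.getElem?_eq_getElem]
    have hlen : w.length = m.length := by
      rcases hm.2 _ (hcm _ (List.getElem_mem _)) _ (hcm _ (List.getElem_mem _)) hlast with hf | hf
      · obtain ⟨j, hj, f1, f2⟩ := hf
        have : j = w.length - 1 := m2.getElem_inj_iff.1 (f1.trans (heq _ (by omega)).symm)
        subst this
        have : (w.length - 1 + 1) % m.length = 0 := m2.getElem_inj_iff.1 (f2.trans e0.symm)
        rw [Nat.sub_add_cancel (by omega)] at this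
        have := Nat.le_of_dvd (by omega) (Nat.dvd_of_mod_eq_zero this)
        omega
      · exfalso
        obtain ⟨j, hj, f1, f2⟩ := hf
        have : j = 0 := m2.getElem_inj_iff.1 (f1.trans e0.symm)
        subst this
        have : (0 + 1) % m.length = w.length - 1 :=
          m2.getElem_inj_iff.1 (f2.trans (heq _ (by omega)).symm)
        rw [Nat.mod_eq_of_lt (by omega)] at this
        omega
    exact List.ext_getElem hlen fun i hi _ => (heq i hi).symm
  have key2 : ∀ l : List V, IsChordlessCycle G l → (∀ v ∈ w, v ∈ l) → Follows l w[0] w[1] →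
      w ~r l := by
    intro l hl h hf
    obtain ⟨m, hm⟩ := exists_isRotated_cons (h w[0] (List.getElem_mem _))
    have hm' := isChordlessCycle_isRotated hm hl
    have hf' := (follows_isRotated hm).2 hf
    have hlen := hm'.1.1
    have hs : w = w[0] :: m := by
      refine key _ hm' (fun v hv => hm.mem_iff.1 (h v hv)) ⟨by omega, by omega, by simp, ?_⟩
      refine follows_right_unique hm'.1.2.1 ?_ hf'
      exact follows_of_getElem (l := w[0] :: m) (i := 0) (by omega)
    rw [hs]
    exact hm.symm
  rcases hl.2 _ (h w[0] (List.getElem_mem _)) _ (h w[1] (List.getElem_mem _))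
    (h3 _ _ (follows_of_getElem (by omega))) with hf | hf
  · exact Or.inl (key2 l hl h hf)
  · refine Or.inr (key2 _ (isChordlessCycle_reverse hl) (fun v hv => by simpa using h v hv) ?_)
    exact follows_reverse.2 hf

/-! ### Two-connected sets of vertices -/

theorem induce_reachable_iff {S : Set V} (a b : S) :
    (G.induce S).Reachable a b ↔ Conn G S a b := by
  rw [SimpleGraph.reachable_iff_reflTransGen]
  constructor
  · intro h
    induction h with
    | refl => exact Conn.refl _ _
    | @tail b c _ h ih => exact ih.trans (Conn.single (by simpa using h) b.2 c.2)
  · intro h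
    have : ∀ c : V, Conn G S a c → ∃ hc : c ∈ S,
        Relation.ReflTransGen (G.induce S).Adj a ⟨c, hc⟩ := by
      intro c hc
      induction hc with
      | refl => exact ⟨a.2, Relation.ReflTransGen.refl⟩
      | tail _ h ih =>
        obtain ⟨_, ih⟩ := ih
        exact ⟨h.2.2, ih.tail (by simpa using h.1)⟩
    exact (this b h).2

theorem induce_connected_iff {S : Set V} :
    (G.induce S).Connected ↔ S.Nonempty ∧ ∀ a ∈ S, ∀ b ∈ S, Conn G S a b := by
  rw [SimpleGraph.connected_iff, Set.nonempty_coe_sort, and_comm]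
  refine and_congr_right fun _ => ?_
  constructor
  · intro h a ha b hb
    exact (induce_reachable_iff ⟨a, ha⟩ ⟨b, hb⟩).1 (h _ _)
  · intro h a b
    exact (induce_reachable_iff a b).2 (h _ a.2 _ b.2)

/-- With `Conn`, different vertex sets can be compared without passing between subtypes. -/
theorem twoConnectedOn_iff {S : Set V} :
    TwoConnectedOn G S ↔ S.Nontrivial ∧ (∀ a ∈ S, ∀ b ∈ S, Conn G S a b) ∧
      ∀ v ∈ S, ∀ a ∈ S \ {v}, ∀ b ∈ S \ {v}, Conn G (S \ {v}) a b := by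
  unfold TwoConnectedOn
  refine and_congr_right fun hS => ?_
  simp only [induce_connected_iff]
  constructor
  · rintro ⟨h1, h2⟩
    exact ⟨h1.2, fun v hv => (h2 v hv).2⟩
  · rintro ⟨h1, h2⟩
    refine ⟨⟨hS.nonempty, h1⟩, fun v hv => ⟨?_, h2 v hv⟩⟩
    obtain ⟨w, hw, hwv⟩ := hS.exists_ne v
    exact ⟨w, hw, hwv⟩

/-- A walk that leaves `U` does so along an edge. -/
theorem Conn.exists_exit {S U : Set V} {a b : V} (h : Conn G S a b) (ha : a ∈ U) (hb : b ∉ U) :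
    ∃ u ∈ U, ∃ w ∈ S, u ∈ S ∧ w ∉ U ∧ G.Adj u w := by
  induction h with
  | refl => exact absurd ha hb
  | @tail b c _ h ih =>
    by_cases hbU : b ∈ U
    · exact ⟨b, hbU, c, h.2.2, h.2.1, hb, h.1⟩
    · exact ih hbU

/-- The vertices that can be reached from `a` inside `S`. -/
def reach (G : SimpleGraph V) (S : Set V) (a : V) : Set V := {v | Conn G S a v}

theorem self_mem_reach {S : Set V} {a : V} : a ∈ reach G S a := Conn.refl _ _

theorem reach_subset {S : Set V} {a : V} (ha : a ∈ S) : reach G S a ⊆ S :=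
  fun _ h => Conn.mem_right h ha

theorem mem_reach_of_adj {S : Set V} {a u v : V} (ha : a ∈ S) (hu : u ∈ reach G S a)
    (huv : G.Adj u v) (hv : v ∈ S) : v ∈ reach G S a :=
  Conn.trans hu (Conn.single huv (reach_subset ha hu) hv)

/-- A walk from `a` visits only vertices reachable from `a`, so it stays inside the reachable set.
-/
theorem reach_connected {S : Set V} {a : V} (ha : a ∈ S) :
    ∀ u ∈ reach G S a, ∀ v ∈ reach G S a, Conn G (reach G S a) u v := by
  have key : ∀ v ∈ reach G S a, Conn G (reach G S a) a v := by
    intro v hv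
    refine (Conn.restrict (K := reach G S a) hv self_mem_reach ?_).1.mono Set.inter_subset_right
    intro c hc d hd hcd
    exact mem_reach_of_adj ha hc hcd hd
  exact fun u hu v hv => (key u hu).symm.trans (key v hv)

/-! ### Neighborhoods in cyclically orientable graphs -/

/-- Two vertices joined by a walk that meets the closed neighborhood of `c` at most in its ends. -/
def Linked (G : SimpleGraph V) (c p q : V) : Prop :=
  Conn G {v | (v ≠ c ∧ ¬ G.Adj c v) ∨ v = p ∨ v = q} p q

theorem Linked.of_adj {c p q : V} (h : G.Adj p q) : Linked G c p q :=
  Conn.single h (Or.inr (Or.inl rfl)) (Or.inr (Or.inr rfl))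

/-- The link closes up through `c` to a chordless cycle on which `p` and `q` are the neighbors of
`c`; a directed cycle enters `c` along one of these edges and leaves along the other. -/
theorem Linked.orientation {D : V → V → Prop} (hD : IsOrientation G D)
    (hC : ∀ l, IsChordlessCycle G l → CyclicallyOriented D l) {c p q : V} (hp : G.Adj c p)
    (hq : G.Adj c q) (hpq : p ≠ q) (h : Linked G c p q) : D c p ↔ ¬ D c q := by
  obtain ⟨l, hl, h1, h2, -⟩ := exists_isChordlessCycle hp hq hpq (Or.inr (Or.inl rfl))
    (by
      rintro m (hm | rfl | rfl)
      · exact ⟨hm.1, fun h => absurd h hm.2⟩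
      · exact ⟨hp.ne', fun _ => Or.inl rfl⟩
      · exact ⟨hq.ne', fun _ => Or.inr rfl⟩) h
  have f1 : Follows (c :: l) c p := by
    cases l with
    | nil => simp at h1
    | cons x l =>
      obtain rfl : x = p := by simpa using h1
      exact follows_of_getElem (l := c :: x :: l) (i := 0) (by simp)
  have f2 : Follows (c :: l) q c := follows_last_head (by rw [List.getLast?_cons, h2]; rfl) rfl
  rcases hC _ hl with h | h
  · have := h _ _ f1
    have := h _ _ f2
    have := (hD c q).2
    tauto
  · have := h _ _ f1
    have := h _ _ f2
    have := (hD c p).2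
    tauto

/-- Three truth values cannot be pairwise different. -/
theorem not_three_linked (hG : CyclicallyOrientable G) {c p q r : V} (hp : G.Adj c p)
    (hq : G.Adj c q) (hr : G.Adj c r) (hpq : p ≠ q) (hpr : p ≠ r) (hqr : q ≠ r)
    (h1 : Linked G c p q) (h2 : Linked G c p r) (h3 : Linked G c q r) : False := by
  obtain ⟨D, hD, hC⟩ := hG
  have := h1.orientation hD hC hp hq hpq
  have := h2.orientation hD hC hp hr hpr
  have := h3.orientation hD hC hq hr hqr
  tauto

/-- Follow the walk and remember the latest neighbor of `c`; after it, no other neighbor of `c`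
occurs. -/
theorem exists_last_neighbor {K : Set V} {c k k' : V} (hc : c ∉ K) (hk : k ∈ K)
    (hck : G.Adj c k) (h : Conn G K k k') :
    ∃ r ∈ K, G.Adj c r ∧ Conn G {v | (v ∈ K ∧ v ≠ c ∧ ¬ G.Adj c v) ∨ v = r} r k' := by
  induction h with
  | refl => exact ⟨k, hk, hck, Conn.refl _ _⟩
  | @tail b d hb h ih =>
    obtain ⟨r, hr, hcr, ih⟩ := ih
    by_cases hd : G.Adj c d
    · exact ⟨d, h.2.2, hd, Conn.refl _ _⟩
    · refine ⟨r, hr, hcr, ih.trans (Conn.single h.1 (ih.mem_right (Or.inr rfl)) (Or.inl ?_))⟩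
      exact ⟨h.2.2, fun e => hc (e ▸ h.2.2), hd⟩

/-- The walk is cut at the first neighbor of `c` other than `p`; up to there it meets the
neighborhood of `c` only in `p`. The given `q` guarantees that such a neighbor exists but need not
lie on the cycle. -/
theorem exists_isChordlessCycle_through {c p q : V} {M : Set V} (hc : c ∉ M) (hpM : p ∈ M)
    (hp : G.Adj c p) (hq : G.Adj c q) (hpq : p ≠ q) (h : Conn G M p q) :
    ∃ l, IsChordlessCycle G l ∧ c ∈ l ∧ p ∈ l ∧ ∀ v ∈ l, v = c ∨ v ∈ M := by
  have key : (∃ r ∈ M, r ≠ p ∧ G.Adj c r ∧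
      Conn G {v | (v ∈ M ∧ ¬ G.Adj c v) ∨ v = p ∨ v = r} p r) ∨
      Conn G {v | (v ∈ M ∧ ¬ G.Adj c v) ∨ v = p} p q := by
    clear hq hpq
    induction h with
    | refl => exact Or.inr (Conn.refl _ _)
    | @tail b d hb h ih =>
      rcases ih with ih | ih
      · exact Or.inl ih
      · by_cases hdp : d = p
        · subst hdp; exact Or.inr (Conn.refl _ _)
        · by_cases hd : G.Adj c d
          · left
            refine ⟨d, h.2.2, hdp, hd, (ih.mono ?_).trans
              (Conn.single h.1 ?_ (Or.inr (Or.inr rfl)))⟩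
            · rintro v (hv | hv)
              · exact Or.inl hv
              · exact Or.inr (Or.inl hv)
            · rcases ih.mem_right (Or.inr rfl) with hv | hv
              · exact Or.inl hv
              · exact Or.inr (Or.inl hv)
          · exact Or.inr (ih.trans (Conn.single h.1 (ih.mem_right (Or.inr rfl))
              (Or.inl ⟨h.2.2, hd⟩)))
  rcases key with ⟨r, hrM, hrp, hr, h⟩ | h
  · obtain ⟨l, hl, h1, h2, h3⟩ := exists_isChordlessCycle hp hr hrp.symm (Or.inr (Or.inl rfl))
      (by
        rintro m (hm | rfl | rfl)
        · exact ⟨fun e => hc (e ▸ hm.1), fun h => absurd h hm.2⟩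
        · exact ⟨hp.ne', fun _ => Or.inl rfl⟩
        · exact ⟨hr.ne', fun _ => Or.inr rfl⟩) h
    refine ⟨c :: l, hl, by simp, List.mem_cons_of_mem _ (List.mem_of_head? h1), ?_⟩
    intro v hv
    rcases List.mem_cons.1 hv with rfl | hv
    · exact Or.inl rfl
    · rcases h3 v hv with h | rfl | rfl
      · exact Or.inr h.1
      · exact Or.inr hpM
      · exact Or.inr hrM
  · rcases h.mem_right (Or.inr rfl) with h | h
    · exact absurd hq h.2
    · exact absurd h.symm hpq

/-- Two vertices of a chordless cycle that have neighbors in the same connected set outside the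
cycle are adjacent. -/
theorem adj_of_attached (hG : CyclicallyOrientable G) {z : List V} (hz : IsChordlessCycle G z)
    {K : Set V} (hK : ∀ a ∈ K, ∀ b ∈ K, Conn G K a b) (hKz : ∀ v ∈ K, v ∉ z) {x y k k' : V}
    (hx : x ∈ z) (hy : y ∈ z) (hxy : x ≠ y) (hk : k ∈ K) (hxk : G.Adj x k) (hk' : k' ∈ K)
    (hyk : G.Adj y k') : G.Adj x y := by
  by_contra hn
  -- The cycle neighbors `p`, `q` of `x` and its last neighbor `r` in `K` all reach `y` without
  -- meeting the neighborhood of `x` again. Since `y` is not adjacent to `x`, joining these walks at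
  -- `y` links the three pairwise.
  obtain ⟨p, q, hp, hq, hpq, hxp, hxq, hnb, -, hcp, hcq⟩ := hz.around hx
  obtain ⟨r, hr, hxr, hc⟩ := exists_last_neighbor (fun h => hKz x h hx) hk hxk (hK k hk k' hk')
  have hyp : y ≠ p := by rintro rfl; exact hn hxp
  have hyq : y ≠ q := by rintro rfl; exact hn hxq
  have hry : Conn G {v | (v ≠ x ∧ ¬ G.Adj x v) ∨ v = r} r y := by
    refine (hc.mono ?_).trans (Conn.single hyk.symm ?_ (Or.inl ⟨hxy.symm, hn⟩))
    · rintro v (hv | hv)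
      · exact Or.inl hv.2
      · exact Or.inr hv
    · rcases hc.mem_right (Or.inr rfl) with hv | hv
      · exact Or.inl hv.2
      · exact Or.inr hv
  have h1 : Conn G {v | (v ≠ x ∧ ¬ G.Adj x v) ∨ v = p} p y := by
    refine (hcp y hy hxy.symm hyq).mono ?_
    rintro v ⟨hv, hv'⟩
    simp only [Set.mem_insert_iff, Set.mem_singleton_iff, not_or] at hv'
    by_cases hxv : G.Adj x v
    · exact Or.inr ((hnb v hv hxv).resolve_right hv'.2)
    · exact Or.inl ⟨hv'.1, hxv⟩
  have h2 : Conn G {v | (v ≠ x ∧ ¬ G.Adj x v) ∨ v = q} y q := by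
    refine (hcq y hy hxy.symm hyp).mono ?_
    rintro v ⟨hv, hv'⟩
    simp only [Set.mem_insert_iff, Set.mem_singleton_iff, not_or] at hv'
    by_cases hxv : G.Adj x v
    · exact Or.inr ((hnb v hv hxv).resolve_left hv'.2)
    · exact Or.inl ⟨hv'.1, hxv⟩
  have join : ∀ {s t : V}, Conn G {v | (v ≠ x ∧ ¬ G.Adj x v) ∨ v = s} s y →
      Conn G {v | (v ≠ x ∧ ¬ G.Adj x v) ∨ v = t} y t → Linked G x s t := by
    intro s t hs ht
    refine (hs.mono ?_).trans (ht.mono ?_)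
    · rintro v (hv | hv)
      · exact Or.inl hv
      · exact Or.inr (Or.inl hv)
    · rintro v (hv | hv)
      · exact Or.inl hv
      · exact Or.inr (Or.inr hv)
  refine not_three_linked hG hxp hxq hxr hpq ?_ ?_ (join h1 h2) (join h1 hry.symm)
    (join h2.symm hry.symm)
  · rintro rfl; exact hKz _ hr hp
  · rintro rfl; exact hKz _ hr hq

/-- No connected set outside a triangle has neighbors at all three corners. -/
theorem not_attached_triangle (hG : CyclicallyOrientable G) {a b c ka kb kc : V}
    (hab : G.Adj a b) (hac : G.Adj a c) (hbc : G.Adj b c) {K : Set V}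
    (hK : ∀ u ∈ K, ∀ v ∈ K, Conn G K u v) (haK : a ∉ K) (hbK : b ∉ K) (hcK : c ∉ K)
    (hka : ka ∈ K) (hkb : kb ∈ K) (hkc : kc ∈ K) (haka : G.Adj a ka) (hbkb : G.Adj b kb)
    (hckc : G.Adj c kc) : False := by
  -- A chordless cycle through the edge `ab` whose other vertices lie in `K`; it misses `c`.
  obtain ⟨z, hz, haz, hbz, hzK⟩ := exists_isChordlessCycle_through (M := {b} ∪ K) (c := a)
    (p := b) (q := ka) (by simp [hab.ne, haK]) (by simp) hab haka
    (by rintro rfl; exact hbK hka)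
    ((Conn.single hbkb (by simp) (by simp [hkb])).trans
      ((hK kb hkb ka hka).mono Set.subset_union_right))
  have hzK' : ∀ v ∈ z, v ≠ a → v ≠ b → v ∈ K := by
    intro v hv hva hvb
    rcases hzK v hv with h | h | h
    · exact absurd h hva
    · exact absurd h hvb
    · exact h
  have hcz : c ∉ z := fun h => hcK (hzK' c h hac.ne' hbc.ne')
  obtain ⟨q0, hq0, hq0K⟩ : ∃ q0 ∈ z, q0 ∈ K := by
    obtain ⟨p, q, hp, hq, hpq, hap, haq, -⟩ := hz.around haz
    by_cases hpb : p = b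
    · exact ⟨q, hq, hzK' q hq haq.ne' (by rintro rfl; exact hpq hpb)⟩
    · exact ⟨p, hp, hzK' p hp hap.ne' hpb⟩
  -- The component of `c` off `z` touches `z` at some `q` in `K`. It is also attached to `a` and
  -- `b`, so both of these are adjacent to `q`.
  set S : Set V := ({c} ∪ K) \ {v | v ∈ z} with hS
  have hcS : c ∈ S := ⟨by simp, hcz⟩
  have hcq0 : Conn G ({c} ∪ K) c q0 := (Conn.single hckc (by simp) (by simp [hkc])).trans
    ((hK kc hkc q0 hq0K).mono Set.subset_union_right)
  obtain ⟨u, hu, q, hq, -, hqn, huq⟩ := hcq0.exists_exit (U := reach G S c) self_mem_reach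
    (fun h => (reach_subset hcS h).2 hq0)
  have hqz : q ∈ z := by
    by_contra h
    exact hqn (mem_reach_of_adj hcS hu huq ⟨hq, h⟩)
  have hqK : q ∈ K := by
    rcases hq with h | h
    · exact absurd (h ▸ hqz) hcz
    · exact h
  have att : ∀ {x}, x ∈ z → x ≠ q → G.Adj x c → G.Adj x q := fun hx hxq hxc =>
    adj_of_attached hG hz (reach_connected hcS) (fun v hv => (reach_subset hcS hv).2) hx hqz hxq
      self_mem_reach hxc hu huq.symm
  have haq : G.Adj a q := att haz (by rintro rfl; exact haK hqK) hac
  have hbq : G.Adj b q := att hbz (by rintro rfl; exact hbK hqK) hbc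
  by_cases hcq : G.Adj c q
  · exact not_three_linked hG hac.symm hbc.symm hcq hab.ne haq.ne hbq.ne (Linked.of_adj hab)
      (Linked.of_adj haq) (Linked.of_adj hbq)
  -- Now `q` is not a neighbor of `c`; its role passes to the last neighbor `r` of `c` on the way to
  -- `q`, which `a` and `b` reach through `q`.
  · obtain ⟨r, hr, hcr, hconn⟩ := exists_last_neighbor hcK hkc hckc (hK kc hkc q hqK)
    have hqc : q ≠ c := by rintro rfl; exact hcK hqK
    have link : ∀ {x}, G.Adj x q → Linked G c x r := by
      intro x hxq
      refine (Conn.single hxq (Or.inr (Or.inl rfl)) (Or.inl ⟨hqc, hcq⟩)).trans (hconn.symm.mono ?_)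
      rintro v (hv | hv)
      · exact Or.inl hv.2
      · exact Or.inr (Or.inr hv)
    exact not_three_linked hG hac.symm hbc.symm hcr hab.ne (by rintro rfl; exact haK hr)
      (by rintro rfl; exact hbK hr) (Linked.of_adj hab) (link haq) (link hbq)

/-- In a two-connected set with at least three vertices every vertex has two neighbors. -/
theorem TwoConnectedOn.exists_two_neighbors [Finite V] {T : Set V} (hT : TwoConnectedOn G T)
    (h3 : 3 ≤ T.ncard) {c : V} (hc : c ∈ T) :
    ∃ p ∈ T, ∃ q ∈ T, p ≠ q ∧ G.Adj c p ∧ G.Adj c q := by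
  rw [twoConnectedOn_iff] at hT
  obtain ⟨d, hd, hdc⟩ := hT.1.exists_ne c
  obtain ⟨u, rfl, p, hp, -, -, hcp⟩ := (hT.2.1 c hc d hd).exists_exit (U := {c}) rfl hdc
  obtain ⟨e, he, hne⟩ : ∃ e ∈ T, e ∉ ({u, p} : Set V) := by
    by_contra! h
    have := Set.ncard_le_ncard (s := T) (t := {u, p}) h (Set.toFinite _)
    have := Set.ncard_insert_le u {p}
    rw [Set.ncard_singleton] at this
    omega
  simp only [Set.mem_insert_iff, Set.mem_singleton_iff, not_or] at hne
  obtain ⟨_, rfl, q, hq, -, -, hcq⟩ := (hT.2.2 p hp u ⟨hc, hcp.ne⟩ e ⟨he, hne.2⟩).exists_exit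
    (U := {u}) rfl hne.1
  exact ⟨p, hp, q, hq.1, fun h => hq.2 h.symm, hcp, hcq⟩

/-- Two neighbors of a vertex `c` remain joined after the removal of `c`. -/
theorem TwoConnectedOn.exists_isChordlessCycle [Finite V] {T : Set V} (hT : TwoConnectedOn G T)
    (h3 : 3 ≤ T.ncard) : ∃ z, IsChordlessCycle G z ∧ ∀ v ∈ z, v ∈ T := by
  obtain ⟨c, hc⟩ := hT.1.nonempty
  obtain ⟨p, hp, q, hq, hpq, hcp, hcq⟩ := hT.exists_two_neighbors h3 hc
  rw [twoConnectedOn_iff] at hT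
  obtain ⟨z, hz, -, -, hzT⟩ := exists_isChordlessCycle_through (M := T \ {c}) (by simp)
    ⟨hp, hcp.ne'⟩ hcp hcq hpq (hT.2.2 c hc p ⟨hp, hcp.ne'⟩ q ⟨hq, hcq.ne'⟩)
  refine ⟨z, hz, fun v hv => ?_⟩
  rcases hzT v hv with rfl | h
  · exact hc
  · exact h.1

/-- A two-connected cyclically orientable graph with at least three vertices has a chordless cycle
that is attached to the rest of the graph along at most one of its edges. -/
theorem exists_ear [Finite V] (hG : CyclicallyOrientable G) {T : Set V}
    (hT : TwoConnectedOn G T) (h3 : 3 ≤ T.ncard) :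
    ∃ z x y, IsChordlessCycle G z ∧ (∀ v ∈ z, v ∈ T) ∧ x ∈ z ∧ y ∈ z ∧ G.Adj x y ∧
      ∀ v ∈ z, v ≠ x → v ≠ y → ∀ w ∈ T, G.Adj v w → w ∈ z := by
  obtain ⟨z₀, hz₀, hz₀T⟩ := hT.exists_isChordlessCycle h3
  rw [twoConnectedOn_iff] at hT
  let out (z : List V) : Set V := T \ {v | v ∈ z}
  -- If no chordless cycle in `T` misses a vertex of `T`, any edge of any such cycle will do.
  by_cases hex : ∃ z a, IsChordlessCycle G z ∧ (∀ v ∈ z, v ∈ T) ∧ a ∈ out z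
  swap
  · push Not at hex
    have hz₀' : ∀ w ∈ T, w ∈ z₀ := by
      intro w hw
      by_contra h
      exact hex z₀ w hz₀ hz₀T ⟨hw, h⟩
    obtain ⟨x, hx⟩ := hz₀.1.exists_mem
    obtain ⟨p, q, hp, -, -, hxp, -⟩ := hz₀.around hx
    exact ⟨z₀, x, p, hz₀, hz₀T, hx, hp, hxp, fun _ _ _ _ w hw _ => hz₀' w hw⟩
  -- Choose the cycle and a component of its complement such that this component is as large as
  -- possible; the difference from the number of vertices turns the maximum into a minimum.
  obtain ⟨⟨z, a⟩, ⟨hz, hzT, ha⟩, hmax⟩ := WellFounded.has_min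
    (InvImage.wf (fun i : List V × V => Nat.card V - (reach G (out i.1) i.2).ncard) Nat.lt_wfRel.wf)
    {i : List V × V | IsChordlessCycle G i.1 ∧ (∀ v ∈ i.1, v ∈ T) ∧ i.2 ∈ out i.1}
    (by obtain ⟨z, a, h⟩ := hex; exact ⟨(z, a), h⟩)
  replace hmax : ∀ z' a', IsChordlessCycle G z' → (∀ v ∈ z', v ∈ T) → a' ∈ out z' →
      (reach G (out z') a').ncard ≤ (reach G (out z) a).ncard := by
    intro z' a' h1 h2 h3
    have h := hmax (z', a') ⟨h1, h2, h3⟩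
    have h : ¬ (Nat.card V - (reach G (out z') a').ncard
      < Nat.card V - (reach G (out z) a).ncard) := h
    have := Set.ncard_le_card (reach G (out z') a')
    omega
  simp only at hz hzT ha
  -- Since `e` is not a cut vertex, each component of the complement has a neighbor on the cycle
  -- other than `e`.
  have attach : ∀ b ∈ out z, ∀ e ∈ z, ∃ x ∈ z, x ≠ e ∧ ∃ k ∈ reach G (out z) b, G.Adj x k := by
    intro b hb e he
    obtain ⟨p, q, hp, -, -, hep, -⟩ := hz.around he
    have hc := hT.2.2 e (hzT e he) b ⟨hb.1, fun h => hb.2 (h ▸ he)⟩ p ⟨hzT p hp, hep.ne'⟩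
    obtain ⟨u, hu, w, hw, -, hwn, huw⟩ := hc.exists_exit (U := reach G (out z) b) self_mem_reach
      (fun h => (reach_subset hb h).2 hp)
    refine ⟨w, ?_, hw.2, u, hu, huw.symm⟩
    by_contra h
    exact hwn (mem_reach_of_adj hb hu huw ⟨hw.1, h⟩)
  have adj : ∀ b ∈ out z, ∀ x ∈ z, ∀ y ∈ z, x ≠ y → (∃ k ∈ reach G (out z) b, G.Adj x k) →
      (∃ k ∈ reach G (out z) b, G.Adj y k) → G.Adj x y := by
    rintro b hb x hx y hy hxy ⟨k, hk, hxk⟩ ⟨k', hk', hyk⟩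
    exact adj_of_attached hG hz (reach_connected hb) (fun v hv => (reach_subset hb hv).2) hx hy hxy
      hk hxk hk' hyk
  obtain ⟨x, hx, hxa⟩ : ∃ x ∈ z, ∃ k ∈ reach G (out z) a, G.Adj x k := by
    obtain ⟨e, he⟩ := hz.1.exists_mem
    obtain ⟨x, hx, -, h⟩ := attach a ha e he
    exact ⟨x, hx, h⟩
  obtain ⟨y, hy, hyx, hya⟩ := attach a ha x hx
  have hxy := adj a ha x hx y hy hyx.symm hxa hya
  refine ⟨z, x, y, hz, hzT, hx, hy, hxy, fun v hv hvx hvy w hw hvw => ?_⟩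
  by_contra hwz
  have hwo : w ∈ out z := ⟨hw, hwz⟩
  -- Otherwise `x`, `y`, `v` form a triangle with one connected set attached to all its corners.
  have hva : ¬ ∃ k ∈ reach G (out z) a, G.Adj v k := by
    intro hva
    have h1 := adj a ha x hx v hv hvx.symm hxa hva
    have h2 := adj a ha y hy v hv hvy.symm hya hva
    obtain ⟨ka, hka, haka⟩ := hxa
    obtain ⟨kb, hkb, hbkb⟩ := hya
    obtain ⟨kc, hkc, hckc⟩ := hva
    have hn : ∀ {u}, u ∈ z → u ∉ reach G (out z) a := fun hu h => (reach_subset ha h).2 hu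
    exact not_attached_triangle hG hxy h1 h2 (reach_connected ha) (hn hx) (hn hy) (hn hv)
      hka hkb hkc haka hbkb hckc
  obtain ⟨v', hv', hvv', hv'w⟩ := attach w hwo v hv
  have hadj : G.Adj v v' := adj w hwo v hv v' hv' hvv'.symm ⟨w, self_mem_reach, hvw⟩ hv'w
  obtain ⟨k, hk, hv'k⟩ := hv'w
  have hn : ∀ {u}, u ∈ z → u ∉ reach G (out z) w := fun hu h => (reach_subset hwo h).2 hu
  -- A new cycle inside `v`, `v'` and the component of `w`; it misses the component of `a`, which is
  -- a different one because `v` is not attached to it.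
  obtain ⟨z', hz', -, -, hz'K⟩ := exists_isChordlessCycle_through
    (M := {v'} ∪ reach G (out z) w) (c := v) (p := v') (q := w) (by simp [hvv'.symm, hn hv])
    (by simp) hadj hvw (by rintro rfl; exact hwz hv')
    ((Conn.single hv'k (by simp) (by simp [hk])).trans
      ((reach_connected hwo k hk w self_mem_reach).mono Set.subset_union_right))
  have hdisj : ∀ u ∈ reach G (out z) a, u ∉ reach G (out z) w := by
    intro u hu hu'
    exact hva ⟨w, Conn.trans hu hu'.symm, hvw⟩
  have hsub : ∀ u ∈ reach G (out z) a, u ∈ out z' := by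
    intro u hu
    have huz := reach_subset ha hu
    refine ⟨huz.1, fun h => ?_⟩
    rcases hz'K u h with rfl | rfl | h
    · exact huz.2 hv
    · exact huz.2 hv'
    · exact hdisj u hu h
  -- One of `x`, `y` is off the new cycle. It enlarges the component of `a`, against the maximal
  -- choice.
  obtain ⟨t, ht, htv', htv, k', hk', htk⟩ : ∃ t ∈ z, t ≠ v' ∧ t ≠ v ∧
      ∃ k ∈ reach G (out z) a, G.Adj t k := by
    by_cases h : x = v'
    · exact ⟨y, hy, by rintro rfl; exact hyx h.symm, hvy.symm, hya⟩
    · exact ⟨x, hx, h, hvx.symm, hxa⟩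
  have hto : t ∈ out z' := by
    refine ⟨hzT t ht, fun h => ?_⟩
    rcases hz'K t h with h | h | h
    · exact htv h
    · exact htv' h
    · exact hn ht h
  have hle := hmax z' a hz' (fun u hu => ?_) (hsub a self_mem_reach)
  · have hss : insert t (reach G (out z) a) ⊆ reach G (out z') a := by
      have h1 : reach G (out z) a ⊆ reach G (out z') a := fun u hu =>
        (reach_connected ha a self_mem_reach u hu).mono hsub
      rintro u (rfl | hu)
      · exact mem_reach_of_adj (hsub a self_mem_reach) (h1 hk') htk.symm hto
      · exact h1 hu
    have h1 := Set.ncard_le_ncard hss (Set.toFinite _)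
    rw [Set.ncard_insert_of_notMem (fun h => (reach_subset ha h).2 ht) (Set.toFinite _)] at h1
    omega
  · rcases hz'K u hu with rfl | rfl | h
    · exact hzT _ hv
    · exact hzT _ hv'
    · exact (reach_subset hwo h).1

/-! ### The number of edges -/

/-- The edges of `G` inside `S`. -/
def edgesIn (G : SimpleGraph V) (S : Set V) : Set (Sym2 V) := {e | e ∈ G.edgeSet ∧ ∀ v ∈ e, v ∈ S}

theorem mem_edgesIn {S : Set V} {a b : V} : s(a, b) ∈ edgesIn G S ↔ G.Adj a b ∧ a ∈ S ∧ b ∈ S := by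
  simp [edgesIn]

theorem numEdges_eq (S : Set V) : numEdges G S = (edgesIn G S).ncard := by
  have : edgesIn G S = Sym2.map Subtype.val '' (G.induce S).edgeSet := by
    ext e
    induction e using Sym2.ind with
    | _ a b =>
      rw [mem_edgesIn]
      constructor
      · rintro ⟨h, ha, hb⟩
        exact ⟨s(⟨a, ha⟩, ⟨b, hb⟩), by simpa using h, by simp⟩
      · rintro ⟨e, he, h⟩
        induction e using Sym2.ind with
        | _ c d =>
          have he : G.Adj c d := by simpa using he
          rw [Sym2.map_mk, Sym2.eq_iff] at h
          rcases h with ⟨rfl, rfl⟩ | ⟨rfl, rfl⟩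
          · exact ⟨he, c.2, d.2⟩
          · exact ⟨he.symm, d.2, c.2⟩
  rw [this, Set.ncard_image_of_injective _ (Sym2.map.injective Subtype.val_injective)]
  rfl

theorem numEdges_le_of_subset [Finite V] {S : Set V} {E : Set (Sym2 V)}
    (h : ∀ a ∈ S, ∀ b ∈ S, G.Adj a b → s(a, b) ∈ E) : numEdges G S ≤ E.ncard := by
  rw [numEdges_eq]
  refine Set.ncard_le_ncard ?_ (Set.toFinite _)
  intro e
  induction e using Sym2.ind with
  | _ a b => intro he; rw [mem_edgesIn] at he; exact h a he.2.1 b he.2.2 he.1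

theorem numEdges_le_add [Finite V] {S A B : Set V}
    (h : ∀ a ∈ S, ∀ b ∈ S, G.Adj a b → (a ∈ A ∧ b ∈ A) ∨ (a ∈ B ∧ b ∈ B)) :
    numEdges G S ≤ numEdges G A + numEdges G B := by
  rw [numEdges_eq A, numEdges_eq B]
  refine (numEdges_le_of_subset (E := edgesIn G A ∪ edgesIn G B) ?_).trans (Set.ncard_union_le _ _)
  intro a ha b hb hab
  rcases h a ha b hb hab with h | h
  · exact Or.inl (mem_edgesIn.2 ⟨hab, h⟩)
  · exact Or.inr (mem_edgesIn.2 ⟨hab, h⟩)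

theorem numEdges_eq_zero [Finite V] {S : Set V} (h : S.ncard ≤ 1) : numEdges G S = 0 := by
  have : numEdges G S ≤ (∅ : Set (Sym2 V)).ncard := by
    refine numEdges_le_of_subset fun a ha b hb hab => ?_
    exact absurd ((Set.ncard_le_one (Set.toFinite S)).1 h a ha b hb) hab.ne
  simpa using this

/-- Allowing `Z` to be empty or a single vertex treats a disconnected set and a cut vertex alike. -/
theorem exists_separation {S : Set V} (hS : S.Nontrivial) (h : ¬ TwoConnectedOn G S) :
    ∃ Z : Set V, Z.ncard ≤ 1 ∧ Z ⊆ S ∧ ∃ a ∈ S \ Z, ∃ b ∈ S \ Z, ¬ Conn G (S \ Z) a b := by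
  rw [twoConnectedOn_iff] at h
  by_contra! hc
  refine h ⟨hS, fun a ha b hb => ?_, fun v hv a ha b hb => ?_⟩
  · simpa using hc ∅ (by simp) (by simp) a (by simpa using ha) b (by simpa using hb)
  · exact hc {v} (by simp) (by simpa using hv) a ha b hb

/-- A cyclically orientable graph with `n ≥ 2` vertices has at most `2n - 3` edges. -/
theorem numEdges_add_three_le [Finite V] (hG : CyclicallyOrientable G) (S : Set V)
    (hS : 2 ≤ S.ncard) : numEdges G S + 3 ≤ 2 * S.ncard := by
  induction hn : S.ncard using Nat.strong_induction_on generalizing S with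
  | _ n ih =>
    subst hn
    -- A single vertex violates the inequality, so it is kept as a separate alternative.
    have bound : ∀ A : Set V, A.ncard < S.ncard → A.Nonempty →
        numEdges G A + 3 ≤ 2 * A.ncard ∨ (numEdges G A = 0 ∧ A.ncard = 1) := by
      intro A hA hne
      have := (Set.ncard_pos (Set.toFinite A)).2 hne
      rcases Nat.lt_or_ge A.ncard 2 with h | h
      · exact Or.inr ⟨numEdges_eq_zero (by omega), by omega⟩
      · exact Or.inl (ih _ hA A h rfl)
    rcases hS.eq_or_lt with h2 | h3
    · obtain ⟨a, b, -, rfl⟩ := Set.ncard_eq_two.1 h2.symm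
      have : numEdges G {a, b} ≤ ({s(a, b)} : Set (Sym2 V)).ncard := by
        refine numEdges_le_of_subset fun c hc d hd hcd => ?_
        rcases hc with rfl | rfl <;> rcases hd with rfl | rfl
        · exact absurd hcd G.irrefl
        · rfl
        · exact Sym2.eq_swap
        · exact absurd hcd G.irrefl
      rw [Set.ncard_singleton] at this
      omega
    by_cases hT : TwoConnectedOn G S
    · obtain ⟨z, x, y, hz, hzS, hx, hy, hxy, hear⟩ := exists_ear hG hT h3
      -- An inner vertex of the ear has only its two cycle neighbors in `S`, so its removal costs at
      -- most two edges.
      obtain ⟨v, hv, hvx, hvy⟩ : ∃ v ∈ z, v ≠ x ∧ v ≠ y := by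
        obtain ⟨p, q, hp, hq, hpq, hxp, hxq, -⟩ := hz.around hx
        by_cases h : p = y
        · exact ⟨q, hq, hxq.ne', by rintro rfl; exact hpq h⟩
        · exact ⟨p, hp, hxp.ne', h⟩
      obtain ⟨p, q, -, -, -, -, -, hpq, -⟩ := hz.around hv
      have hcard := Set.ncard_sdiff_singleton_add_one (hzS v hv) (Set.toFinite S)
      have h1 : numEdges G S ≤ (edgesIn G (S \ {v}) ∪ {s(v, p), s(v, q)}).ncard := by
        refine numEdges_le_of_subset fun c hc d hd hcd => ?_
        by_cases hcv : c = v
        · subst hcv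
          rcases hpq d (hear c hv hvx hvy d hd hcd) hcd with rfl | rfl <;> simp
        · by_cases hdv : d = v
          · subst hdv
            rw [Sym2.eq_swap]
            rcases hpq c (hear d hv hvx hvy c hc hcd.symm) hcd.symm with rfl | rfl <;> simp
          · exact Or.inl (mem_edgesIn.2 ⟨hcd, ⟨hc, hcv⟩, ⟨hd, hdv⟩⟩)
      have h2 := Set.ncard_union_le (edgesIn G (S \ {v})) {s(v, p), s(v, q)}
      have h4 := Set.ncard_insert_le (s(v, p)) {s(v, q)}
      rw [Set.ncard_singleton] at h4
      rw [← numEdges_eq] at h2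
      have := ih _ (by omega) (S \ {v}) (by omega) rfl
      omega
    · obtain ⟨Z, hZ, hZS, a, ha, b, hb, hab⟩ := exists_separation
        (Set.one_lt_ncard_iff_nontrivial.1 (by omega)) hT
      -- Every edge lies in `R ∪ Z` or in `S \ R`, and the sizes of these proper subsets add up to
      -- at most one more than that of `S`.
      set R := reach G (S \ Z) a with hR
      have hRS := reach_subset (G := G) ha
      have hAB : numEdges G S ≤ numEdges G (R ∪ Z) + numEdges G (S \ R) := by
        refine numEdges_le_add fun c hc d hd hcd => ?_
        by_cases hcR : c ∈ R
        · left
          refine ⟨Or.inl hcR, ?_⟩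
          by_cases hdZ : d ∈ Z
          · exact Or.inr hdZ
          · exact Or.inl (mem_reach_of_adj ha hcR hcd ⟨hd, hdZ⟩)
        · by_cases hdR : d ∈ R
          · left
            refine ⟨?_, Or.inl hdR⟩
            by_contra h
            rw [Set.mem_union, not_or] at h
            exact hcR (mem_reach_of_adj ha hdR hcd.symm ⟨hc, h.2⟩)
          · exact Or.inr ⟨⟨hc, hcR⟩, ⟨hd, hdR⟩⟩
      have hA : (R ∪ Z).ncard < S.ncard := by
        refine Set.ncard_lt_ncard ?_ (Set.toFinite _)
        refine ⟨Set.union_subset (fun v hv => (hRS hv).1) hZS, fun h => ?_⟩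
        exact (h hb.1).elim hab hb.2
      have hB : (S \ R).ncard < S.ncard := by
        refine Set.ncard_lt_ncard ?_ (Set.toFinite _)
        exact ⟨Set.sdiff_subset, fun h => (h ha.1).2 self_mem_reach⟩
      have hsum : (S \ R).ncard + R.ncard = S.ncard :=
        Set.ncard_sdiff_add_ncard_of_subset (fun v hv => (hRS hv).1) (Set.toFinite _)
      have hun := Set.ncard_union_le R Z
      have b1 := bound _ hA ⟨a, Or.inl self_mem_reach⟩
      have b2 := bound _ hB ⟨b, hb.1, hab⟩
      omega

theorem not_tooManyEdges [Finite V] (hG : CyclicallyOrientable G) {S : Set V}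
    (hS : 2 ≤ S.ncard) : ¬ TooManyEdges G S := by
  have := numEdges_add_three_le hG S hS
  unfold TooManyEdges
  omega

theorem TwoConnectedOn.two_le_ncard [Finite V] {S : Set V} (h : TwoConnectedOn G S) :
    2 ≤ S.ncard :=
  Set.one_lt_ncard_iff_nontrivial.2 h.1

/-- A connected set of two vertices carries exactly one edge. This translates the condition on the
listed components into the size that `exists_ear` needs. -/
theorem TwoConnectedOn.three_le_ncard [Finite V] {S : Set V} (h : TwoConnectedOn G S)
    (hE : numEdges G S ≠ 1) : 3 ≤ S.ncard := by
  rcases h.two_le_ncard.eq_or_lt with h2 | h3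
  · exfalso
    obtain ⟨a, b, hne, rfl⟩ := Set.ncard_eq_two.1 h2.symm
    have hc := (twoConnectedOn_iff.1 h).2.1 a (by simp) b (by simp)
    obtain ⟨u, rfl, w, hw, -, hwu, hadj⟩ := hc.exists_exit (U := {a}) rfl hne.symm
    obtain rfl : w = b := by
      rcases hw with rfl | rfl
      · exact absurd rfl hwu
      · rfl
    apply hE
    rw [numEdges_eq, Set.ncard_eq_one]
    refine ⟨s(u, w), ?_⟩
    ext e
    induction e using Sym2.ind with
    | _ c d =>
      rw [mem_edgesIn, Set.mem_singleton_iff, Sym2.eq_iff]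
      constructor
      · rintro ⟨hcd, rfl | rfl, rfl | rfl⟩
        · exact absurd hcd G.irrefl
        · exact Or.inl ⟨rfl, rfl⟩
        · exact Or.inr ⟨rfl, rfl⟩
        · exact absurd hcd G.irrefl
      · rintro (⟨rfl, rfl⟩ | ⟨rfl, rfl⟩)
        · exact ⟨hadj, by simp, by simp⟩
        · exact ⟨hadj.symm, by simp, by simp⟩
  · exact h3

/-! ### Chordless cycles and two-connected components -/

/-- Deleting a vertex from a cycle leaves a path. -/
theorem IsChordlessCycle.twoConnectedOn {z : List V} (hz : IsChordlessCycle G z) :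
    TwoConnectedOn G {v | v ∈ z} := by
  rw [twoConnectedOn_iff]
  refine ⟨?_, ?_, ?_⟩
  · obtain ⟨x, hx⟩ := hz.1.exists_mem
    obtain ⟨p, q, hp, hq, hpq, -⟩ := hz.around hx
    exact ⟨p, hp, q, hq, hpq⟩
  · have key : ∀ a ∈ z, ∀ b ∈ z, a ≠ b → Conn G {v | v ∈ z} a b := by
      intro a ha b hb hab
      obtain ⟨p, q, hp, hq, hpq, hap, haq, -, hc, -⟩ := hz.around ha
      exact (Conn.single hap ha hp).trans ((hc b hb hab.symm).mono Set.sdiff_subset)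
    intro a ha b hb
    by_cases hab : a = b
    · subst hab; exact Conn.refl _ _
    · exact key a ha b hb hab
  · intro v hv a ha b hb
    obtain ⟨p, q, -, -, -, -, -, -, hc, -⟩ := hz.around hv
    exact (hc a ha.1 ha.2).symm.trans (hc b hb.1 hb.2)

/-- The vertices of the cycle form a two-connected set, which extends to a maximal one; two edges of
the cycle at one vertex show that it is not a single edge. -/
theorem IsChordlessCycle.exists_component [Finite V] {z : List V} (hz : IsChordlessCycle G z) :
    ∃ S, IsTwoConnectedComponent G S ∧ numEdges G S ≠ 1 ∧ ∀ v ∈ z, v ∈ S := by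
  obtain ⟨S, hzS, hS⟩ := Set.Finite.exists_le_maximal (s := {S | TwoConnectedOn G S})
    (Set.toFinite _) hz.twoConnectedOn
  refine ⟨S, hS, fun hE => ?_, hzS⟩
  obtain ⟨x, hx⟩ := hz.1.exists_mem
  obtain ⟨p, q, hp, hq, hpq, hxp, hxq, -⟩ := hz.around hx
  rw [numEdges_eq, Set.ncard_eq_one] at hE
  obtain ⟨e, he⟩ := hE
  have h1 : s(x, p) ∈ edgesIn G S := mem_edgesIn.2 ⟨hxp, hzS hx, hzS hp⟩
  have h2 : s(x, q) ∈ edgesIn G S := mem_edgesIn.2 ⟨hxq, hzS hx, hzS hq⟩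
  rw [he, Set.mem_singleton_iff] at h1 h2
  exact hpq (Sym2.congr_right.1 (h1.trans h2.symm))

/-- Removing a set attached along one edge keeps a set two-connected. -/
theorem TwoConnectedOn.diff {T P : Set V} (hT : TwoConnectedOn G T) {x y : V} (hx : x ∈ T \ P)
    (hy : y ∈ T \ P) (hxy : G.Adj x y)
    (hP : ∀ v ∈ P, ∀ t ∈ T, G.Adj v t → t ∈ P ∨ t = x ∨ t = y) : TwoConnectedOn G (T \ P) := by
  rw [twoConnectedOn_iff] at hT ⊢
  -- While the walk is inside `P`, the end `e` through which it entered is remembered; when it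
  -- leaves, it does so at `x` or `y`, and the edge `xy` replaces the excursion. The set `W` will be
  -- `T` or `T` without one vertex.
  have key : ∀ W ⊆ T, ∀ a b, a ∈ W \ P → Conn G W a b → (b ∉ P → Conn G (W \ P) a b) ∧
      (b ∈ P → ∃ e ∈ W \ P, (e = x ∨ e = y) ∧ Conn G (W \ P) a e) := by
    intro W hW a b ha h
    induction h with
    | refl => exact ⟨fun _ => Conn.refl _ _, fun h => absurd h ha.2⟩
    | @tail b c hb h ih =>
      by_cases hbP : b ∈ P
      · obtain ⟨e, he, hxe, hc⟩ := ih.2 hbP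
        refine ⟨fun hcP => ?_, fun _ => ⟨e, he, hxe, hc⟩⟩
        have := (hP b hbP c (hW h.2.2) h.1).resolve_left hcP
        by_cases hce : e = c
        · exact hce ▸ hc
        · refine hc.trans (Conn.single ?_ he ⟨h.2.2, hcP⟩)
          rcases hxe with rfl | rfl <;> rcases this with rfl | rfl
          · exact absurd rfl hce
          · exact hxy
          · exact hxy.symm
          · exact absurd rfl hce
      · have hc := ih.1 hbP
        refine ⟨fun hcP => hc.trans (Conn.single h.1 ⟨h.2.1, hbP⟩ ⟨h.2.2, hcP⟩), fun hcP => ?_⟩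
        exact ⟨b, ⟨h.2.1, hbP⟩, (hP c hcP b (hW h.2.1) h.1.symm).resolve_left hbP, hc⟩
  refine ⟨⟨x, hx, y, hy, hxy.ne⟩, fun a ha b hb => ?_, fun v hv a ha b hb => ?_⟩
  · exact (key T subset_rfl a b ha (hT.2.1 a ha.1 b hb.1)).1 hb.2
  · have := (key (T \ {v}) Set.sdiff_subset a b ⟨⟨ha.1.1, ha.2⟩, ha.1.2⟩
      (hT.2.2 v hv.1 a ⟨ha.1.1, ha.2⟩ b ⟨hb.1.1, hb.2⟩)).1 hb.1.2
    rwa [Set.sdiff_sdiff_comm] at this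

/-! ### Vertices of degree at most two -/

/-- `v` has at most two neighbors in `T`. -/
def Thin (G : SimpleGraph V) (T : Set V) (v : V) : Prop := (G.neighborSet v ∩ T).ncard ≤ 2

theorem Thin.mono [Finite V] {T T' : Set V} (hT : T' ⊆ T) {v : V} (h : Thin G T v) :
    Thin G T' v :=
  (Set.ncard_le_ncard (Set.inter_subset_inter_right _ hT) (Set.toFinite _)).trans h

theorem Thin.eq_or_eq [Finite V] {T : Set V} {v p q t : V} (h : Thin G T v) (hpq : p ≠ q)
    (hp : p ∈ T) (hq : q ∈ T) (ht : t ∈ T) (hvp : G.Adj v p) (hvq : G.Adj v q)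
    (hvt : G.Adj v t) : t = p ∨ t = q := by
  by_contra! hc
  have hsub : {t, p, q} ⊆ G.neighborSet v ∩ T := by
    rintro w (rfl | rfl | rfl)
    · exact ⟨hvt, ht⟩
    · exact ⟨hvp, hp⟩
    · exact ⟨hvq, hq⟩
  have h1 := Set.ncard_le_ncard hsub (Set.toFinite _)
  have h2 : ({t, p, q} : Set V).ncard = 3 :=
    Set.ncard_eq_three.2 ⟨t, p, q, hc.1, hc.2, hpq, rfl⟩
  unfold Thin at h
  omega

/-- A chord at a thin vertex would give it a third neighbor, and an edge between the first and the
last vertex is the closing edge. -/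
theorem isChordlessCycle_of_thin [Finite V] {T : Set V} {l : List V} (hl : IsCycle G l)
    (hT : ∀ v ∈ l, v ∈ T) (h : ∀ v ∈ l, Thin G T v ∨ l.head? = some v ∨ l.getLast? = some v) :
    IsChordlessCycle G l := by
  refine ⟨hl, fun a ha b hb hab => ?_⟩
  obtain ⟨h1, h2, h3⟩ := isCycle_iff.1 hl
  have key : ∀ a ∈ l, ∀ b ∈ l, G.Adj a b → Thin G T a → Follows l a b ∨ Follows l b a := by
    intro a ha b hb hab hth
    obtain ⟨p, hp⟩ := exists_follows' ha
    obtain ⟨q, hq⟩ := exists_follows ha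
    rcases hth.eq_or_eq (follows_ne h2 h1 hp hq) (hT p hp.mem.1) (hT q hq.mem.2) (hT b hb)
      (h3 _ _ hp).symm (h3 _ _ hq) hab with rfl | rfl
    · exact Or.inr hp
    · exact Or.inl hq
  rcases h a ha with hta | ha'
  · exact key a ha b hb hab hta
  rcases h b hb with htb | hb'
  · exact (key b hb a ha hab.symm htb).symm
  rcases ha' with ha' | ha' <;> rcases hb' with hb' | hb'
  · rw [ha'] at hb'
    exact absurd (Option.some_inj.1 hb') hab.ne
  · exact Or.inr (follows_last_head hb' ha')
  · exact Or.inl (follows_last_head ha' hb')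
  · rw [ha'] at hb'
    exact absurd (Option.some_inj.1 hb') hab.ne

/-- The two cycle neighbors of a thin vertex are all its neighbors in `T`. -/
theorem IsChordlessCycle.mem_of_thin [Finite V] {T : Set V} {z : List V}
    (hz : IsChordlessCycle G z) (hT : ∀ v ∈ z, v ∈ T) {v t : V} (hv : v ∈ z) (hth : Thin G T v)
    (ht : t ∈ T) (hvt : G.Adj v t) : t ∈ z := by
  obtain ⟨p, q, hp, hq, hpq, hvp, hvq, -⟩ := hz.around hv
  rcases hth.eq_or_eq hpq (hT p hp) (hT q hq) ht hvp hvq hvt with rfl | rfl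
  · exact hp
  · exact hq

/-- A chordless cycle that meets a path of vertices with at most two neighbors contains the path,
together with the ends of its surroundings. -/
theorem IsChordlessCycle.covers [Finite V] {T : Set V} {z : List V}
    (hz : IsChordlessCycle G z) (hT : ∀ v ∈ z, v ∈ T) {a b : V} {P : List V}
    (hc : (a :: P ++ [b]).IsChain G.Adj) (hP : ∀ v ∈ a :: P ++ [b], v ∈ T)
    (hth : ∀ v ∈ P, Thin G T v) {v : V} (hv : v ∈ P) (hvz : v ∈ z) :
    ∀ w ∈ a :: P ++ [b], w ∈ z := by
  -- The cycle is followed from `v` to one end of the path; the other end is treated by reversing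
  -- the list.
  have fwd : ∀ (P : List V) (v b : V), (v :: P ++ [b]).IsChain G.Adj →
      (∀ w ∈ v :: P, Thin G T w) → (∀ w ∈ v :: P ++ [b], w ∈ T) → v ∈ z →
      ∀ w ∈ v :: P ++ [b], w ∈ z := by
    intro P
    induction P with
    | nil =>
      intro v b hc hth hP hv w hw
      simp at hc hth hP hw
      rcases hw with rfl | rfl
      · exact hv
      · exact hz.mem_of_thin hT hv hth hP.2 hc
    | cons u P ih =>
      intro v b hc hth hP hv w hw
      simp only [List.cons_append, List.isChain_cons_cons] at hc
      rcases List.mem_cons.1 hw with rfl | hw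
      · exact hv
      · refine ih u b hc.2 (fun w hw => hth w (by simp at hw ⊢; tauto))
          (fun w hw => hP w (by simp at hw ⊢; tauto)) ?_ w hw
        exact hz.mem_of_thin hT hv (hth v (by simp)) (hP u (by simp)) hc.1
  obtain ⟨P₁, P₂, rfl⟩ := List.append_of_mem hv
  intro w hw
  have h1 := fwd P₂ v b
    (by
      rw [show a :: (P₁ ++ v :: P₂) ++ [b] = (a :: P₁) ++ (v :: P₂ ++ [b]) by simp] at hc
      exact hc.right_of_append)
    (fun w hw => hth w (by simp at hw ⊢; tauto)) (fun w hw => hP w (by simp at hw ⊢; tauto)) hvz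
  have h2 := fwd P₁.reverse v a
    (by
      rw [show v :: P₁.reverse ++ [a] = (a :: P₁ ++ [v]).reverse by simp, List.isChain_reverse]
      rw [show a :: (P₁ ++ v :: P₂) ++ [b] = (a :: P₁ ++ [v]) ++ (P₂ ++ [b]) by simp] at hc
      exact hc.left_of_append.imp fun _ _ h => h.symm)
    (fun w hw => hth w (by simp at hw ⊢; tauto)) (fun w hw => hP w (by simp at hw ⊢; tauto)) hvz
  simp only [List.cons_append, List.mem_cons, List.mem_append, List.not_mem_nil, or_false] at hw
  rcases hw with rfl | (hw | rfl | hw) | rfl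
  · exact h2 _ (by simp)
  · exact h2 _ (by simp [hw])
  · exact hvz
  · exact h1 _ (by simp [hw])
  · exact h1 _ (by simp)

/-! ### The working copy as a model of the remaining graph -/

/-- The relation is the graph of a bijection. This form suits "vertex `t` belongs to the key of node
`q`", where no function is at hand. -/
theorem ncard_eq_of_relation {α β : Type*} {s : Set α} {t : Set β} (R : α → β → Prop)
    (h1 : ∀ a ∈ s, ∃ b ∈ t, R a b) (h2 : ∀ b ∈ t, ∃ a ∈ s, R a b)
    (u1 : ∀ a ∈ s, ∀ b ∈ t, ∀ b' ∈ t, R a b → R a b' → b = b')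
    (u2 : ∀ b ∈ t, ∀ a ∈ s, ∀ a' ∈ s, R a b → R a' b → a = a') : s.ncard = t.ncard := by
  choose f hf hR using h1
  refine Set.ncard_congr f hf ?_ ?_
  · intro a a' ha ha' h
    exact u2 _ (hf a ha) a ha a' ha' (hR a ha) (h ▸ hR a' ha')
  · intro b hb
    obtain ⟨a, ha, hab⟩ := h2 b hb
    exact ⟨a, ha, u1 a ha _ (hf a ha) b hb (hR a ha) hab⟩

/-- The neighbors of a vertex of a path of thin vertices. -/
theorem neighbor_of_segment [Finite V] {T : Set V} {x y t v : V} {P : List V}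
    (hc : (x :: P ++ [y]).IsChain G.Adj) (hnd : P.Nodup) (hx : x ∉ P) (hy : y ∉ P)
    (hxy : x ≠ y ∨ 2 ≤ P.length) (hT : ∀ w ∈ x :: P ++ [y], w ∈ T) (ht : t ∈ P)
    (hth : Thin G T t) (hv : v ∈ T) (htv : G.Adj t v) :
    v ∈ P ∨ (v = x ∧ P.head? = some t) ∨ (v = y ∧ P.getLast? = some t) := by
  obtain ⟨P₁, P₂, rfl⟩ := List.append_of_mem ht
  obtain ⟨p, hp, hpt, hp'⟩ : ∃ p, p ∈ x :: P₁ ∧ G.Adj p t ∧ (p ∈ P₁ ∨ (p = x ∧ P₁ = [])) := by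
    rcases List.eq_nil_or_concat' P₁ with rfl | ⟨Q, p, rfl⟩
    · exact ⟨x, by simp, by simpa using hc.rel_head? (y := t) (by simp), Or.inr ⟨rfl, rfl⟩⟩
    · refine ⟨p, by simp, ?_, Or.inl (by simp)⟩
      rw [show x :: (Q ++ [p] ++ t :: P₂) ++ [y] = (x :: Q) ++ p :: t :: (P₂ ++ [y]) by simp] at hc
      exact (List.isChain_cons_cons.1 hc.right_of_append).1
  obtain ⟨q, hq, htq, hq'⟩ : ∃ q, q ∈ P₂ ++ [y] ∧ G.Adj t q ∧ (q ∈ P₂ ∨ (q = y ∧ P₂ = [])) := by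
    rw [show x :: (P₁ ++ t :: P₂) ++ [y] = (x :: P₁) ++ t :: (P₂ ++ [y]) by simp] at hc
    have hc := hc.right_of_append
    cases P₂ with
    | nil => exact ⟨y, by simp, by simpa using hc, Or.inr ⟨rfl, rfl⟩⟩
    | cons q Q => exact ⟨q, by simp, (List.isChain_cons_cons.1 hc).1, Or.inl (by simp)⟩
  -- Predecessor and successor could coincide only if a path of one vertex had equal ends, which
  -- `hxy` excludes.
  have hpq : p ≠ q := by
    rintro rfl
    rw [List.nodup_append] at hnd
    rcases hp' with h | ⟨rfl, rfl⟩ <;> rcases hq' with h' | ⟨rfl, rfl⟩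
    · exact hnd.2.2 p h p (by simp [h']) rfl
    · exact hy (by simp [h])
    · exact hx (by simp [h'])
    · simp at hxy
  have hpT : p ∈ T := hT p (by simp at hp ⊢; tauto)
  have hqT : q ∈ T := hT q (by simp at hq ⊢; tauto)
  rcases hth.eq_or_eq hpq hpT hqT hv hpt.symm htq htv with rfl | rfl
  · rcases hp' with h | ⟨rfl, rfl⟩
    · exact Or.inl (by simp [h])
    · exact Or.inr (Or.inl ⟨rfl, by simp⟩)
  · rcases hq' with h | ⟨rfl, rfl⟩
    · exact Or.inl (by simp [h])
    · exact Or.inr (Or.inr ⟨rfl, by simp⟩)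

/-- The active nodes `A` of the working copy `s` represent the subgraph of `G` induced on `T`:
each vertex of `T` belongs to the key of one active node, and a created node stands for a path of
vertices of degree two between two nonadjacent vertices. -/
structure Model (G : SimpleGraph V) (T : Set V) (A : Set (Node V)) (s : Work V) : Prop where
  mem_iff : ∀ v, v ∈ T ↔ ∃ p ∈ A, v ∈ s.key p
  disj : ∀ p ∈ A, ∀ q ∈ A, ∀ v, v ∈ s.key p → v ∈ s.key q → p = q
  symm : ∀ p q, s.adj p q → s.adj q p
  keyInl : ∀ a, s.key (Sum.inl a) = [a]
  adjInl : ∀ a b, Sum.inl a ∈ A → Sum.inl b ∈ A →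
    (s.adj (Sum.inl a) (Sum.inl b) ↔ G.Adj a b)
  path : ∀ k, Sum.inr k ∈ A → ∃ a b, Sum.inl a ∈ A ∧ Sum.inl b ∈ A ∧ a ≠ b ∧ ¬ G.Adj a b ∧
    s.start (Sum.inr k) = Sum.inl a ∧
    (∀ q ∈ A, s.adj (Sum.inr k) q ↔ q = Sum.inl a ∨ q = Sum.inl b) ∧
    s.key (Sum.inr k) ≠ [] ∧ (s.key (Sum.inr k)).Nodup ∧
    (a :: s.key (Sum.inr k) ++ [b]).IsChain G.Adj ∧ ∀ v ∈ s.key (Sum.inr k), Thin G T v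

namespace Model

variable {T : Set V} {A : Set (Node V)} {s : Work V}

theorem inl_mem (hM : Model G T A s) {a : V} (ha : Sum.inl a ∈ A) : a ∈ T :=
  (hM.mem_iff a).2 ⟨_, ha, by simp [hM.keyInl]⟩

theorem key_subset (hM : Model G T A s) {p : Node V} (hp : p ∈ A) {v : V} (hv : v ∈ s.key p) :
    v ∈ T := (hM.mem_iff v).2 ⟨p, hp, hv⟩

theorem exists_mem_key (hM : Model G T A s) {p : Node V} (hp : p ∈ A) : ∃ v, v ∈ s.key p := by
  rcases p with a | k
  · exact ⟨a, by simp [hM.keyInl]⟩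
  · obtain ⟨a, b, -, -, -, -, -, -, hne, -⟩ := hM.path k hp
    exact List.exists_mem_of_ne_nil _ hne

theorem key_nodup (hM : Model G T A s) {p : Node V} (hp : p ∈ A) : (s.key p).Nodup := by
  rcases p with a | k
  · simp [hM.keyInl]
  · obtain ⟨a, b, -, -, -, -, -, -, -, h, -⟩ := hM.path k hp
    exact h

theorem end_notMem (hM : Model G T A s) {a : V} {k : ℕ} (ha : Sum.inl a ∈ A)
    (hk : Sum.inr k ∈ A) : a ∉ s.key (Sum.inr k) := by
  intro h
  have := hM.disj _ ha _ hk a (by simp [hM.keyInl]) h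
  simp at this

theorem path_subset (hM : Model G T A s) {a b : V} {k : ℕ} (ha : Sum.inl a ∈ A)
    (hb : Sum.inl b ∈ A) (hk : Sum.inr k ∈ A) : ∀ w ∈ a :: s.key (Sum.inr k) ++ [b], w ∈ T := by
  intro w hw
  simp only [List.cons_append, List.mem_cons, List.mem_append, List.not_mem_nil, or_false] at hw
  rcases hw with rfl | hw | rfl
  · exact hM.inl_mem ha
  · exact hM.key_subset hk hw
  · exact hM.inl_mem hb

theorem adj_of_inr [Finite V] (hM : Model G T A s) {k : ℕ} {q : Node V} (hk : Sum.inr k ∈ A)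
    (hq : q ∈ A) {v t : V} (hv : v ∈ s.key (Sum.inr k)) (ht : t ∈ s.key q) (hvt : G.Adj v t) :
    Sum.inr k = q ∨ s.adj (Sum.inr k) q := by
  obtain ⟨a, b, ha, hb, hab, -, -, hadj, -, hnd, hc, hth⟩ := hM.path k hk
  rcases neighbor_of_segment hc hnd (hM.end_notMem ha hk) (hM.end_notMem hb hk) (Or.inl hab)
    (hM.path_subset ha hb hk) hv (hth v hv) (hM.key_subset hq ht) hvt with h | ⟨rfl, -⟩ | ⟨rfl, -⟩
  · exact Or.inl (hM.disj _ hk _ hq t h ht)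
  · have := hM.disj _ hq _ ha t ht (by simp [hM.keyInl])
    exact Or.inr ((hadj q hq).2 (Or.inl this))
  · have := hM.disj _ hq _ hb t ht (by simp [hM.keyInl])
    exact Or.inr ((hadj q hq).2 (Or.inr this))

/-- Edges of the remaining graph join vertices of the same node or of adjacent nodes. -/
theorem adj_of_adj [Finite V] (hM : Model G T A s) {p q : Node V} (hp : p ∈ A) (hq : q ∈ A)
    {v t : V} (hv : v ∈ s.key p) (ht : t ∈ s.key q) (hvt : G.Adj v t) : p = q ∨ s.adj p q := by
  rcases p with a | k
  · rcases q with b | k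
    · simp only [hM.keyInl, List.mem_singleton] at hv ht
      subst hv ht
      exact Or.inr ((hM.adjInl _ _ hp hq).2 hvt)
    · rcases hM.adj_of_inr hq hp ht hv hvt.symm with h | h
      · exact Or.inl h.symm
      · exact Or.inr (hM.symm _ _ h)
  · exact hM.adj_of_inr hp hq hv ht hvt

theorem ne_of_adj (hM : Model G T A s) {p q : Node V} (hp : p ∈ A) (hq : q ∈ A)
    (h : s.adj p q) : p ≠ q := by
  rintro rfl
  rcases p with a | k
  · exact G.irrefl ((hM.adjInl _ _ hp hp).1 h)
  · obtain ⟨a, b, -, -, -, -, -, hadj, -⟩ := hM.path k hp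
    rcases (hadj _ hp).1 h with h | h <;> simp at h

/-- Each adjacent node contributes exactly one vertex: the ends of a created node are distinct, so
`a` touches its path on one side only. -/
theorem ncard_neighbors [Finite V] (hM : Model G T A s) {a : V} (ha : Sum.inl a ∈ A) :
    (G.neighborSet a ∩ T).ncard = {q | q ∈ A ∧ s.adj (Sum.inl a) q}.ncard := by
  have haK : a ∈ s.key (Sum.inl a) := by simp [hM.keyInl]
  refine ncard_eq_of_relation (fun t q => t ∈ s.key q) ?_ ?_ ?_ ?_
  · rintro t ⟨hat, htT⟩
    obtain ⟨q, hq, htq⟩ := (hM.mem_iff t).1 htT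
    refine ⟨q, ⟨hq, ?_⟩, htq⟩
    rcases hM.adj_of_adj ha hq haK htq hat with rfl | h
    · simp only [hM.keyInl, List.mem_singleton] at htq
      subst htq
      exact absurd hat G.irrefl
    · exact h
  · rintro q ⟨hq, hadj⟩
    rcases q with b | k
    · exact ⟨b, ⟨(hM.adjInl _ _ ha hq).1 hadj, hM.inl_mem hq⟩, by simp [hM.keyInl]⟩
    · obtain ⟨x, y, hx, hy, hxy, -, -, h, hne, -, hc, -⟩ := hM.path k hq
      rcases (h _ ha).1 (hM.symm _ _ hadj) with e | e
      · obtain rfl : a = x := Sum.inl_injective e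
        obtain ⟨t, P, hP⟩ := List.exists_cons_of_ne_nil hne
        rw [hP] at hc
        have ht : t ∈ s.key (Sum.inr k) := by simp [hP]
        exact ⟨t, ⟨(List.isChain_cons_cons.1 hc).1, hM.key_subset hq ht⟩, ht⟩
      · obtain rfl : a = y := Sum.inl_injective e
        obtain ⟨P, t, hP⟩ := (List.eq_nil_or_concat' _).resolve_left hne
        rw [hP, show x :: (P ++ [t]) ++ [a] = (x :: P) ++ [t, a] by simp] at hc
        have ht : t ∈ s.key (Sum.inr k) := by simp [hP]
        exact ⟨t, ⟨(List.isChain_cons_cons.1 hc.right_of_append).1.symm, hM.key_subset hq ht⟩, ht⟩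
  · rintro t - q hq q' hq' h h'
    exact hM.disj q hq.1 q' hq'.1 t h h'
  · rintro q ⟨hq, -⟩ t ⟨hat, -⟩ t' ⟨hat', -⟩ ht ht'
    rcases q with b | k
    · simp only [hM.keyInl, List.mem_singleton] at ht ht'
      rw [ht, ht']
    · obtain ⟨x, y, hx, hy, hxy, -, -, -, -, hnd, hc, hth⟩ := hM.path k hq
      have key : ∀ t ∈ s.key (Sum.inr k), G.Adj a t →
          (a = x ∧ (s.key (Sum.inr k)).head? = some t) ∨
          (a = y ∧ (s.key (Sum.inr k)).getLast? = some t) := by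
        intro t ht hat
        exact (neighbor_of_segment hc hnd (hM.end_notMem hx hq) (hM.end_notMem hy hq)
          (Or.inl hxy) (hM.path_subset hx hy hq) ht (hth t ht) (hM.inl_mem ha)
          hat.symm).resolve_left (hM.end_notMem ha hq)
      rcases key t ht hat with ⟨rfl, h⟩ | ⟨rfl, h⟩ <;> rcases key t' ht' hat' with ⟨h1, h'⟩ | ⟨h1, h'⟩
      · exact Option.some_inj.1 (h.symm.trans h')
      · exact absurd h1 hxy
      · exact absurd h1.symm hxy
      · exact Option.some_inj.1 (h.symm.trans h')

theorem mem_keyTowards {p q : Node V} {v : V} : v ∈ s.keyTowards p q ↔ v ∈ s.key p := by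
  unfold Work.keyTowards
  split <;> simp

theorem keyTowards_inl (hM : Model G T A s) (a : V) (q : Node V) :
    s.keyTowards (Sum.inl a) q = [a] := by
  unfold Work.keyTowards
  split <;> simp [hM.keyInl]

theorem keyTowards_ne_nil (hM : Model G T A s) {p : Node V} (hp : p ∈ A) (q : Node V) :
    s.keyTowards p q ≠ [] := by
  obtain ⟨v, hv⟩ := hM.exists_mem_key hp
  exact List.ne_nil_of_mem (mem_keyTowards.2 hv)

/-- The keys met on a walk through the working copy fit together. -/
theorem isChain_keyTowards (hM : Model G T A s) {p q r : Node V} (hp : p ∈ A) (hq : q ∈ A)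
    (hr : r ∈ A) (hpq : s.adj p q) (hqr : s.adj q r) (hpr : p ≠ r) :
    (s.keyTowards p q ++ s.keyTowards q r).IsChain G.Adj := by
  have rev : ∀ {l : List V}, l.IsChain G.Adj → l.reverse.IsChain G.Adj := fun h => by
    rw [List.isChain_reverse]; exact h.imp fun _ _ h => h.symm
  rcases q with v | k
  · rw [hM.keyTowards_inl v]
    rcases p with a | k
    · rw [hM.keyTowards_inl a]
      simpa using (hM.adjInl _ _ hp hq).1 hpq
    · obtain ⟨x, y, hx, hy, hxy, -, hst, h, -, -, hc, -⟩ := hM.path k hp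
      rcases (h _ hq).1 hpq with e | e
      · obtain rfl : v = x := Sum.inl_injective e
        rw [Work.keyTowards, if_pos hst.symm]
        simpa using rev hc.left_of_append
      · obtain rfl : v = y := Sum.inl_injective e
        rw [Work.keyTowards, if_neg (by rw [hst]; simpa using hxy.symm)]
        exact hc.tail
  · obtain ⟨x, y, hx, hy, hxy, -, hst, h, -, -, hc, -⟩ := hM.path k hq
    -- Because `p ≠ r`, the path of the created node is entered at one end and left at the other.
    rcases (h _ hp).1 (hM.symm _ _ hpq) with rfl | rfl <;> rcases (h _ hr).1 hqr with rfl | rfl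
    · exact absurd rfl hpr
    · rw [hM.keyTowards_inl, Work.keyTowards, if_neg (by rw [hst]; simpa using hxy.symm)]
      exact hc.left_of_append
    · rw [hM.keyTowards_inl, Work.keyTowards, if_pos hst.symm]
      simpa using rev hc.tail
    · exact absurd rfl hpr

end Model

/-- The nodes of the working copy. -/
def Valid (S : Set V) (s : Work V) (q : Node V) : Prop :=
  (∃ a ∈ S, q = Sum.inl a) ∨ ∃ k < s.created, q = Sum.inr k

/-- The invariant at the head of the loop over the queue. -/
structure OuterInv (G : SimpleGraph V) (S T : Set V) (A : Set (Node V)) (s : Work V) : Prop where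
  model : Model G T A s
  degInl : ∀ a, Sum.inl a ∈ A → s.degree (Sum.inl a) = (G.neighborSet a ∩ T).ncard
  degInr : ∀ k, Sum.inr k ∈ A → s.degree (Sum.inr k) = 2
  valid : ∀ p ∈ A, Valid S s p
  -- Restricted to existing nodes, because `Work.init` also colors the indices of nodes not yet
  -- created.
  white : ∀ p, Valid S s p → (s.color p = Color.white ↔ p ∈ A)
  adjValid : ∀ p q, s.adj p q → Valid S s q
  -- Entries that are no longer active may remain in the queue, hence the implication.
  queue : ∀ p ∈ s.queue, ∃ a ∈ S, p = Sum.inl a ∧ (p ∈ A → s.degree p = 2)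
  mem_queue : ∀ a, Sum.inl a ∈ A → s.degree (Sum.inl a) = 2 → Sum.inl a ∈ s.queue
  subset : T ⊆ S
  twoConnected : T = ∅ ∨ (TwoConnectedOn G T ∧ 3 ≤ T.ncard)

namespace OuterInv

variable {S T : Set V} {A : Set (Node V)} {s : Work V}

theorem twoConnected_of_mem (h : OuterInv G S T A s) {p : Node V} (hp : p ∈ A) :
    TwoConnectedOn G T ∧ 3 ≤ T.ncard := by
  refine h.twoConnected.resolve_left ?_
  rintro rfl
  obtain ⟨v, hv⟩ := h.model.exists_mem_key hp
  exact h.model.key_subset hp hv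

theorem two_neighbors [Finite V] (h : OuterInv G S T A s) {p : Node V} (hp : p ∈ A)
    (hd : s.degree p = 2) : ∃ q ∈ A, ∃ r ∈ A, q ≠ r ∧ s.adj p q ∧ s.adj p r ∧
      ∀ t ∈ A, s.adj p t → t = q ∨ t = r := by
  rcases p with a | k
  · rw [h.degInl a hp, h.model.ncard_neighbors hp, Set.ncard_eq_two] at hd
    obtain ⟨q, r, hqr, he⟩ := hd
    have hq : q ∈ {q | q ∈ A ∧ s.adj (Sum.inl a) q} := he ▸ (by simp)
    have hr : r ∈ {q | q ∈ A ∧ s.adj (Sum.inl a) q} := he ▸ (by simp)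
    refine ⟨q, hq.1, r, hr.1, hqr, hq.2, hr.2, fun t ht hat => ?_⟩
    have : t ∈ {q | q ∈ A ∧ s.adj (Sum.inl a) q} := ⟨ht, hat⟩
    rw [he] at this
    exact this
  · obtain ⟨a, b, ha, hb, hab, -, -, hadj, -⟩ := h.model.path k hp
    exact ⟨_, ha, _, hb, by simpa using hab, (hadj _ ha).2 (Or.inl rfl),
      (hadj _ hb).2 (Or.inr rfl), fun t ht hat => (hadj t ht).1 hat⟩

/-- Of two distinct neighbors of a node of degree two and a third one, two are equal. -/
theorem eq_or_eq_of_degree [Finite V] (h : OuterInv G S T A s) {p q r t : Node V} (hp : p ∈ A)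
    (hd : s.degree p = 2) (hq : q ∈ A) (hr : r ∈ A) (ht : t ∈ A) (hpq : s.adj p q)
    (hpr : s.adj p r) (hpt : s.adj p t) (hqr : q ≠ r) : t = q ∨ t = r := by
  obtain ⟨q', -, r', -, -, -, -, hall⟩ := h.two_neighbors hp hd
  have := hall q hq hpq
  have := hall r hr hpr
  have := hall t ht hpt
  grind

theorem exists_other_neighbor [Finite V] (h : OuterInv G S T A s) {p q : Node V} (hp : p ∈ A)
    (hd : s.degree p = 2) : ∃ r ∈ A, s.adj p r ∧ r ≠ q := by
  obtain ⟨q', hq', r', hr', hne, h1, h2, -⟩ := h.two_neighbors hp hd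
  by_cases e : q' = q
  · exact ⟨r', hr', h2, fun e' => hne (e.trans e'.symm)⟩
  · exact ⟨q', hq', h1, e⟩

theorem thin [Finite V] (h : OuterInv G S T A s) {p : Node V} (hp : p ∈ A)
    (hd : s.degree p = 2) {v : V} (hv : v ∈ s.key p) : Thin G T v := by
  rcases p with a | k
  · simp only [h.model.keyInl, List.mem_singleton] at hv
    subst hv
    rw [h.degInl _ hp] at hd
    exact hd.le
  · obtain ⟨a, b, -, -, -, -, -, -, -, -, -, hth⟩ := h.model.path k hp
    exact hth v hv

/-- Two-connectedness gives at least two neighbors, so a degree other than two is at least three;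
created nodes always have degree two. -/
theorem exists_third_neighbor [Finite V] (h : OuterInv G S T A s) {p : Node V} (hp : p ∈ A)
    (hd : s.degree p ≠ 2) (q r : Node V) : ∃ t ∈ A, s.adj p t ∧ t ≠ q ∧ t ≠ r := by
  rcases p with a | k
  swap
  · exact absurd (h.degInr k hp) hd
  obtain ⟨h2, h3⟩ := h.twoConnected_of_mem hp
  have haT := h.model.inl_mem hp
  obtain ⟨u, hu, v, hv, huv, hau, hav⟩ := h2.exists_two_neighbors h3 haT
  have hsub : {u, v} ⊆ G.neighborSet a ∩ T := by
    rintro w (rfl | rfl)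
    · exact ⟨hau, hu⟩
    · exact ⟨hav, hv⟩
  have h4 := Set.ncard_le_ncard hsub (Set.toFinite _)
  rw [Set.ncard_pair huv, ← h.degInl a hp] at h4
  have h5 : 2 < s.degree (Sum.inl a) := lt_of_le_of_ne h4 (Ne.symm hd)
  rw [h.degInl a hp, h.model.ncard_neighbors hp] at h5
  by_contra! hc
  have hsub : {q | q ∈ A ∧ s.adj (Sum.inl a) q} ⊆ {q, r} := by
    rintro t ⟨ht, hat⟩
    by_cases e : t = q
    · exact Or.inl e
    · exact Or.inr (hc t ht hat e)
  have h6 := Set.ncard_le_ncard hsub (Set.toFinite _)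
  have h7 := Set.ncard_insert_le q {r}
  rw [Set.ncard_singleton] at h7
  omega

/-- While vertices remain, some original vertex has degree two. -/
theorem exists_mem_queue [Finite V] (hG : CyclicallyOrientable G) (h : OuterInv G S T A s)
    (hT : T ≠ ∅) : s.queue ≠ [] := by
  obtain ⟨h2, h3⟩ := h.twoConnected.resolve_left hT
  obtain ⟨z, x, y, hz, hzT, hx, hy, hxy, hear⟩ := exists_ear hG h2 h3
  have key : ∀ v ∈ z, v ≠ x → v ≠ y → Sum.inl v ∈ A → Sum.inl v ∈ s.queue := by
    intro v hv hvx hvy hA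
    refine h.mem_queue v hA ?_
    rw [h.degInl v hA]
    obtain ⟨p, q, hp, hq, hpq, hvp, hvq, hnb, -⟩ := hz.around hv
    rw [Set.ncard_eq_two]
    refine ⟨p, q, hpq, Set.Subset.antisymm ?_ ?_⟩
    · rintro t ⟨hvt, ht⟩
      exact hnb t (hear v hv hvx hvy t ht hvt) hvt
    · rintro t (rfl | rfl)
      · exact ⟨hvp, hzT _ hp⟩
      · exact ⟨hvq, hzT _ hq⟩
  obtain ⟨v, hv, hvx, hvy⟩ : ∃ v ∈ z, v ≠ x ∧ v ≠ y := by
    obtain ⟨p, q, hp, hq, hpq, hxp, hxq, -⟩ := hz.around hx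
    by_cases e : p = y
    · exact ⟨q, hq, hxq.ne', by rintro rfl; exact hpq e⟩
    · exact ⟨p, hp, hxp.ne', e⟩
  obtain ⟨p, hp, hvp⟩ := (h.model.mem_iff v).1 (hzT v hv)
  rcases p with a | k
  · simp only [h.model.keyInl, List.mem_singleton] at hvp
    subst hvp
    exact List.ne_nil_of_mem (key _ hv hvx hvy hp)
  -- The inner vertex `v` is hidden in a created node. The ear then contains the whole path with its
  -- ends `a` and `b`; these are not adjacent while `x` and `y` are, so one of them is itself an
  -- inner vertex.
  · obtain ⟨a, b, ha, hb, hab, hnadj, -, -, -, -, hc, hth⟩ := h.model.path k hp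
    have hcov := hz.covers hzT hc (h.model.path_subset ha hb hp) hth hvp hv
    have haz : a ∈ z := hcov a (by simp)
    have hbz : b ∈ z := hcov b (by simp)
    by_cases h1 : a = x ∨ a = y
    · refine List.ne_nil_of_mem (key b hbz ?_ ?_ hb)
      · rintro rfl
        rcases h1 with rfl | rfl
        · exact hab rfl
        · exact hnadj hxy.symm
      · rintro rfl
        rcases h1 with rfl | rfl
        · exact hnadj hxy
        · exact hab rfl
    · rw [not_or] at h1
      exact List.ne_nil_of_mem (key a haz h1.1 h1.2 ha)

end OuterInv

/-! ### The two walks -/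

/-- The state `s` arises from `s₀` by painting the nodes in `N` gray and removing them, and perhaps
`u`, from the queue. -/
structure Painted (s₀ s : Work V) (u : Node V) (N : Set (Node V)) : Prop where
  adj : s.adj = s₀.adj
  degree : s.degree = s₀.degree
  key : s.key = s₀.key
  start : s.start = s₀.start
  created : s.created = s₀.created
  color : ∀ p, s.color p = Color.white ↔ s₀.color p = Color.white ∧ p ∉ N
  queue : ∀ p ∈ s.queue, p ∈ s₀.queue
  mem_queue : ∀ p ∈ s₀.queue, p ∉ N → p ≠ u → p ∈ s.queue

theorem Painted.keyTowards {s₀ s : Work V} {u : Node V} {N : Set (Node V)}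
    (h : Painted s₀ s u N) (p q : Node V) : s.keyTowards p q = s₀.keyTowards p q := by
  simp [Work.keyTowards, h.key, h.start]

theorem Painted.remove {s₀ s : Work V} {u : Node V} {N : Set (Node V)}
    (h : Painted s₀ s u N) (x : Node V) : Painted s₀ (s.remove x) u (insert x N) where
  adj := h.adj
  degree := h.degree
  key := h.key
  start := h.start
  created := h.created
  color p := by
    by_cases hp : p = x
    · subst hp; simp [Work.remove, Work.paint]
    · simp [Work.remove, Work.paint, h.color, hp]
  queue p hp := by
    simp only [Work.remove, List.mem_filter] at hp
    exact h.queue p hp.1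
  mem_queue p hp hN hu := by
    simp only [Set.mem_insert_iff, not_or] at hN
    simp only [Work.remove, List.mem_filter]
    exact ⟨h.mem_queue p hp hN.2 hu, by simpa using hN.1⟩

/-- The nodes in `N` have been painted in the present round, and `P` consists of their keys. -/
structure Walk (A : Set (Node V)) (s₀ s : Work V) (u : Node V) (N : Set (Node V)) (P : List V) :
    Prop where
  painted : Painted s₀ s u N
  subset : N ⊆ A
  degree : ∀ n ∈ N, s₀.degree n = 2
  nodup : P.Nodup
  mem_iff : ∀ v, v ∈ P ↔ ∃ n ∈ N, v ∈ s₀.key n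

namespace Walk

variable {S T : Set V} {A : Set (Node V)} {s₀ s : Work V} {u : Node V} {N : Set (Node V)}
  {P : List V}

/-- Shared by both walks: the permutation covers extension at either end of `P` and either reading
direction of the key. -/
theorem paint (hw : Walk A s₀ s u N P) (hI : OuterInv G S T A s₀) {x : Node V} (hx : x ∈ A)
    (hxN : x ∉ N) (hd : s₀.degree x = 2) {P' : List V} (hP : P'.Perm (s₀.key x ++ P)) :
    Walk A s₀ (s.remove x) u (insert x N) P' where
  painted := hw.painted.remove x
  subset := Set.insert_subset hx hw.subset
  degree := by
    rintro n (rfl | hn)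
    · exact hd
    · exact hw.degree n hn
  nodup := by
    rw [hP.nodup_iff, List.nodup_append]
    refine ⟨hI.model.key_nodup hx, hw.nodup, ?_⟩
    rintro v hv _ hv' rfl
    obtain ⟨n, hn, hvn⟩ := (hw.mem_iff v).1 hv'
    exact hxN (hI.model.disj x hx n (hw.subset hn) v hv hvn ▸ hn)
  mem_iff v := by
    rw [hP.mem_iff, List.mem_append, hw.mem_iff]
    simp

/-- Reduces the test to the state at the start of the round, where the invariant is available. -/
theorem canMove_iff (hw : Walk A s₀ s u N P) (hI : OuterInv G S T A s₀) {prev x a : Node V} :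
    s.CanMove prev x a ↔
      s₀.degree x = 2 ∧ s₀.adj x a ∧ a ∈ A ∧ a ∉ N ∧ a ≠ prev := by
  unfold Work.CanMove
  rw [hw.painted.degree, hw.painted.adj, hw.painted.color]
  constructor
  · rintro ⟨h1, h2, ⟨h3, h4⟩, h5⟩
    exact ⟨h1, h2, (hI.white a (hI.adjValid _ _ h2)).1 h3, h4, h5⟩
  · rintro ⟨h1, h2, h3, h4, h5⟩
    exact ⟨h1, h2, ⟨(hI.white a (hI.valid a h3)).2 h3, h4⟩, h5⟩

theorem mem_T (hw : Walk A s₀ s u N P) (hI : OuterInv G S T A s₀) {v : V} (hv : v ∈ P) :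
    v ∈ T := by
  obtain ⟨n, hn, hvn⟩ := (hw.mem_iff v).1 hv
  exact hI.model.key_subset (hw.subset hn) hvn

theorem thin [Finite V] (hw : Walk A s₀ s u N P) (hI : OuterInv G S T A s₀) {v : V}
    (hv : v ∈ P) : Thin G T v := by
  obtain ⟨n, hn, hvn⟩ := (hw.mem_iff v).1 hv
  exact hI.thin (hw.subset hn) (hw.degree n hn) hvn

theorem notMem (hw : Walk A s₀ s u N P) (hI : OuterInv G S T A s₀) {p : Node V} (hp : p ∈ A)
    (hpN : p ∉ N) {v : V} (hv : v ∈ s₀.key p) : v ∉ P := by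
  intro h
  obtain ⟨n, hn, hvn⟩ := (hw.mem_iff v).1 h
  exact hpN (hI.model.disj p hp n (hw.subset hn) v hv hvn ▸ hn)

theorem length_le [Fintype V] (hw : Walk A s₀ s u N P) : P.length ≤ Fintype.card V :=
  hw.nodup.length_le_card

end Walk

/-- The invariant of the first walk. -/
structure WalkX (G : SimpleGraph V) (A : Set (Node V)) (s₀ s : Work V) (u₀ : V)
    (first : Node V) (N : Set (Node V)) (P : List V) (prev x : Node V) : Prop where
  walk : Walk A s₀ s (Sum.inl u₀) N P
  u_mem : Sum.inl u₀ ∈ A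
  u_notMem : Sum.inl u₀ ∉ N
  u_degree : s₀.degree (Sum.inl u₀) = 2
  x_mem : x ∈ A
  x_notMem : x ∉ N
  prev_mem : prev ∈ A
  prev_adj : s₀.adj prev x
  first_mem : first ∈ A
  first_adj : s₀.adj (Sum.inl u₀) first
  -- When the walk is back at its start, the last clause shows that both neighbors of the start are
  -- painted and distinct.
  cases : (N = ∅ ∧ P = [] ∧ prev = Sum.inl u₀ ∧ x = first ∧ x ≠ Sum.inl u₀) ∨
    (first ∈ N ∧ prev ∈ N ∧ (x = Sum.inl u₀ → prev ≠ first))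
  -- Each exit is recorded with the node it leads from; this later identifies the one neighbor that
  -- an end of the ear loses.
  closed : ∀ n ∈ N, ∀ q ∈ A, s₀.adj n q →
    q ∈ N ∨ (q = x ∧ n = prev) ∨ (q = Sum.inl u₀ ∧ n = first)
  -- Quantified over the next node, since the reading direction of a created node's key depends on
  -- where the walk continues.
  chain : ∀ r ∈ A, s₀.adj x r → r ≠ prev →
    ((s₀.keyTowards x r).reverse ++ (P ++ [u₀])).IsChain G.Adj

/-- The first walk went around a cycle. -/
structure Loop (G : SimpleGraph V) (A : Set (Node V)) (s₀ s : Work V) (u₀ : V)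
    (N : Set (Node V)) (P : List V) : Prop where
  walk : Walk A s₀ s (Sum.inl u₀) N P
  u_mem : Sum.inl u₀ ∈ A
  u_notMem : Sum.inl u₀ ∉ N
  u_degree : s₀.degree (Sum.inl u₀) = 2
  closed : ∀ n ∈ N, ∀ q ∈ A, s₀.adj n q → q ∈ N ∨ q = Sum.inl u₀
  u_closed : ∀ q ∈ A, s₀.adj (Sum.inl u₀) q → q ∈ N
  length : 2 ≤ P.length
  chain : (u₀ :: P ++ [u₀]).IsChain G.Adj

/-- The invariant of the second walk. -/
structure WalkY (G : SimpleGraph V) (A : Set (Node V)) (s₀ s : Work V) (u₀ : V)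
    (N : Set (Node V)) (P : List V) (x₀ : V) (px prev y : Node V) : Prop where
  walk : Walk A s₀ s (Sum.inl u₀) N P
  u_mem : Sum.inl u₀ ∈ A
  u_degree : s₀.degree (Sum.inl u₀) = 2
  u_cases : Sum.inl u₀ ∈ N ∨ y = Sum.inl u₀
  x_mem : Sum.inl x₀ ∈ A
  x_notMem : Sum.inl x₀ ∉ N
  x_degree : s₀.degree (Sum.inl x₀) ≠ 2
  y_mem : y ∈ A
  y_notMem : y ∉ N
  px_mem : px ∈ A
  px_adj : s₀.adj px (Sum.inl x₀)
  prev_mem : prev ∈ A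
  prev_adj : s₀.adj prev y
  -- The first alternative is the case in which the first walk stopped at once, at the neighbor of
  -- the start.
  cases : (N = ∅ ∧ prev = Sum.inl x₀ ∧ px = y) ∨ (prev ∈ N ∧ px ∈ N)
  closed : ∀ n ∈ N, ∀ q ∈ A, s₀.adj n q →
    q ∈ N ∨ (q = Sum.inl x₀ ∧ n = px) ∨ (q = y ∧ n = prev)
  chain : ∀ r ∈ A, s₀.adj y r → r ≠ prev → (x₀ :: P ++ s₀.keyTowards y r).IsChain G.Adj

/-- The result of the two walks if the first one did not go around a cycle. -/
structure Ear (G : SimpleGraph V) (A : Set (Node V)) (s₀ s : Work V) (u₀ : V)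
    (N : Set (Node V)) (P : List V) (x₀ y₀ : V) (px py : Node V) : Prop where
  walk : Walk A s₀ s (Sum.inl u₀) N P
  u_mem : Sum.inl u₀ ∈ N
  x_mem : Sum.inl x₀ ∈ A
  x_notMem : Sum.inl x₀ ∉ N
  x_degree : s₀.degree (Sum.inl x₀) ≠ 2
  y_mem : Sum.inl y₀ ∈ A
  y_notMem : Sum.inl y₀ ∉ N
  y_degree : s₀.degree (Sum.inl y₀) ≠ 2
  px_mem : px ∈ N
  px_adj : s₀.adj px (Sum.inl x₀)
  py_mem : py ∈ N
  py_adj : s₀.adj py (Sum.inl y₀)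
  closed : ∀ n ∈ N, ∀ q ∈ A, s₀.adj n q →
    q ∈ N ∨ (q = Sum.inl x₀ ∧ n = px) ∨ (q = Sum.inl y₀ ∧ n = py)
  chain : (x₀ :: P ++ [y₀]).IsChain G.Adj

section

variable {S T : Set V} {A : Set (Node V)} {s₀ s : Work V} {u₀ : V} {N : Set (Node V)}
  {P : List V} {first prev x y : Node V}

theorem WalkX.init {s : Work V} (hI : OuterInv G S T A s) {F : List (Node V)}
    (hq : s.queue = Sum.inl u₀ :: F) (hu : Sum.inl u₀ ∈ A)
    (hd : s.degree (Sum.inl u₀) = 2) {a : Node V} (ha : a ∈ A) (hua : s.adj (Sum.inl u₀) a) :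
    WalkX G A s { s with queue := F } u₀ a ∅ [] (Sum.inl u₀) a where
  walk :=
    { painted :=
        { adj := rfl, degree := rfl, key := rfl, start := rfl, created := rfl
          color := by simp
          queue := fun p hp => by rw [hq]; exact List.mem_cons_of_mem _ hp
          mem_queue := fun p hp _ hpu => by
            rw [hq] at hp
            exact (List.mem_cons.1 hp).resolve_left hpu }
      subset := by simp
      degree := by simp
      nodup := by simp
      mem_iff := by simp }
  u_mem := hu
  u_notMem := by simp
  u_degree := hd
  x_mem := ha
  x_notMem := by simp
  prev_mem := hu
  prev_adj := hua
  first_mem := ha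
  first_adj := hua
  cases := Or.inl ⟨rfl, rfl, rfl, rfl, (hI.model.ne_of_adj hu ha hua).symm⟩
  closed := by simp
  chain r hr har hru := by
    have := hI.model.isChain_keyTowards hu ha hr hua har hru.symm
    rw [hI.model.keyTowards_inl] at this
    rw [List.nil_append, ← List.reverse_singleton, ← List.reverse_append, List.isChain_reverse]
    exact this.imp fun _ _ h => h.symm

/-- The node `x` has only the neighbors `prev` and `a`, so painting it moves the exit to `a`. Back
at the start no move is possible, because both neighbors are painted. The growth of `P` drives
termination. -/
theorem WalkX.move [Finite V] (hw : WalkX G A s₀ s u₀ first N P prev x)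
    (hI : OuterInv G S T A s₀) {a : Node V} (h : s.CanMove prev x a) :
    WalkX G A s₀ (s.remove x) u₀ first (insert x N) ((s.keyTowards x a).reverse ++ P) x a ∧
      P.length < ((s.keyTowards x a).reverse ++ P).length := by
  obtain ⟨hd, hxa, ha, haN, hap⟩ := (hw.walk.canMove_iff hI).1 h
  rw [hw.walk.painted.keyTowards]
  have hxp := hI.model.symm _ _ hw.prev_adj
  have hxu : x ≠ Sum.inl u₀ := by
    rintro rfl
    rcases hw.cases with ⟨-, -, -, -, h⟩ | ⟨h1, h2, h3⟩
    · exact h rfl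
    · rcases hI.eq_or_eq_of_degree hw.u_mem hw.u_degree hw.prev_mem hw.first_mem ha hxp
        hw.first_adj hxa (h3 rfl) with rfl | rfl
      · exact hap rfl
      · exact haN h1
  have hxx := hI.model.ne_of_adj hw.x_mem ha hxa
  refine ⟨?_, ?_⟩
  · exact
    { walk := hw.walk.paint hI hw.x_mem hw.x_notMem hd (by
        refine List.Perm.append_right _ ((List.reverse_perm _).trans ?_)
        unfold Work.keyTowards
        split
        · exact List.reverse_perm _
        · exact List.Perm.refl _)
      u_mem := hw.u_mem
      u_notMem := by
        rintro (h | h)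
        · exact hxu h.symm
        · exact hw.u_notMem h
      u_degree := hw.u_degree
      x_mem := ha
      x_notMem := by
        rintro (h | h)
        · exact hxx h.symm
        · exact haN h
      prev_mem := hw.x_mem
      prev_adj := hxa
      first_mem := hw.first_mem
      first_adj := hw.first_adj
      cases := by
        right
        rcases hw.cases with ⟨-, -, h1, h2, -⟩ | ⟨h1, -, -⟩
        · exact ⟨Or.inl h2.symm, Or.inl rfl, fun h => absurd (h.trans h1.symm) hap⟩
        · exact ⟨Or.inr h1, Or.inl rfl, fun _ h => hw.x_notMem (h ▸ h1)⟩
      closed := by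
        rintro n (rfl | hn) q hq hnq
        · rcases hI.eq_or_eq_of_degree hw.x_mem hd hw.prev_mem ha hq hxp hxa hnq hap.symm
            with rfl | rfl
          · rcases hw.cases with ⟨-, -, h1, h2, -⟩ | ⟨-, h2, -⟩
            · exact Or.inr (Or.inr ⟨h1, h2⟩)
            · exact Or.inl (Or.inr h2)
          · exact Or.inr (Or.inl ⟨rfl, rfl⟩)
        · rcases hw.closed n hn q hq hnq with h | ⟨rfl, -⟩ | h
          · exact Or.inl (Or.inr h)
          · exact Or.inl (Or.inl rfl)
          · exact Or.inr (Or.inr h)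
      chain := by
        intro r hr har hrx
        have h1 := hw.chain a ha hxa hap
        have h2 := hI.model.isChain_keyTowards hw.x_mem ha hr hxa har hrx.symm
        rw [List.append_assoc, ← List.append_assoc]
        refine List.IsChain.append_overlap ?_ h1 ?_
        · rw [← List.reverse_append, List.isChain_reverse]
          exact h2.imp fun _ _ h => h.symm
        · simpa using hI.model.keyTowards_ne_nil hw.x_mem a }
  · have := List.length_pos_iff.2 (hI.model.keyTowards_ne_nil hw.x_mem a)
    simp; omega

/-- Away from the start, a node of degree two would allow a move: its other neighbor cannot be
painted, since the only painted neighbor of `x` is `prev`. So the walk stops at an original vertex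
of larger degree. -/
theorem WalkX.finish [Finite V] (hw : WalkX G A s₀ s u₀ first N P prev x)
    (hI : OuterInv G S T A s₀) (h : ∀ a, ¬ s.CanMove prev x a) :
    (x = Sum.inl u₀ ∧ Loop G A s₀ s u₀ N P) ∨
      ∃ x₀ px, x = Sum.inl x₀ ∧ WalkY G A s₀ s u₀ N P x₀ px first (Sum.inl u₀) := by
  have hxp := hI.model.symm _ _ hw.prev_adj
  by_cases hxu : x = Sum.inl u₀
  · left
    refine ⟨hxu, ?_⟩
    subst hxu
    rcases hw.cases with ⟨-, -, -, -, h⟩ | ⟨h1, h2, h3⟩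
    · exact absurd rfl h
    have hpf := h3 rfl
    exact
    { walk := hw.walk
      u_mem := hw.u_mem
      u_notMem := hw.u_notMem
      u_degree := hw.u_degree
      closed := by
        intro n hn q hq hnq
        rcases hw.closed n hn q hq hnq with h | h | h
        · exact Or.inl h
        · exact Or.inr h.1
        · exact Or.inr h.1
      u_closed := by
        intro q hq huq
        rcases hI.eq_or_eq_of_degree hw.u_mem hw.u_degree hw.prev_mem hw.first_mem hq hxp
          hw.first_adj huq hpf with rfl | rfl
        · exact h2
        · exact h1
      length := by
        obtain ⟨v, hv⟩ := hI.model.exists_mem_key hw.prev_mem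
        obtain ⟨w, hw'⟩ := hI.model.exists_mem_key hw.first_mem
        have hvw : v ≠ w := by
          rintro rfl
          exact hpf (hI.model.disj _ hw.prev_mem _ hw.first_mem v hv hw')
        have hvP := (hw.walk.mem_iff v).2 ⟨_, h2, hv⟩
        have hwP := (hw.walk.mem_iff w).2 ⟨_, h1, hw'⟩
        match P, hvP, hwP with
        | [t], hvP, hwP =>
          simp at hvP hwP
          exact absurd (hvP.trans hwP.symm) hvw
        | _ :: _ :: _, _, _ => simp
      chain := by
        have := hw.chain first hw.first_mem hw.first_adj hpf.symm
        rw [hI.model.keyTowards_inl] at this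
        simpa using this }
  · right
    have hd : s₀.degree x ≠ 2 := by
      intro hd
      obtain ⟨a, ha, hxa, hap⟩ := hI.exists_other_neighbor (q := prev) hw.x_mem hd
      refine h a ((hw.walk.canMove_iff hI).2 ⟨hd, hxa, ha, fun haN => ?_, hap⟩)
      rcases hw.closed a haN x hw.x_mem (hI.model.symm _ _ hxa) with h | h | h
      · exact hw.x_notMem h
      · exact hap h.2
      · exact hxu h.1
    obtain ⟨x₀, rfl⟩ : ∃ x₀, x = Sum.inl x₀ := by
      rcases x with x₀ | k
      · exact ⟨x₀, rfl⟩
      · exact absurd (hI.degInr k hw.x_mem) hd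
    have hchain : (x₀ :: P ++ [u₀]).IsChain G.Adj := by
      obtain ⟨r, hr, hxr, hrp, -⟩ := hI.exists_third_neighbor hw.x_mem hd prev prev
      simpa [hI.model.keyTowards_inl] using hw.chain r hr hxr hrp
    refine ⟨x₀, prev, rfl, ?_⟩
    exact
    { walk := hw.walk
      u_mem := hw.u_mem
      u_degree := hw.u_degree
      u_cases := Or.inr rfl
      x_mem := hw.x_mem
      x_notMem := hw.x_notMem
      x_degree := hd
      y_mem := hw.u_mem
      y_notMem := hw.u_notMem
      px_mem := hw.prev_mem
      px_adj := hw.prev_adj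
      prev_mem := hw.first_mem
      prev_adj := hI.model.symm _ _ hw.first_adj
      cases := by
        rcases hw.cases with ⟨h0, -, h1, h2, -⟩ | ⟨h1, h2, -⟩
        · exact Or.inl ⟨h0, h2.symm, h1⟩
        · exact Or.inr ⟨h1, h2⟩
      closed := hw.closed
      chain := by
        intro r _ _ _
        rwa [hI.model.keyTowards_inl] }

/-- The end `x₀` of the first walk has degree different from two, so it is never painted by the
second walk. -/
theorem WalkY.move [Finite V] {x₀ : V} {px : Node V}
    (hw : WalkY G A s₀ s u₀ N P x₀ px prev y) (hI : OuterInv G S T A s₀) {b : Node V}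
    (h : s.CanMove prev y b) :
    WalkY G A s₀ (s.remove y) u₀ (insert y N) (P ++ s.keyTowards y b) x₀ px y b ∧
      P.length < (P ++ s.keyTowards y b).length := by
  obtain ⟨hd, hyb, hb, hbN, hbp⟩ := (hw.walk.canMove_iff hI).1 h
  rw [hw.walk.painted.keyTowards]
  have hyp := hI.model.symm _ _ hw.prev_adj
  have hyx : Sum.inl x₀ ≠ y := by
    rintro rfl
    exact hw.x_degree hd
  refine ⟨?_, ?_⟩
  · exact
    { walk := hw.walk.paint hI hw.y_mem hw.y_notMem hd (by
        refine List.perm_append_comm.trans (List.Perm.append_right _ ?_)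
        unfold Work.keyTowards
        split
        · exact List.reverse_perm _
        · exact List.Perm.refl _)
      u_mem := hw.u_mem
      u_degree := hw.u_degree
      u_cases := by
        left
        rcases hw.u_cases with h | h
        · exact Or.inr h
        · exact Or.inl h.symm
      x_mem := hw.x_mem
      x_notMem := by
        rintro (h | h)
        · exact hyx h
        · exact hw.x_notMem h
      x_degree := hw.x_degree
      y_mem := hb
      y_notMem := by
        rintro (h | h)
        · exact hI.model.ne_of_adj hw.y_mem hb hyb h.symm
        · exact hbN h
      px_mem := hw.px_mem
      px_adj := hw.px_adj
      prev_mem := hw.y_mem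
      prev_adj := hyb
      cases := by
        rcases hw.cases with ⟨-, -, h⟩ | ⟨-, h⟩
        · exact Or.inr ⟨Or.inl rfl, Or.inl h⟩
        · exact Or.inr ⟨Or.inl rfl, Or.inr h⟩
      closed := by
        rintro n (rfl | hn) q hq hnq
        · rcases hI.eq_or_eq_of_degree hw.y_mem hd hw.prev_mem hb hq hyp hyb hnq hbp.symm
            with rfl | rfl
          · rcases hw.cases with ⟨-, h1, h2⟩ | ⟨h1, -⟩
            · exact Or.inr (Or.inl ⟨h1, h2.symm⟩)
            · exact Or.inl (Or.inr h1)
          · exact Or.inr (Or.inr ⟨rfl, rfl⟩)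
        · rcases hw.closed n hn q hq hnq with h | h | ⟨rfl, -⟩
          · exact Or.inl (Or.inr h)
          · exact Or.inr (Or.inl h)
          · exact Or.inl (Or.inl rfl)
      chain := by
        intro r hr hbr hry
        have h1 := hw.chain b hb hyb hbp
        have h2 := hI.model.isChain_keyTowards hw.y_mem hb hr hyb hbr hry.symm
        rw [← List.cons_append]
        exact List.IsChain.append_overlap h1 h2 (hI.model.keyTowards_ne_nil hw.y_mem b) }
  · have := List.length_pos_iff.2 (hI.model.keyTowards_ne_nil hw.y_mem b)
    simp; omega

/-- The second walk also stops at a degree different from two; hence it has left the start, which is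
therefore painted. -/
theorem WalkY.finish [Finite V] {x₀ : V} {px : Node V}
    (hw : WalkY G A s₀ s u₀ N P x₀ px prev y) (hI : OuterInv G S T A s₀)
    (h : ∀ a, ¬ s.CanMove prev y a) :
    ∃ y₀, y = Sum.inl y₀ ∧ Ear G A s₀ s u₀ N P x₀ y₀ px prev := by
  have hd : s₀.degree y ≠ 2 := by
    intro hd
    obtain ⟨b, hb, hyb, hbp⟩ := hI.exists_other_neighbor (q := prev) hw.y_mem hd
    refine h b ((hw.walk.canMove_iff hI).2 ⟨hd, hyb, hb, fun hbN => ?_, hbp⟩)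
    rcases hw.closed b hbN y hw.y_mem (hI.model.symm _ _ hyb) with h | h | h
    · exact hw.y_notMem h
    · exact hw.x_degree (h.1 ▸ hd)
    · exact hbp h.2
  obtain ⟨y₀, rfl⟩ : ∃ y₀, y = Sum.inl y₀ := by
    rcases y with y₀ | k
    · exact ⟨y₀, rfl⟩
    · exact absurd (hI.degInr k hw.y_mem) hd
  have huN : Sum.inl u₀ ∈ N := by
    refine hw.u_cases.resolve_right fun h => hd ?_
    rw [h]; exact hw.u_degree
  have hcases := hw.cases.resolve_left fun h => by
    rw [h.1] at huN
    exact huN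
  refine ⟨y₀, rfl, ?_⟩
  exact
  { walk := hw.walk
    u_mem := huN
    x_mem := hw.x_mem
    x_notMem := hw.x_notMem
    x_degree := hw.x_degree
    y_mem := hw.y_mem
    y_notMem := hw.y_notMem
    y_degree := hd
    px_mem := hcases.2
    px_adj := hw.px_adj
    py_mem := hcases.1
    py_adj := hw.prev_adj
    closed := hw.closed
    chain := by
      obtain ⟨r, hr, hyr, hrp, -⟩ := hI.exists_third_neighbor hw.y_mem hd prev prev
      simpa [hI.model.keyTowards_inl] using hw.chain r hr hyr hrp }

end

/-! ### The end of a round -/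

theorem Work.mem_cut_queue {s : Work V} {x y p : Node V} :
    p ∈ (s.cut x y).queue ↔ p ∈ s.queue ∨ (p = x ∧ (s.cut x y).degree x = 2) ∨
      (p = y ∧ (s.cut x y).degree y = 2) := by
  set d := (s.cut x y).degree with hd
  have : (s.cut x y).queue = if d y = 2 then (if d x = 2 then s.queue ++ [x] else s.queue) ++ [y]
      else (if d x = 2 then s.queue ++ [x] else s.queue) := rfl
  rw [this]
  clear this
  clear_value d
  clear hd
  split_ifs <;> simp [*]

section

variable {S T : Set V} {A : Set (Node V)} {s₀ s : Work V} {u₀ x₀ y₀ : V} {N : Set (Node V)}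
  {P : List V} {px py : Node V}

/-- Carries closedness of the painted nodes over to the vertices in their keys. -/
theorem Walk.mem_or_of_adj [Finite V] (hw : Walk A s₀ s (Sum.inl u₀) N P)
    (hI : OuterInv G S T A s₀) {a b : V}
    (hcl : ∀ n ∈ N, ∀ q ∈ A, s₀.adj n q → q ∈ N ∨ q = Sum.inl a ∨ q = Sum.inl b) :
    ∀ v ∈ P, ∀ t ∈ T, G.Adj v t → t ∈ P ∨ t = a ∨ t = b := by
  intro v hv t ht hvt
  obtain ⟨n, hn, hvn⟩ := (hw.mem_iff v).1 hv
  obtain ⟨q, hq, htq⟩ := (hI.model.mem_iff t).1 ht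
  have : q ∈ N ∨ q = Sum.inl a ∨ q = Sum.inl b := by
    rcases hI.model.adj_of_adj (hw.subset hn) hq hvn htq hvt with rfl | h
    · exact Or.inl hn
    · exact hcl n hn q hq h
  rcases this with h | rfl | rfl
  · exact Or.inl ((hw.mem_iff t).2 ⟨q, h, htq⟩)
  · simp only [hI.model.keyInl, List.mem_singleton] at htq
    exact Or.inr (Or.inl htq)
  · simp only [hI.model.keyInl, List.mem_singleton] at htq
    exact Or.inr (Or.inr htq)

/-! ### Rounds whose walk closes up. -/

namespace Loop

theorem u_notMem_path (h : Loop G A s₀ s u₀ N P) (hI : OuterInv G S T A s₀) : u₀ ∉ P :=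
  h.walk.notMem hI h.u_mem h.u_notMem (by simp [hI.model.keyInl])

/-- The start and the painted nodes are closed under adjacency, and `T` is connected. -/
theorem subset_path [Finite V] (h : Loop G A s₀ s u₀ N P) (hI : OuterInv G S T A s₀) :
    ∀ t ∈ T, t = u₀ ∨ t ∈ P := by
  intro t ht
  by_contra hc
  have h2 := (twoConnectedOn_iff.1 (hI.twoConnected_of_mem h.u_mem).1).2.1 u₀
    (hI.model.inl_mem h.u_mem) t ht
  obtain ⟨v, hv, w, hw, -, hwn, hvw⟩ := h2.exists_exit (U := {t | t = u₀ ∨ t ∈ P}) (Or.inl rfl) hc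
  rcases hv with rfl | hv
  · obtain ⟨q, hq, hwq⟩ := (hI.model.mem_iff w).1 hw
    rcases hI.model.adj_of_adj h.u_mem hq (by simp [hI.model.keyInl]) hwq hvw with rfl | hadj
    · simp only [hI.model.keyInl, List.mem_singleton] at hwq
      exact hwn (Or.inl hwq)
    · exact hwn (Or.inr ((h.walk.mem_iff w).2 ⟨q, h.u_closed q hq hadj, hwq⟩))
  · rcases h.walk.mem_or_of_adj hI (a := u₀) (b := u₀)
      (fun n hn q hq hnq => (h.closed n hn q hq hnq).imp_right Or.inl) v hv w hw hvw with h' | h' | h'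
    · exact hwn (Or.inr h')
    · exact hwn (Or.inl h')
    · exact hwn (Or.inl h')

theorem isChordlessCycle [Finite V] (h : Loop G A s₀ s u₀ N P) (hI : OuterInv G S T A s₀) :
    IsChordlessCycle G (u₀ :: P) := by
  have hlen := h.length
  refine isChordlessCycle_of_thin (T := T) ⟨by simp; omega, ?_, h.chain.left_of_append, ?_⟩ ?_ ?_
  · exact List.nodup_cons.2 ⟨h.u_notMem_path hI, h.walk.nodup⟩
  · intro a ha b hb
    have := (List.isChain_append.1 h.chain).2.2 a ha u₀ (by simp)
    simp only [List.head?_cons, Option.mem_some_iff] at hb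
    exact hb ▸ this
  · intro v hv
    rcases List.mem_cons.1 hv with rfl | hv
    · exact hI.model.inl_mem h.u_mem
    · exact h.walk.mem_T hI hv
  · intro v hv
    rcases List.mem_cons.1 hv with rfl | hv
    · exact Or.inl (hI.thin h.u_mem h.u_degree (by simp [hI.model.keyInl]))
    · exact Or.inl (h.walk.thin hI hv)

theorem sameCycle [Finite V] (h : Loop G A s₀ s u₀ N P) (hI : OuterInv G S T A s₀) {z : List V}
    (hz : IsChordlessCycle G z) (hzT : ∀ v ∈ z, v ∈ T) : SameCycle (u₀ :: P) z := by
  -- A cycle has two distinct vertices, and at most one of them is `u₀`.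
  obtain ⟨v, hv, hvz⟩ : ∃ v ∈ P, v ∈ z := by
    obtain ⟨x, hx⟩ := hz.1.exists_mem
    obtain ⟨p, q, hp, hq, hpq, -⟩ := hz.around hx
    rcases h.subset_path hI p (hzT p hp) with rfl | h'
    · rcases h.subset_path hI q (hzT q hq) with rfl | h'
      · exact absurd rfl hpq
      · exact ⟨q, h', hq⟩
    · exact ⟨p, h', hp⟩
  have hc := hz.covers hzT h.chain (by
    intro w hw
    simp only [List.cons_append, List.mem_cons, List.mem_append, List.not_mem_nil, or_false] at hw
    rcases hw with rfl | hw | rfl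
    · exact hI.model.inl_mem h.u_mem
    · exact h.walk.mem_T hI hw
    · exact hI.model.inl_mem h.u_mem) (fun w hw => h.walk.thin hI hw) hv hvz
  exact sameCycle_of_subset (h.isChordlessCycle hI).1 hz fun w hw =>
    hc w (List.mem_append_left _ hw)

theorem outerInv [Finite V] (h : Loop G A s₀ s u₀ N P) (hI : OuterInv G S T A s₀) :
    OuterInv G S ∅ ∅ (s.paint (Sum.inl u₀)) where
  model :=
    { mem_iff := by simp
      disj := by simp
      symm := by
        intro p q hpq
        change s.adj p q at hpq
        change s.adj q p
        rw [h.walk.painted.adj] at hpq ⊢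
        exact hI.model.symm p q hpq
      keyInl := by
        intro a
        change s.key _ = _
        rw [h.walk.painted.key, hI.model.keyInl]
      adjInl := by simp
      path := by simp }
  degInl := by simp
  degInr := by simp
  valid := by simp
  white := by
    intro p hp
    have hp' : Valid S s₀ p := by
      unfold Valid at hp ⊢
      rwa [← h.walk.painted.created]
    simp only [Set.mem_empty_iff_false, iff_false]
    intro hc
    by_cases hpu : p = Sum.inl u₀
    · subst hpu
      simp [Work.paint] at hc
    · simp only [Work.paint, Function.update_of_ne hpu] at hc
      obtain ⟨h1, h2⟩ := (h.walk.painted.color p).1 hc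
      have hpA := (hI.white p hp').1 h1
      obtain ⟨t, ht⟩ := hI.model.exists_mem_key hpA
      rcases h.subset_path hI t (hI.model.key_subset hpA ht) with rfl | htP
      · exact hpu (hI.model.disj _ hpA _ h.u_mem t ht (by simp [hI.model.keyInl]))
      · exact h.walk.notMem hI hpA h2 ht htP
  adjValid := by
    intro p q hpq
    change s.adj p q at hpq
    rw [h.walk.painted.adj] at hpq
    have := hI.adjValid p q hpq
    unfold Valid at this ⊢
    rwa [← h.walk.painted.created] at this
  queue := by
    intro p hp
    obtain ⟨a, ha, hpa, -⟩ := hI.queue p (h.walk.painted.queue p hp)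
    exact ⟨a, ha, hpa, by simp⟩
  mem_queue := by simp
  subset := by simp
  twoConnected := Or.inl rfl

end Loop

/-! ### Rounds that end at two branching vertices. -/

namespace Ear

theorem x_notMem_path (h : Ear G A s₀ s u₀ N P x₀ y₀ px py) (hI : OuterInv G S T A s₀) :
    x₀ ∉ P :=
  h.walk.notMem hI h.x_mem h.x_notMem (by simp [hI.model.keyInl])

theorem y_notMem_path (h : Ear G A s₀ s u₀ N P x₀ y₀ px py) (hI : OuterInv G S T A s₀) :
    y₀ ∉ P :=
  h.walk.notMem hI h.y_mem h.y_notMem (by simp [hI.model.keyInl])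

theorem path_ne_nil (h : Ear G A s₀ s u₀ N P x₀ y₀ px py) (hI : OuterInv G S T A s₀) :
    P ≠ [] :=
  List.ne_nil_of_mem ((h.walk.mem_iff u₀).2 ⟨_, h.u_mem, by simp [hI.model.keyInl]⟩)

theorem mem_T (h : Ear G A s₀ s u₀ N P x₀ y₀ px py) (hI : OuterInv G S T A s₀) :
    ∀ w ∈ x₀ :: P ++ [y₀], w ∈ T := by
  intro w hw
  simp only [List.cons_append, List.mem_cons, List.mem_append, List.not_mem_nil, or_false] at hw
  rcases hw with rfl | hw | rfl
  · exact hI.model.inl_mem h.x_mem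
  · exact h.walk.mem_T hI hw
  · exact hI.model.inl_mem h.y_mem

theorem path_closed [Finite V] (h : Ear G A s₀ s u₀ N P x₀ y₀ px py)
    (hI : OuterInv G S T A s₀) : ∀ v ∈ P, ∀ t ∈ T, G.Adj v t → t ∈ P ∨ t = x₀ ∨ t = y₀ :=
  h.walk.mem_or_of_adj hI fun n hn q hq hnq =>
    (h.closed n hn q hq hnq).imp_right (Or.imp And.left And.left)

/-- The first end of an ear has a neighbor outside the ear and outside a prescribed node. -/
theorem exists_outside [Finite V] (h : Ear G A s₀ s u₀ N P x₀ y₀ px py)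
    (hI : OuterInv G S T A s₀) {r : Node V} (hrA : r ∈ A) (hr : x₀ = y₀ → r = py) :
    ∃ t ∈ T, t ∉ P ∧ t ≠ x₀ ∧ t ∉ s₀.key r := by
  -- A neighbor of `x₀` other than `px` and `r`. Among painted nodes only `px`, and `py` if the ends
  -- coincide, are adjacent to `x₀`, so `q` is not painted.
  obtain ⟨q, hq, hxq, hq1, hq2⟩ := hI.exists_third_neighbor h.x_mem h.x_degree px r
  have hqN : q ∉ N := by
    intro hqN
    rcases h.closed q hqN _ h.x_mem (hI.model.symm _ _ hxq) with h' | h' | h'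
    · exact h.x_notMem h'
    · exact hq1 h'.2
    · exact hq2 (h'.2.trans (hr (Sum.inl_injective h'.1)).symm)
  obtain ⟨t, ht⟩ := hI.model.exists_mem_key hq
  have h1 : t ≠ x₀ := by
    rintro rfl
    exact hI.model.ne_of_adj h.x_mem hq hxq
      (hI.model.disj _ h.x_mem _ hq t (by simp [hI.model.keyInl]) ht)
  exact ⟨t, hI.model.key_subset hq ht, h.walk.notMem hI hq hqN ht, h1, fun htr =>
    hq2 (hI.model.disj _ hq _ hrA t ht htr)⟩

/-- A common end would be a cut vertex, separating the path from a further neighbor. -/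
theorem ends_ne [Finite V] (h : Ear G A s₀ s u₀ N P x₀ y₀ px py)
    (hI : OuterInv G S T A s₀) : x₀ ≠ y₀ := by
  rintro rfl
  obtain ⟨t, htT, htP, htx, -⟩ := h.exists_outside hI (h.walk.subset h.py_mem) fun _ => rfl
  obtain ⟨p, hp⟩ := List.exists_mem_of_ne_nil _ (h.path_ne_nil hI)
  have hpx : p ≠ x₀ := by
    rintro rfl
    exact h.x_notMem_path hI hp
  have hconn := (twoConnectedOn_iff.1 (hI.twoConnected_of_mem h.x_mem).1).2.2 x₀
    (hI.model.inl_mem h.x_mem) p ⟨h.walk.mem_T hI hp, hpx⟩ t ⟨htT, htx⟩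
  obtain ⟨v, hv, w, hw, -, hwn, hvw⟩ := hconn.exists_exit (U := {v | v ∈ P}) hp htP
  rcases h.path_closed hI v hv w hw.1 hvw with h' | h' | h'
  · exact hwn h'
  · exact hw.2 h'
  · exact hw.2 h'

theorem isChordlessCycle [Finite V] (h : Ear G A s₀ s u₀ N P x₀ y₀ px py)
    (hI : OuterInv G S T A s₀) (hadj : G.Adj x₀ y₀) : IsChordlessCycle G (x₀ :: P ++ [y₀]) := by
  refine isChordlessCycle_of_thin (T := T) ⟨?_, ?_, h.chain, ?_⟩ (h.mem_T hI) ?_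
  · have := List.length_pos_iff.2 (h.path_ne_nil hI)
    simp; omega
  · have := h.x_notMem_path hI
    have := h.y_notMem_path hI
    have := hadj.ne
    simp only [List.cons_append, List.nodup_cons, List.mem_append, List.mem_singleton,
      List.nodup_append, h.walk.nodup, List.not_mem_nil, not_false_iff]
    grind
  · intro a ha b hb
    simp only [List.getLast?_append, List.getLast?_singleton, Option.some_or,
      Option.mem_some_iff] at ha
    simp only [List.cons_append, List.head?_cons, Option.mem_some_iff] at hb
    rw [← ha, ← hb]
    exact hadj.symm
  · intro v hv
    simp only [List.cons_append, List.mem_cons, List.mem_append, List.not_mem_nil, or_false] at hv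
    rcases hv with rfl | hv | rfl
    · exact Or.inr (Or.inl rfl)
    · exact Or.inl (h.walk.thin hI hv)
    · exact Or.inr (Or.inr List.getLast?_concat)

/-- A chordless cycle that meets the path must contain it with both ends, and then it is the cycle
of the ear. -/
theorem sameCycle_or [Finite V] (h : Ear G A s₀ s u₀ N P x₀ y₀ px py)
    (hI : OuterInv G S T A s₀) (hadj : G.Adj x₀ y₀) {z : List V} (hz : IsChordlessCycle G z)
    (hzT : ∀ v ∈ z, v ∈ T) :
    SameCycle (x₀ :: P ++ [y₀]) z ∨ ∀ v ∈ z, v ∈ T \ {v | v ∈ P} := by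
  by_cases hv : ∃ v ∈ P, v ∈ z
  · obtain ⟨v, hv, hvz⟩ := hv
    exact Or.inl (sameCycle_of_subset (h.isChordlessCycle hI hadj).1 hz
      (hz.covers hzT h.chain (h.mem_T hI) (fun w hw => h.walk.thin hI hw) hv hvz))
  · exact Or.inr fun v hvz => ⟨hzT v hvz, fun hvP => hv ⟨v, hvP, hvz⟩⟩

/-- Painted nodes lead out of the painted set only to `x₀` and `y₀`, never to a created node, so
surviving created nodes keep their ends. -/
theorem inl_notMem (h : Ear G A s₀ s u₀ N P x₀ y₀ px py) (hI : OuterInv G S T A s₀) {a : V}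
    {k : ℕ} (hk : Sum.inr k ∈ A) (hkN : Sum.inr k ∉ N)
    (hadj : s₀.adj (Sum.inr k) (Sum.inl a)) : Sum.inl a ∉ N := by
  intro haN
  rcases h.closed _ haN _ hk (hI.model.symm _ _ hadj) with h' | h' | h'
  · exact hkN h'
  · simp at h'
  · simp at h'

/-- The set `T` stays the same; only its representation changes. The new index is fresh, so no
earlier adjacency involves it. -/
theorem outerInv_create [Finite V] (h : Ear G A s₀ s u₀ N P x₀ y₀ px py)
    (hI : OuterInv G S T A s₀) (hadj : ¬ G.Adj x₀ y₀) :
    OuterInv G S T (insert (Sum.inr s.created) (A \ N))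
      (s.create (Sum.inl x₀) (Sum.inl y₀) P) := by
  have hp := h.walk.painted
  have hw : Sum.inr s.created ∉ A := by
    intro hA
    rcases hI.valid _ hA with ⟨a, -, h'⟩ | ⟨k, hk, h'⟩
    · simp at h'
    · rw [← hp.created] at hk
      simp only [Sum.inr.injEq] at h'
      omega
  have hwadj : ∀ p, ¬ s.adj p (Sum.inr s.created) := by
    intro p hpw
    rw [hp.adj] at hpw
    rcases hI.adjValid _ _ hpw with ⟨a, -, h'⟩ | ⟨k, hk, h'⟩
    · simp at h'
    · rw [← hp.created] at hk
      simp only [Sum.inr.injEq] at h'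
      omega
  have hwadj' : ∀ p, ¬ s.adj (Sum.inr s.created) p := by
    intro p hpw
    refine hwadj p ?_
    rw [hp.adj] at hpw ⊢
    exact hI.model.symm _ _ hpw
  have hkey : ∀ p, p ≠ Sum.inr s.created →
      (s.create (Sum.inl x₀) (Sum.inl y₀) P).key p = s₀.key p := by
    intro p hne
    simp [Work.create, hne, hp.key]
  have hkeyw : (s.create (Sum.inl x₀) (Sum.inl y₀) P).key (Sum.inr s.created) = P := by
    simp [Work.create]
  have hdeg : ∀ p, p ≠ Sum.inr s.created →
      (s.create (Sum.inl x₀) (Sum.inl y₀) P).degree p = s₀.degree p := by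
    intro p hne
    simp [Work.create, hne, hp.degree]
  have hvalid : ∀ p, Valid S s₀ p → Valid S (s.create (Sum.inl x₀) (Sum.inl y₀) P) p := by
    rintro p (hpv | ⟨k, hk, rfl⟩)
    · exact Or.inl hpv
    · refine Or.inr ⟨k, ?_, rfl⟩
      rw [← hp.created] at hk
      exact Nat.lt_succ_of_lt hk
  have hne : ∀ p ∈ A, p ≠ Sum.inr s.created := by
    rintro p hpA rfl
    exact hw hpA
  refine { model := ?_, degInl := ?_, degInr := ?_, valid := ?_, white := ?_, adjValid := ?_,
           queue := ?_, mem_queue := ?_, subset := hI.subset, twoConnected := hI.twoConnected }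
  · refine { mem_iff := ?_, disj := ?_, symm := ?_, keyInl := ?_, adjInl := ?_, path := ?_ }
    · intro v
      constructor
      · intro hv
        obtain ⟨p, hpA, hvp⟩ := (hI.model.mem_iff v).1 hv
        by_cases hpN : p ∈ N
        · refine ⟨_, Or.inl rfl, ?_⟩
          rw [hkeyw]
          exact (h.walk.mem_iff v).2 ⟨p, hpN, hvp⟩
        · refine ⟨p, Or.inr ⟨hpA, hpN⟩, ?_⟩
          rwa [hkey p (hne p hpA)]
      · rintro ⟨p, rfl | hpA, hvp⟩
        · rw [hkeyw] at hvp
          exact h.walk.mem_T hI hvp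
        · rw [hkey p (hne p hpA.1)] at hvp
          exact hI.model.key_subset hpA.1 hvp
    · rintro p (rfl | hpA) q (rfl | hqA) v hvp hvq
      · rfl
      · rw [hkeyw] at hvp
        rw [hkey q (hne q hqA.1)] at hvq
        exact absurd hvp (h.walk.notMem hI hqA.1 hqA.2 hvq)
      · rw [hkeyw] at hvq
        rw [hkey p (hne p hpA.1)] at hvp
        exact absurd hvq (h.walk.notMem hI hpA.1 hpA.2 hvp)
      · rw [hkey p (hne p hpA.1)] at hvp
        rw [hkey q (hne q hqA.1)] at hvq
        exact hI.model.disj p hpA.1 q hqA.1 v hvp hvq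
    · rintro p q (hpq | hpq | hpq)
      · left
        rw [hp.adj] at hpq ⊢
        exact hI.model.symm _ _ hpq
      · exact Or.inr (Or.inr hpq)
      · exact Or.inr (Or.inl hpq)
    · intro a
      rw [hkey _ (by simp), hI.model.keyInl]
    · rintro a b (ha | ha) (hb | hb)
      · simp at ha
      · simp at ha
      · simp at hb
      · rw [← hI.model.adjInl a b ha.1 hb.1]
        simp [Work.create, hp.adj]
    · intro k hk
      by_cases hks : k = s.created
      · subst hks
        rw [hkeyw]
        refine ⟨x₀, y₀, Or.inr ⟨h.x_mem, h.x_notMem⟩, Or.inr ⟨h.y_mem, h.y_notMem⟩, h.ends_ne hI,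
          hadj, by simp [Work.create], ?_, h.path_ne_nil hI, h.walk.nodup, h.chain,
          fun v hv => h.walk.thin hI hv⟩
        intro q _
        simp [Work.create, hwadj']
      · have hk : Sum.inr k ∈ A \ N := by
          rcases hk with hk | hk
          · simp only [Sum.inr.injEq] at hk
            exact absurd hk hks
          · exact hk
        obtain ⟨a, b, ha, hb, hab, hnadj, hst, hall, hrest⟩ := hI.model.path k hk.1
        rw [hkey _ (hne _ hk.1)]
        refine ⟨a, b, Or.inr ⟨ha, ?_⟩, Or.inr ⟨hb, ?_⟩, hab, hnadj, ?_, ?_, hrest⟩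
        · exact h.inl_notMem hI hk.1 hk.2 ((hall _ ha).2 (Or.inl rfl))
        · exact h.inl_notMem hI hk.1 hk.2 ((hall _ hb).2 (Or.inr rfl))
        · simp [Work.create, hks, hp.start, hst]
        · rintro q (rfl | hq)
          · simp [Work.create, hks, hwadj]
          · have := hne q hq.1
            rw [← hall q hq.1]
            simp [Work.create, hks, this, hp.adj]
  · rintro a (ha | ha)
    · simp at ha
    · rw [hdeg _ (by simp), hI.degInl a ha.1]
  · intro k hk
    by_cases hks : k = s.created
    · subst hks
      simp [Work.create]
    · rcases hk with hk | hk
      · simp only [Sum.inr.injEq] at hk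
        exact absurd hk hks
      · rw [hdeg _ (by simpa using hks), hI.degInr k hk.1]
  · rintro p (rfl | hpA)
    · exact Or.inr ⟨_, Nat.lt_succ_self _, rfl⟩
    · exact hvalid p (hI.valid p hpA.1)
  · intro p hpv
    by_cases hpw : p = Sum.inr s.created
    · subst hpw
      simp [Work.create]
    · have hpv' : Valid S s₀ p := by
        rcases hpv with hpv | ⟨k, hk, rfl⟩
        · exact Or.inl hpv
        · refine Or.inr ⟨k, ?_, rfl⟩
          rw [← hp.created]
          have : k ≠ s.created := by simpa using hpw
          exact lt_of_le_of_ne (Nat.lt_succ_iff.1 hk) this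
      simp only [Work.create, Function.update_of_ne hpw, hp.color, hI.white p hpv',
        Set.mem_insert_iff, hpw, false_or, Set.mem_sdiff]
  · rintro p q (hpq | ⟨-, rfl | rfl⟩ | ⟨rfl, -⟩)
    · rw [hp.adj] at hpq
      exact hvalid q (hI.adjValid p q hpq)
    · exact hvalid _ (hI.valid _ h.x_mem)
    · exact hvalid _ (hI.valid _ h.y_mem)
    · exact Or.inr ⟨_, Nat.lt_succ_self _, rfl⟩
  · intro p hpq
    obtain ⟨a, ha, rfl, hd⟩ := hI.queue p (hp.queue p hpq)
    refine ⟨a, ha, rfl, ?_⟩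
    rintro (hA | hA)
    · simp at hA
    · rw [hdeg _ (by simp)]
      exact hd hA.1
  · rintro a (ha | ha) hd
    · simp at ha
    · rw [hdeg _ (by simp)] at hd
      refine hp.mem_queue _ (hI.mem_queue a ha.1 hd) ha.2 ?_
      rintro hu
      exact ha.2 (hu ▸ h.u_mem)

/-- Only `x₀` and `y₀` lose a neighbor, one each, which matches the decreased counters; all other
surviving vertices have no neighbor on the path. -/
theorem outerInv_cut [Finite V] (h : Ear G A s₀ s u₀ N P x₀ y₀ px py)
    (hI : OuterInv G S T A s₀) (hadj : G.Adj x₀ y₀) :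
    OuterInv G S (T \ {v | v ∈ P}) (A \ N) (s.cut (Sum.inl x₀) (Sum.inl y₀)) := by
  have hp := h.walk.painted
  have hkey : (s.cut (Sum.inl x₀) (Sum.inl y₀)).key = s₀.key := hp.key
  have hsadj : (s.cut (Sum.inl x₀) (Sum.inl y₀)).adj = s₀.adj := hp.adj
  have hstart : (s.cut (Sum.inl x₀) (Sum.inl y₀)).start = s₀.start := hp.start
  have hcolor : (s.cut (Sum.inl x₀) (Sum.inl y₀)).color = s.color := rfl
  have hvalid : ∀ p, Valid S (s.cut (Sum.inl x₀) (Sum.inl y₀)) p ↔ Valid S s₀ p := by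
    intro p
    unfold Valid
    rw [← hp.created]
    rfl
  have hne := h.ends_ne hI
  have hdx : (s.cut (Sum.inl x₀) (Sum.inl y₀)).degree (Sum.inl x₀)
      = s₀.degree (Sum.inl x₀) - 1 := by
    simp [Work.cut, Work.enqueueIfTwo, Work.decrease, hne, hp.degree]
  have hdy : (s.cut (Sum.inl x₀) (Sum.inl y₀)).degree (Sum.inl y₀)
      = s₀.degree (Sum.inl y₀) - 1 := by
    simp [Work.cut, Work.enqueueIfTwo, Work.decrease, hne.symm, hp.degree]
  have hd : ∀ p, p ≠ Sum.inl x₀ → p ≠ Sum.inl y₀ →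
      (s.cut (Sum.inl x₀) (Sum.inl y₀)).degree p = s₀.degree p := by
    intro p h1 h2
    simp [Work.cut, Work.enqueueIfTwo, Work.decrease, h1, h2, hp.degree]
  have hmodel : Model G (T \ {v | v ∈ P}) (A \ N) (s.cut (Sum.inl x₀) (Sum.inl y₀)) := by
    refine { mem_iff := ?_, disj := ?_, symm := ?_, keyInl := ?_, adjInl := ?_, path := ?_ }
    · intro v
      rw [hkey]
      constructor
      · rintro ⟨hv, hvP⟩
        obtain ⟨p, hpA, hvp⟩ := (hI.model.mem_iff v).1 hv
        exact ⟨p, ⟨hpA, fun hpN => hvP ((h.walk.mem_iff v).2 ⟨p, hpN, hvp⟩)⟩, hvp⟩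
      · rintro ⟨p, hpA, hvp⟩
        exact ⟨hI.model.key_subset hpA.1 hvp, h.walk.notMem hI hpA.1 hpA.2 hvp⟩
    · intro p hpA q hqA v
      rw [hkey]
      exact hI.model.disj p hpA.1 q hqA.1 v
    · rw [hsadj]
      exact hI.model.symm
    · rw [hkey]
      exact hI.model.keyInl
    · intro a b ha hb
      rw [hsadj]
      exact hI.model.adjInl a b ha.1 hb.1
    · intro k hk
      obtain ⟨a, b, ha, hb, hab, hnadj, hst, hall, h1, h2, h3, h4⟩ := hI.model.path k hk.1
      rw [hkey, hsadj, hstart]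
      refine ⟨a, b, ⟨ha, ?_⟩, ⟨hb, ?_⟩, hab, hnadj, hst, fun q hq => hall q hq.1, h1, h2, h3,
        fun v hv => (h4 v hv).mono Set.sdiff_subset⟩
      · exact h.inl_notMem hI hk.1 hk.2 ((hall _ ha).2 (Or.inl rfl))
      · exact h.inl_notMem hI hk.1 hk.2 ((hall _ hb).2 (Or.inr rfl))
  -- The uniqueness of the painted neighbor `pa` makes the drop in the vertex count exactly one,
  -- even if `pa` stands for a long path.
  have hcut : ∀ a, ∀ pa ∈ N, Sum.inl a ∈ A → Sum.inl a ∉ N → s₀.adj pa (Sum.inl a) →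
      (∀ n ∈ N, s₀.adj n (Sum.inl a) → n = pa) →
      (G.neighborSet a ∩ (T \ {v | v ∈ P})).ncard = s₀.degree (Sum.inl a) - 1 := by
    intro a pa hpa ha haN hadj hall
    rw [hmodel.ncard_neighbors ⟨ha, haN⟩, hI.degInl a ha, hI.model.ncard_neighbors ha,
      ← Set.ncard_sdiff_singleton_of_mem (s := {q | q ∈ A ∧ s₀.adj (Sum.inl a) q}) (a := pa)
        ⟨h.walk.subset hpa, hI.model.symm _ _ hadj⟩]
    congr 1
    ext q
    simp only [Set.mem_sdiff, Set.mem_ofPred_eq, Set.mem_singleton_iff, hsadj]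
    constructor
    · rintro ⟨⟨h1, h2⟩, h3⟩
      exact ⟨⟨h1, h3⟩, fun e => h2 (e ▸ hpa)⟩
    · rintro ⟨⟨h1, h3⟩, h2⟩
      exact ⟨⟨h1, fun hqN => h2 (hall q hqN (hI.model.symm _ _ h3))⟩, h3⟩
  have hcx := hcut x₀ px h.px_mem h.x_mem h.x_notMem h.px_adj (by
    intro n hn hnx
    rcases h.closed n hn _ h.x_mem hnx with h' | h' | h'
    · exact absurd h' h.x_notMem
    · exact h'.2
    · exact absurd (Sum.inl_injective h'.1) hne)
  have hcy := hcut y₀ py h.py_mem h.y_mem h.y_notMem h.py_adj (by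
    intro n hn hny
    rcases h.closed n hn _ h.y_mem hny with h' | h' | h'
    · exact absurd h' h.y_notMem
    · exact absurd (Sum.inl_injective h'.1).symm hne
    · exact h'.2)
  have hxT : x₀ ∈ T \ {v | v ∈ P} := ⟨hI.model.inl_mem h.x_mem, h.x_notMem_path hI⟩
  have hyT : y₀ ∈ T \ {v | v ∈ P} := ⟨hI.model.inl_mem h.y_mem, h.y_notMem_path hI⟩
  refine { model := hmodel, degInl := ?_, degInr := ?_, valid := ?_, white := ?_,
           adjValid := ?_, queue := ?_, mem_queue := ?_, subset := fun v hv => hI.subset hv.1, twoConnected := ?_ }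
  · intro a ha
    by_cases hax : a = x₀
    · subst hax
      rw [hdx, hcx]
    by_cases hay : a = y₀
    · subst hay
      rw [hdy, hcy]
    rw [hd _ (by simpa using hax) (by simpa using hay), hI.degInl a ha.1]
    congr 1
    ext t
    constructor
    · rintro ⟨hat, ht⟩
      refine ⟨hat, ht, fun htP => ?_⟩
      rcases h.path_closed hI t htP a (hI.model.inl_mem ha.1) hat.symm with h' | h' | h'
      · exact h.walk.notMem hI ha.1 ha.2 (by simp [hI.model.keyInl]) h'
      · exact hax h'
      · exact hay h'
    · rintro ⟨hat, ht⟩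
      exact ⟨hat, ht.1⟩
  · intro k hk
    rw [hd _ (by simp) (by simp), hI.degInr k hk.1]
  · intro p hpA
    exact (hvalid p).2 (hI.valid p hpA.1)
  · intro p hpv
    rw [hcolor, hp.color, hI.white p ((hvalid p).1 hpv)]
    rfl
  · intro p q hpq
    rw [hsadj] at hpq
    exact (hvalid q).2 (hI.adjValid p q hpq)
  · intro p hpq
    have memS : ∀ {a}, Sum.inl a ∈ A → a ∈ S := fun ha => hI.subset (hI.model.inl_mem ha)
    rw [Work.mem_cut_queue] at hpq
    by_cases hpx : p = Sum.inl x₀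
    · subst hpx
      refine ⟨x₀, memS h.x_mem, rfl, fun _ => ?_⟩
      rcases hpq with hpq | hpq | hpq
      · obtain ⟨a, -, -, hd'⟩ := hI.queue _ (hp.queue _ hpq)
        exact absurd (hd' h.x_mem) h.x_degree
      · exact hpq.2
      · exact absurd (Sum.inl_injective hpq.1) hne
    by_cases hpy : p = Sum.inl y₀
    · subst hpy
      refine ⟨y₀, memS h.y_mem, rfl, fun _ => ?_⟩
      rcases hpq with hpq | hpq | hpq
      · obtain ⟨a, -, -, hd'⟩ := hI.queue _ (hp.queue _ hpq)
        exact absurd (hd' h.y_mem) h.y_degree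
      · exact absurd (Sum.inl_injective hpq.1).symm hne
      · exact hpq.2
    obtain ⟨a, ha, hpa, hd'⟩ := hI.queue p (hp.queue p (by tauto))
    refine ⟨a, ha, hpa, fun hA => ?_⟩
    rw [hd p hpx hpy]
    exact hd' hA.1
  · intro a ha hda
    rw [Work.mem_cut_queue]
    by_cases hax : a = x₀
    · subst hax
      exact Or.inr (Or.inl ⟨rfl, hda⟩)
    by_cases hay : a = y₀
    · subst hay
      exact Or.inr (Or.inr ⟨rfl, hda⟩)
    rw [hd _ (by simpa using hax) (by simpa using hay)] at hda
    refine Or.inl (hp.mem_queue _ (hI.mem_queue a ha.1 hda) ha.2 ?_)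
    rintro hu
    exact ha.2 (hu ▸ h.u_mem)
  · right
    refine ⟨(hI.twoConnected_of_mem h.x_mem).1.diff hxT hyT hadj (h.path_closed hI), ?_⟩
    -- A third remaining vertex, so that what is left is more than the edge between the ends.
    obtain ⟨t, htT, htP, htx, hty⟩ := h.exists_outside hI h.y_mem (fun e => absurd e hne)
    simp only [hI.model.keyInl, List.mem_singleton] at hty
    have hsub : ({x₀, y₀, t} : Set V) ⊆ T \ {v | v ∈ P} := by
      rintro w (rfl | rfl | rfl)
      · exact hxT
      · exact hyT
      · exact ⟨htT, htP⟩
    have h3 := Set.ncard_le_ncard hsub (Set.toFinite _)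
    rwa [Set.ncard_eq_three.2 ⟨x₀, y₀, t, hne, Ne.symm htx, Ne.symm hty, rfl⟩] at h3

end Ear

end

/-! ### The runs of the algorithm -/

/-- All members of `C` are chordless cycles, and a chordless cycle that does not lie in one of the
sets `L` or in `T` is described by a member of `C`. -/
structure Found (G : SimpleGraph V) (L : List (Set V)) (C : Set (List V)) (T : Set V) : Prop where
  sound : ∀ c ∈ C, IsChordlessCycle G c
  complete : ∀ l, IsChordlessCycle G l →
    (∃ c ∈ C, SameCycle c l) ∨ (∃ S ∈ L, ∀ v ∈ l, v ∈ S) ∨ ∀ v ∈ l, v ∈ T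

theorem Found.insert {L : List (Set V)} {C : Set (List V)} {T T' : Set V} (h : Found G L C T)
    {c : List V} (hc : IsChordlessCycle G c)
    (hT : ∀ l, IsChordlessCycle G l → (∀ v ∈ l, v ∈ T) → SameCycle c l ∨ ∀ v ∈ l, v ∈ T') :
    Found G L (insert c C) T' where
  sound := by
    rintro d (rfl | hd)
    · exact hc
    · exact h.sound d hd
  complete l hl := by
    rcases h.complete l hl with ⟨d, hd, hdl⟩ | h' | h'
    · exact Or.inl ⟨d, Or.inr hd, hdl⟩
    · exact Or.inr (Or.inl h')
    · rcases hT l hl h' with h' | h'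
      · exact Or.inl ⟨c, Or.inl rfl, h'⟩
      · exact Or.inr (Or.inr h')

section

variable {Q : Result V → Prop} {L : List (Set V)} {C : Set (List V)} {S T : Set V}
  {A : Set (Node V)} {s₀ s : Work V} {u₀ : V} {N : Set (Node V)} {P : List V}

/-- Every run returns from the head of the queue loop, once fewer than `n` original vertices are
active. -/
def ReturnsBelow (G : SimpleGraph V) (Q : Result V → Prop) (L : List (Set V)) (S : Set V)
    (n : ℕ) : Prop :=
  ∀ T A s C, OuterInv G S T A s → Found G L C T → {a | Sum.inl a ∈ A}.ncard < n →
    EveryRunReturns G Q (.outer L C S s)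

/-- Created nodes are not counted, so that a contraction decreases the measure as well. -/
theorem ncard_active_lt [Finite V] {A' : Set (Node V)} (h : ∀ a, Sum.inl a ∈ A' → Sum.inl a ∈ A)
    (hu : Sum.inl u₀ ∈ A) (hu' : Sum.inl u₀ ∉ A') :
    {a : V | Sum.inl a ∈ A'}.ncard < {a : V | Sum.inl a ∈ A}.ncard := by
  refine Set.ncard_lt_ncard ⟨fun a ha => h a ha, fun hs => hu' ?_⟩ (Set.toFinite _)
  exact hs (show u₀ ∈ {a : V | Sum.inl a ∈ A} from hu)

theorem Loop.returns [Finite V] (h : Loop G A s₀ s u₀ N P) (hI : OuterInv G S T A s₀)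
    (hF : Found G L C T) (hR : ReturnsBelow G Q L S {a | Sum.inl a ∈ A}.ncard) :
    EveryRunReturns G Q (.branch L C S s P (Sum.inl u₀) (Sum.inl u₀)) := by
  refine .step _ ⟨_, .close L C S s P _ _ rfl⟩ fun c' hc' => ?_
  cases hc' with
  | peel _ _ _ _ _ _ _ hne => exact absurd rfl hne
  | contract _ _ _ _ _ _ _ hne => exact absurd rfl hne
  | close =>
    refine hR _ _ _ _ (h.outerInv hI) (hF.insert ?_ ?_) (ncard_active_lt (by simp) h.u_mem (by simp))
    · rw [h.walk.painted.key, hI.model.keyInl]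
      exact h.isChordlessCycle hI
    · intro l hl hlT
      left
      rw [h.walk.painted.key, hI.model.keyInl]
      exact h.sameCycle hI hl hlT

theorem Ear.returns [Finite V] {x₀ y₀ : V} {px py : Node V}
    (h : Ear G A s₀ s u₀ N P x₀ y₀ px py) (hI : OuterInv G S T A s₀)
    (hF : Found G L C T) (hR : ReturnsBelow G Q L S {a | Sum.inl a ∈ A}.ncard) :
    EveryRunReturns G Q (.branch L C S s P (Sum.inl x₀) (Sum.inl y₀)) := by
  have hne := h.ends_ne hI
  have hne' : (Sum.inl x₀ : Node V) ≠ Sum.inl y₀ := by simpa using hne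
  have hadj : s.adj (Sum.inl x₀) (Sum.inl y₀) ↔ G.Adj x₀ y₀ := by
    rw [h.walk.painted.adj]
    exact hI.model.adjInl _ _ h.x_mem h.y_mem
  refine .step _ ?_ fun c' hc' => ?_
  · by_cases hxy : G.Adj x₀ y₀
    · exact ⟨_, .peel L C S s P _ _ hne' (hadj.2 hxy)⟩
    · exact ⟨_, .contract L C S s P _ _ hne' (fun h' => hxy (hadj.1 h'))⟩
  cases hc' with
  | peel _ _ _ _ _ _ _ _ hxy =>
    rw [hadj] at hxy
    refine hR _ _ _ _ (h.outerInv_cut hI hxy) (hF.insert ?_ ?_)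
      (ncard_active_lt (fun a ha => ha.1) (h.walk.subset h.u_mem) (fun hu => hu.2 h.u_mem))
    · rw [h.walk.painted.key, hI.model.keyInl, hI.model.keyInl]
      exact h.isChordlessCycle hI hxy
    · intro l hl hlT
      rw [h.walk.painted.key, hI.model.keyInl, hI.model.keyInl]
      exact h.sameCycle_or hI hxy hl hlT
  | contract _ _ _ _ _ _ _ _ hxy =>
    rw [hadj] at hxy
    refine hR _ _ _ _ (h.outerInv_create hI hxy) hF
      (ncard_active_lt ?_ (h.walk.subset h.u_mem) ?_)
    · rintro a (ha | ha)
      · simp at ha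
      · exact ha.1
    · rintro (hu | hu)
      · simp at hu
      · exact hu.2 h.u_mem
  | close _ _ _ _ _ _ _ heq => exact absurd heq hne'

/-- The path has no repeated vertices and grows with every move, so its length is bounded by the
number of vertices. -/
theorem WalkY.returns [Fintype V] (hI : OuterInv G S T A s₀) (hF : Found G L C T)
    (hR : ReturnsBelow G Q L S {a | Sum.inl a ∈ A}.ncard) {x₀ : V} {px prev y : Node V}
    (hw : WalkY G A s₀ s u₀ N P x₀ px prev y) :
    EveryRunReturns G Q (.walkY L C S s P (Sum.inl x₀) prev y) := by
  induction hm : Fintype.card V - P.length using Nat.strong_induction_on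
    generalizing s N P prev y with
  | _ m ih =>
    refine .step _ ?_ fun c' hc' => ?_
    · by_cases h : ∃ b, s.CanMove prev y b
      · obtain ⟨b, hb⟩ := h
        exact ⟨_, .moveY L C S s P _ _ _ b hb⟩
      · push Not at h
        exact ⟨_, .endY L C S s P _ _ _ h⟩
    cases hc' with
    | moveY _ _ _ _ _ _ _ _ b hb =>
      obtain ⟨hw', hlt⟩ := hw.move hI hb
      have := hw'.walk.length_le
      exact ih _ (by omega) hw' rfl
    | endY _ _ _ _ _ _ _ _ h =>
      obtain ⟨y₀, rfl, he⟩ := hw.finish hI h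
      exact he.returns hI hF hR

theorem WalkX.returns [Fintype V] (hI : OuterInv G S T A s₀) (hF : Found G L C T)
    (hR : ReturnsBelow G Q L S {a | Sum.inl a ∈ A}.ncard) {first prev x : Node V}
    (hw : WalkX G A s₀ s u₀ first N P prev x) :
    EveryRunReturns G Q (.walkX L C S s (Sum.inl u₀) first P prev x) := by
  induction hm : Fintype.card V - P.length using Nat.strong_induction_on
    generalizing s N P prev x with
  | _ m ih =>
    refine .step _ ?_ fun c' hc' => ?_
    · by_cases h : ∃ a, s.CanMove prev x a
      · obtain ⟨a, ha⟩ := h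
        exact ⟨_, .moveX L C S s _ _ P _ _ a ha⟩
      · push Not at h
        exact ⟨_, .endX L C S s _ _ P _ _ h⟩
    cases hc' with
    | moveX _ _ _ _ _ _ _ _ _ a ha =>
      obtain ⟨hw', hlt⟩ := hw.move hI ha
      have := hw'.walk.length_le
      exact ih _ (by omega) hw' rfl
    | endX _ _ _ _ _ _ _ _ _ h =>
      rcases hw.finish hI h with ⟨rfl, hl⟩ | ⟨x₀, px, rfl, hy⟩
      -- After a closed walk the second walk is stuck at once, since all neighbors of the start are
      -- painted.
      · have hno : ∀ b, ¬ s.CanMove first (Sum.inl u₀) b := by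
          intro b hb
          obtain ⟨-, hub, hbA, hbN, -⟩ := (hl.walk.canMove_iff hI).1 hb
          exact hbN (hl.u_closed b hbA hub)
        refine .step _ ⟨_, .endY L C S s P _ _ _ hno⟩ fun c' hc' => ?_
        cases hc' with
        | moveY _ _ _ _ _ _ _ _ b hb => exact absurd hb (hno b)
        | endY => exact hl.returns hI hF hR
      · exact hy.returns hI hF hR

theorem OuterInv.skip (hI : OuterInv G S T A s) {u : Node V} {F : List (Node V)}
    (hq : s.queue = u :: F) (hu : u ∉ A) : OuterInv G S T A { s with queue := F } where
  model := ⟨hI.model.mem_iff, hI.model.disj, hI.model.symm, hI.model.keyInl, hI.model.adjInl,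
    hI.model.path⟩
  degInl := hI.degInl
  degInr := hI.degInr
  valid := hI.valid
  white := hI.white
  adjValid := hI.adjValid
  queue p hp := hI.queue p (by rw [hq]; exact List.mem_cons_of_mem _ hp)
  mem_queue a ha hd := by
    have := hI.mem_queue a ha hd
    rw [hq] at this
    rcases List.mem_cons.1 this with h | h
    · exact absurd (h ▸ ha) hu
    · exact h
  subset := hI.subset
  twoConnected := hI.twoConnected

/-- Induction on the number of active original vertices, and inside it on the queue: skipping an
entry leaves the active nodes unchanged. -/
theorem OuterInv.returns [Fintype V] (hG : CyclicallyOrientable G)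
    (hnext : ∀ C, Found G L C ∅ → EveryRunReturns G Q (.components L C))
    (hI : OuterInv G S T A s) (hF : Found G L C T) : EveryRunReturns G Q (.outer L C S s) := by
  induction hn : {a | Sum.inl a ∈ A}.ncard using Nat.strong_induction_on
    generalizing T A s C with
  | _ n ih =>
    have hR : ReturnsBelow G Q L S {a | Sum.inl a ∈ A}.ncard :=
      fun T' A' s' C' hI' hF' hlt => ih _ (hn ▸ hlt) hI' hF' rfl
    clear ih hn
    induction hq : s.queue generalizing s with
    | nil =>
      -- An empty queue means that nothing is left, so no vertex of the component is white and the
      -- negative answer is impossible.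
      have hT : T = ∅ := by
        by_contra hT
        exact hI.exists_mem_queue hG hT hq
      subst hT
      have hno : ∀ a ∈ S, s.color (Sum.inl a) ≠ Color.white := fun a ha hc =>
        hI.model.inl_mem ((hI.white _ (Or.inl ⟨a, ha, rfl⟩)).1 hc)
      refine .step _ ⟨_, .componentYes L C S s hq hno⟩ fun c' hc' => ?_
      cases hc' with
      | skip _ _ _ _ _ _ hq' => rw [hq] at hq'; simp at hq'
      | take _ _ _ _ _ _ hq' => rw [hq] at hq'; simp at hq'
      | componentNo _ _ _ _ _ h =>
        obtain ⟨a, ha, hc⟩ := h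
        exact absurd hc (hno a ha)
      | componentYes => exact hnext C hF
    | cons u F ihq =>
      obtain ⟨u₀, hu₀, rfl, hd⟩ := hI.queue u (by rw [hq]; simp)
      have hwhite := hI.white (Sum.inl u₀) (Or.inl ⟨u₀, hu₀, rfl⟩)
      refine .step _ ?_ fun c' hc' => ?_
      · by_cases hc : s.color (Sum.inl u₀) = Color.white
        · have huA := hwhite.1 hc
          obtain ⟨a, ha, -, -, -, hua, -⟩ := hI.two_neighbors huA (hd huA)
          exact ⟨_, .take L C S s _ F hq hc a hua ((hI.white a (hI.valid a ha)).2 ha)⟩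
        · exact ⟨_, .skip L C S s _ F hq hc⟩
      cases hc' with
      | skip _ _ _ _ u' F' hq' hc =>
        rw [hq] at hq'
        obtain ⟨rfl, rfl⟩ := List.cons_eq_cons.1 hq'
        exact ihq (hI.skip hq fun h => hc (hwhite.2 h)) rfl
      | take _ _ _ _ u' F' hq' hc a hua hca =>
        rw [hq] at hq'
        obtain ⟨rfl, rfl⟩ := List.cons_eq_cons.1 hq'
        have huA := hwhite.1 hc
        have haA := (hI.white a (hI.adjValid _ _ hua)).1 hca
        exact (WalkX.init hI hq huA (hd huA) haA hua).returns hI hF hR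
      | componentNo _ _ _ _ hq' => rw [hq] at hq'; simp at hq'
      | componentYes _ _ _ _ hq' => rw [hq] at hq'; simp at hq'

theorem OuterInv.init [Finite V] (hS : TwoConnectedOn G S) (h3 : 3 ≤ S.ncard)
    {F : List (Node V)} (hF : IsInitialQueue G S F) :
    OuterInv G S S (Sum.inl '' S) (Work.init G S F) where
  model :=
    { mem_iff := by simp [Work.init]
      disj := by
        rintro _ ⟨a, -, rfl⟩ _ ⟨b, -, rfl⟩ v hv hv'
        simp only [Work.init, Sum.elim_inl, List.mem_singleton] at hv hv'
        rw [← hv, ← hv']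
      symm := by
        rintro p q ⟨a, ha, b, hb, rfl, rfl, hab⟩
        exact ⟨b, hb, a, ha, rfl, rfl, hab.symm⟩
      keyInl := fun _ => rfl
      adjInl := by
        rintro a b ha hb
        simp only [Set.mem_image, Sum.inl.injEq, exists_eq_right] at ha hb
        simp [Work.init, ha, hb]
      path := by simp }
  degInl _ _ := rfl
  degInr := by simp
  valid := by
    rintro _ ⟨a, ha, rfl⟩
    exact Or.inl ⟨a, ha, rfl⟩
  white := by
    rintro p (⟨a, ha, rfl⟩ | ⟨k, hk, -⟩)
    · simp [Work.init, ha]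
    · simp [Work.init] at hk
  adjValid := by
    rintro p q ⟨a, ha, b, hb, rfl, rfl, hab⟩
    exact Or.inl ⟨b, hb, rfl⟩
  queue p hp := by
    obtain ⟨a, ha, rfl, hd⟩ := (hF.2 p).1 hp
    exact ⟨a, ha, rfl, fun _ => hd⟩
  mem_queue a ha hd := by
    simp only [Set.mem_image, Sum.inl.injEq, exists_eq_right] at ha
    exact (hF.2 _).2 ⟨a, ha, rfl, hd⟩
  subset := subset_rfl
  twoConnected := Or.inr ⟨hS, h3⟩

theorem exists_isInitialQueue [Finite V] (G : SimpleGraph V) (S : Set V) :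
    ∃ F, IsInitialQueue G S F := by
  have hfin : {p : Node V | ∃ a ∈ S, p = Sum.inl a ∧ (G.neighborSet a ∩ S).ncard = 2}.Finite := by
    refine (Set.toFinite (Sum.inl '' (Set.univ : Set V))).subset ?_
    rintro _ ⟨a, -, rfl, -⟩
    exact ⟨a, trivial, rfl⟩
  exact ⟨hfin.toFinset.toList, Finset.nodup_toList _, by simp⟩

theorem Found.returns [Fintype V] (hG : CyclicallyOrientable G)
    (hQ : ∀ C, Found G [] C ∅ → Q (.yes C)) (hL : ∀ S ∈ L, TwoConnectedOn G S ∧ 3 ≤ S.ncard)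
    (hF : Found G L C ∅) : EveryRunReturns G Q (.components L C) := by
  induction L generalizing C with
  | nil =>
    refine .step _ ⟨_, .answerYes C⟩ fun c' hc' => ?_
    cases hc' with
    | answerYes => exact .returned _ (hQ C hF)
  | cons S L ih =>
    refine .step _ ?_ fun c' hc' => ?_
    · obtain ⟨F, hF⟩ := exists_isInitialQueue G S
      exact ⟨_, .nextComponent L C S F hF⟩
    cases hc' with
    | nextComponent _ _ _ F hq =>
      obtain ⟨hS, h3⟩ := hL S (by simp)
      refine (OuterInv.init hS h3 hq).returns hG
        (fun C' hC' => ih (fun S' hS' => hL S' (List.mem_cons_of_mem _ hS')) hC')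
        ⟨hF.sound, fun l hl => ?_⟩
      rcases hF.complete l hl with h | ⟨S', hS', h⟩ | h
      · exact Or.inl h
      · rcases List.mem_cons.1 hS' with rfl | hS'
        · exact Or.inr (Or.inr h)
        · exact Or.inr (Or.inl ⟨S', hS', h⟩)
      · obtain ⟨v, hv⟩ := hl.1.exists_mem
        exact absurd (h v hv) (by simp)

end

end COGraph

theorem theorem3 {V : Type*} [Fintype V] (G : SimpleGraph V)
    (hV : 2 ≤ Fintype.card V) (hG : COGraph.CyclicallyOrientable G) :
    COGraph.EveryRunReturns G
      (fun r => ∃ C : Set (List V), r = COGraph.Result.yes C ∧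
        (∀ c ∈ C, COGraph.IsChordlessCycle G c) ∧
        (∀ l, COGraph.IsChordlessCycle G l → ∃ c ∈ C, COGraph.SameCycle c l))
      COGraph.Config.start := by
  have hfew : ¬ (COGraph.TooManyEdges G Set.univ ∨
      ∃ S, COGraph.IsTwoConnectedComponent G S ∧ COGraph.TooManyEdges G S) := by
    rintro (h | ⟨S, hS, h⟩)
    · refine COGraph.not_tooManyEdges hG ?_ h
      rwa [Set.ncard_univ, Nat.card_eq_fintype_card]
    · exact COGraph.not_tooManyEdges hG hS.prop.two_le_ncard h
  refine .step _ ?_ fun c' hc' => ?_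
  · have hfin := Set.toFinite
      {S : Set V | COGraph.IsTwoConnectedComponent G S ∧ COGraph.numEdges G S ≠ 1}
    exact ⟨_, .accept hfin.toFinset.toList hfew (Finset.nodup_toList _) (by simp)⟩
  cases hc' with
  | reject h => exact absurd h hfew
  | accept L _ _ hmem =>
    refine COGraph.Found.returns hG ?_ ?_ ⟨by simp, fun l hl => ?_⟩
    · intro C hC
      refine ⟨C, rfl, hC.sound, fun l hl => ?_⟩
      rcases hC.complete l hl with h | ⟨S, hS, -⟩ | h
      · exact h
      · simp at hS
      · obtain ⟨v, hv⟩ := hl.1.exists_mem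
        exact absurd (h v hv) (by simp)
    · intro S hS
      obtain ⟨h1, h2⟩ := (hmem S).1 hS
      exact ⟨h1.prop, h1.prop.three_le_ncard h2⟩
    -- At the start every chordless cycle is still pending in one of the listed components.
    · obtain ⟨S, h1, h2, h3⟩ := hl.exists_component
      exact Or.inr (Or.inl ⟨S, (hmem S).2 ⟨h1, h2⟩, h3⟩)
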